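/- Let $k$ be a field of characteristic zero, $n\ge 1$, and $V$ a $k$-vector space of dimension $n$. For an $n$-dimensional linear subspace $U\subset \mathrm{Sym}^2V^\vee$ of quadratic forms such that the quadrics $Q_u\subset\mathbb P(V)$, $u\in U$, have empty intersection (as a scheme, i.e. over an algebraic closure of $k$), let $\mathcal B_i=\bigoplus_s \Lambda^{i-2s}V\otimes\mathcal O(s)$ be the Clifford sheaves on $\mathbb P(U)$: they are the sheaves associated with the Clifford algebra of the universal quadratic form over $\mathrm{Sym}^\bullet(U^\vee)$ (generated by $V$ over $\mathrm{Sym}^\bullet(U^\vee)$, with relations $v^2=q(v)\in U^\vee$, $q(v)(u)=u(v)$), where $V$ has weight $1$ and $U^\vee$ has weight $2$. The coordinate algebra of the minimal Clifford space $(\mathbb P(U),\mathcal B_0)$ is $$B_U=\bigoplus_{i\ge 0}\mathrm{Hom}_{\mathcal B_0}(\mathcal B_0,\mathcal B_i).$$ 1. Every graded component of $B_U$ is finite-dimensional and $$\sum_{i\ge 0}\dim (B_{U,i})\,z^i=\frac1{(1-z)^n}.$$ 2. All these algebras form a flat deformation family. Precisely, the subspaces $U$ as above are the $k$-points of an open subscheme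 $\mathrm{Gr}^\circ$ of the Grassmannian $\mathrm{Gr}(n,\mathrm{Sym}^2V^\vee)$: the condition of empty intersection is stable under base change, and for every commutative $k$-algebra $R$ and every $R$-point of the Grassmannian it defines an open subset of $\mathrm{Spec}\,R$. Any two $k$-points of $\mathrm{Gr}^\circ$ are specializations at two $k$-points of an $R$-point of $\mathrm{Gr}^\circ$ for some integral domain $R$ over $k$. For every commutative $k$-algebra $R$ and every $R$-point $\mathcal U$ of $\mathrm{Gr}^\circ$ the graded $R$-algebra $B_{\mathcal U}$, defined by the same construction on $\mathbb P_R(\mathcal U)$, is flat over $R$, its component of degree $i$ is finitely generated projective of rank $\binom{n+i-1}{i}$, and for every commutative $R$-algebra $R'$ there is an isomorphism of graded $R'$-algebras $R'\otimes_R B_{\mathcal U}\cong B_{\mathcal U'}$, where $\mathcal U'$ is the base change of $\mathcal U$ to $R'$, which is the identity on the vectors $v\in V$ in degree one. In particular the fibre of the family at a point $[U]$ of $\mathrm{Gr}^\circ(k)$ is $B_U$. -/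

import Mathlib

open TensorProduct DirectSum TopologicalSpace

universe u

noncomputable section

/-! ## The grading of the symmetric algebra -/

namespace SymGrading

variable (R L : Type*) [CommRing R] [AddCommGroup L] [Module R L]

/-- The degree `d` part `Sym^d L` of the symmetric algebra: the span of the `d`-fold products of
elements of `L`. -/
def part (d : ℕ) : Submodule R (SymmetricAlgebra R L) :=
  LinearMap.range (SymmetricAlgebra.ι R L) ^ d

instance : SetLike.GradedMonoid (part R L) where
  one_mem := by simp [part]
  mul_mem i j a b ha hb := by
    unfold part at *
    rw [pow_add]
    exact Submodule.mul_mem_mul ha hb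

/-- The inclusion of `L` as the degree one part, with values in the direct sum of the parts. -/
def ιGraded : L →ₗ[R] ⨁ d : ℕ, part R L d :=
  DirectSum.lof R ℕ (fun d => part R L d) 1 ∘ₗ
    (SymmetricAlgebra.ι R L).codRestrict _ fun m => by
      simpa only [part, pow_one] using LinearMap.mem_range_self _ m

theorem ιGraded_apply (m : L) :
    ιGraded R L m = DirectSum.of (fun d => part R L d) 1
      ⟨SymmetricAlgebra.ι R L m, by
        simpa only [part, pow_one] using LinearMap.mem_range_self _ m⟩ :=
  rfl

instance : GradedAlgebra (part R L) :=
  GradedAlgebra.ofAlgHom _ (SymmetricAlgebra.lift (ιGraded R L))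
    (by
      ext m
      change DirectSum.coeAlgHom (part R L) (SymmetricAlgebra.lift (ιGraded R L)
        (SymmetricAlgebra.ι R L m)) = SymmetricAlgebra.ι R L m
      rw [SymmetricAlgebra.lift_ι_apply, ιGraded_apply R L, DirectSum.coeAlgHom_of])
    fun i x => by
    obtain ⟨x, hx⟩ := x
    dsimp only [Subtype.coe_mk, DirectSum.lof_eq_of]
    change x ∈ LinearMap.range (SymmetricAlgebra.ι R L) ^ i at hx
    induction hx using Submodule.pow_induction_on_left' with
    | algebraMap r =>
      rw [AlgHom.commutes, DirectSum.algebraMap_apply]; rfl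
    | add x y i hx hy ihx ihy =>
      rw [map_add, ihx, ihy, ← map_add]
      rfl
    | mem_mul m hm i x hx ih =>
      obtain ⟨_, rfl⟩ := hm
      rw [map_mul, ih, SymmetricAlgebra.lift_ι_apply, ιGraded_apply R L, DirectSum.of_mul_of]
      exact DirectSum.of_eq_of_gradedMonoid_eq (Sigma.subtype_ext (add_comm _ _) rfl)

end SymGrading

/-! ## The sheaves attached to an algebra over a graded ring

`S = ⨁ S_d` is a graded commutative `R`-algebra and `C` is an `S`-algebra, not necessarily
commutative, with subspaces `C_i` such that `S_d` has weight `2d` in `C`. To this one attaches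
sheaves `B_i` on `Proj S`: the sheaf `B_i` is the sheaf of `𝒪`-modules associated with the graded
`S`-module `⨁_d C_{i + 2d}`. -/

/-- `𝒞` makes `C` a weighted algebra over the graded ring `(S, 𝒮)`, with elements of `𝒮 d` having
weight `2 * d`. -/
class HalfGraded {R S C : Type*} [CommRing R] [CommRing S] [Algebra R S] [Ring C] [Algebra R C]
    [Algebra S C] (𝒮 : ℕ → Submodule R S) (𝒞 : ℕ → Submodule R C) : Prop
    extends SetLike.GradedMonoid 𝒞 where
  algebraMap_mem : ∀ (d : ℕ) (f : S), f ∈ 𝒮 d → algebraMap S C f ∈ 𝒞 (2 * d)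

namespace HalfGraded

variable {R S C : Type*} [CommRing R] [CommRing S] [Algebra R S] [Ring C] [Algebra R C]
  [Algebra S C] (𝒮 : ℕ → Submodule R S) [GradedAlgebra 𝒮]
  (𝒞 : ℕ → Submodule R C)

/-- The localization of `C` at a point of `Proj S`. It contains the stalks at this point of all the
sheaves `B_i`. -/
def Stalk (C : Type*) [Ring C] [Algebra S C] (x : ProjectiveSpectrum 𝒮) : Type _ :=
  LocalizedModule x.asHomogeneousIdeal.toIdeal.primeCompl C

instance (x : ProjectiveSpectrum 𝒮) : Ring (Stalk 𝒮 C x) :=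
  inferInstanceAs (Ring (LocalizedModule x.asHomogeneousIdeal.toIdeal.primeCompl C))

instance (x : ProjectiveSpectrum 𝒮) : Algebra S (Stalk 𝒮 C x) :=
  inferInstanceAs (Algebra S (LocalizedModule x.asHomogeneousIdeal.toIdeal.primeCompl C))

instance (x : ProjectiveSpectrum 𝒮) : Algebra R (Stalk 𝒮 C x) :=
  ((algebraMap S (Stalk 𝒮 C x)).comp (algebraMap R S)).toAlgebra' fun r c =>
    Algebra.commutes (algebraMap R S r) c

/-- The fraction `c / f` in the stalk at a point `x`. -/
def Stalk.mk {x : ProjectiveSpectrum 𝒮} (c : C)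
    (f : x.asHomogeneousIdeal.toIdeal.primeCompl) : Stalk 𝒮 C x :=
  LocalizedModule.mk c f

theorem Stalk.smul_eq {x : ProjectiveSpectrum 𝒮} (r : R) (s : Stalk 𝒮 C x) :
    r • s = algebraMap R S r • s := by
  rw [Algebra.smul_def, Algebra.smul_def]
  rfl

/-- The element `s` of the product of the stalks over `W` is, locally on `W`, a fraction `c / f`
with `f ∈ S_d` and `c ∈ C_{i + 2d}` for some `d`. -/
def IsSection (i : ℕ) (W : Opens (ProjectiveSpectrum 𝒮)) (s : ∀ x : W, Stalk 𝒮 C x.1) : Prop :=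
  ∀ x : W, ∃ V : Opens (ProjectiveSpectrum 𝒮), x.1 ∈ V ∧ ∃ (_ : V ≤ W) (d : ℕ) (c : C) (f : S),
    c ∈ 𝒞 (i + 2 * d) ∧ f ∈ 𝒮 d ∧ ∀ (y : W), y.1 ∈ V →
      ∃ hf : f ∈ y.1.asHomogeneousIdeal.toIdeal.primeCompl, s y = Stalk.mk 𝒮 c ⟨f, hf⟩

variable [HalfGraded 𝒮 𝒞]

theorem isSection_global {i : ℕ} {c : C} (hc : c ∈ 𝒞 i) (W : Opens (ProjectiveSpectrum 𝒮)) :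
    IsSection 𝒮 𝒞 i W (fun _ => Stalk.mk 𝒮 c 1) := by
  intro x
  refine ⟨W, x.2, le_rfl, 0, c, 1, by simpa using hc, SetLike.GradedOne.one_mem, fun y _ => ?_⟩
  exact ⟨Submonoid.one_mem _, rfl⟩

theorem isSection_one (W : Opens (ProjectiveSpectrum 𝒮)) :
    IsSection 𝒮 𝒞 0 W (1 : ∀ x : W, Stalk 𝒮 C x.1) := by
  have h := isSection_global 𝒮 𝒞 (SetLike.GradedOne.one_mem : (1 : C) ∈ 𝒞 0) W
  have e : (fun x : W => (Stalk.mk 𝒮 (1 : C) 1 : Stalk 𝒮 C x.1)) = 1 := by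
    funext x
    exact OreLocalization.one_def.symm
  rwa [e] at h

theorem IsSection.add {i : ℕ} {W : Opens (ProjectiveSpectrum 𝒮)} {s t : ∀ x : W, Stalk 𝒮 C x.1}
    (hs : IsSection 𝒮 𝒞 i W s) (ht : IsSection 𝒮 𝒞 i W t) : IsSection 𝒮 𝒞 i W (s + t) := by
  intro x
  obtain ⟨V, hxV, hVW, d, c, f, hc, hf, h⟩ := hs x
  obtain ⟨V', hxV', hVW', d', c', f', hc', hf', h'⟩ := ht x
  refine ⟨V ⊓ V', ⟨hxV, hxV'⟩, inf_le_left.trans hVW, d + d', f' • c + f • c', f * f', ?_,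
    SetLike.GradedMul.mul_mem hf hf', fun y hy => ?_⟩
  · refine Submodule.add_mem _ ?_ ?_
    · rw [Algebra.smul_def, show i + 2 * (d + d') = 2 * d' + (i + 2 * d) by ring]
      exact SetLike.GradedMul.mul_mem (HalfGraded.algebraMap_mem d' f' hf') hc
    · rw [Algebra.smul_def, show i + 2 * (d + d') = 2 * d + (i + 2 * d') by ring]
      exact SetLike.GradedMul.mul_mem (HalfGraded.algebraMap_mem d f hf) hc'
  · obtain ⟨h1, e1⟩ := h y hy.1
    obtain ⟨h2, e2⟩ := h' y hy.2
    refine ⟨Submonoid.mul_mem _ h1 h2, ?_⟩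
    rw [Pi.add_apply, e1, e2]
    exact LocalizedModule.mk_add_mk

theorem IsSection.mul {i j : ℕ} {W : Opens (ProjectiveSpectrum 𝒮)}
    {s t : ∀ x : W, Stalk 𝒮 C x.1} (hs : IsSection 𝒮 𝒞 i W s) (ht : IsSection 𝒮 𝒞 j W t) :
    IsSection 𝒮 𝒞 (i + j) W (s * t) := by
  intro x
  obtain ⟨V, hxV, hVW, d, c, f, hc, hf, h⟩ := hs x
  obtain ⟨V', hxV', hVW', d', c', f', hc', hf', h'⟩ := ht x
  refine ⟨V ⊓ V', ⟨hxV, hxV'⟩, inf_le_left.trans hVW, d + d', c * c', f * f', ?_,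
    SetLike.GradedMul.mul_mem hf hf', fun y hy => ?_⟩
  · rw [show i + j + 2 * (d + d') = (i + 2 * d) + (j + 2 * d') by ring]
    exact SetLike.GradedMul.mul_mem hc hc'
  · obtain ⟨h1, e1⟩ := h y hy.1
    obtain ⟨h2, e2⟩ := h' y hy.2
    refine ⟨Submonoid.mul_mem _ h1 h2, ?_⟩
    rw [Pi.mul_apply, e1, e2]
    exact LocalizedModule.mk_mul_mk

variable [IsScalarTower R S C]

theorem IsSection.smul {i : ℕ} {W : Opens (ProjectiveSpectrum 𝒮)} {s : ∀ x : W, Stalk 𝒮 C x.1}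
    (r : R) (hs : IsSection 𝒮 𝒞 i W s) : IsSection 𝒮 𝒞 i W (r • s) := by
  intro x
  obtain ⟨V, hxV, hVW, d, c, f, hc, hf, h⟩ := hs x
  refine ⟨V, hxV, hVW, d, r • c, f, Submodule.smul_mem _ r hc, hf, fun y hy => ?_⟩
  obtain ⟨h1, e1⟩ := h y hy
  refine ⟨h1, ?_⟩
  rw [Pi.smul_apply, e1, Stalk.smul_eq, ← algebraMap_smul S r c]
  exact LocalizedModule.smul'_mk _ _ _

/-- The module `B_i(W)` of sections over `W` of the sheaf `B_i`. -/
def Sec (i : ℕ) (W : Opens (ProjectiveSpectrum 𝒮)) : Submodule R (∀ x : W, Stalk 𝒮 C x.1) where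
  carrier := {s | IsSection 𝒮 𝒞 i W s}
  add_mem' := IsSection.add 𝒮 𝒞
  zero_mem' := by
    have h := isSection_global 𝒮 𝒞 (Submodule.zero_mem (𝒞 i)) W
    have e : (fun x : W => (Stalk.mk 𝒮 (0 : C) 1 : Stalk 𝒮 C x.1)) = 0 := by
      funext x
      exact LocalizedModule.zero_mk _
    rwa [e] at h
  smul_mem' r _ h := IsSection.smul 𝒮 𝒞 r h

variable {𝒮 𝒞}

/-- Restriction of sections from `W` to `W' ⊆ W`. -/
def Sec.res {i : ℕ} {W W' : Opens (ProjectiveSpectrum 𝒮)} (h : W' ≤ W) (s : Sec 𝒮 𝒞 i W) :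
    Sec 𝒮 𝒞 i W' :=
  ⟨fun x => s.1 ⟨x.1, h x.2⟩, fun x => by
    obtain ⟨V, hxV, _, d, c, f, hc, hf, hs⟩ := s.2 ⟨x.1, h x.2⟩
    exact ⟨V ⊓ W', ⟨hxV, x.2⟩, inf_le_right, d, c, f, hc, hf,
      fun y hy => hs ⟨y.1, h y.2⟩ hy.1⟩⟩

/-- The multiplication `B_i(W) × B_j(W) → B_{i+j}(W)`. For `j = 0` this is the right action on
`B_i` of the sheaf of algebras `B_0`, and for `i = j = 0` the multiplication of `B_0`. -/
def Sec.mul {i j : ℕ} {W : Opens (ProjectiveSpectrum 𝒮)} (s : Sec 𝒮 𝒞 i W) (t : Sec 𝒮 𝒞 j W) :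
    Sec 𝒮 𝒞 (i + j) W :=
  ⟨s.1 * t.1, IsSection.mul 𝒮 𝒞 s.2 t.2⟩

variable (𝒮 𝒞)

/-- The section of `B_i` over `W` given by an element of weight `i` of `C`. -/
def Sec.ofElem {i : ℕ} {c : C} (hc : c ∈ 𝒞 i) (W : Opens (ProjectiveSpectrum 𝒮)) : Sec 𝒮 𝒞 i W :=
  ⟨fun _ => Stalk.mk 𝒮 c 1, isSection_global 𝒮 𝒞 hc W⟩

/-- The unit section of the sheaf of algebras `B_0`. -/
def Sec.one (W : Opens (ProjectiveSpectrum 𝒮)) : Sec 𝒮 𝒞 0 W :=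
  ⟨1, isSection_one 𝒮 𝒞 W⟩

/-- `Hom_{B_0}(B_0, B_i)`: the morphisms of sheaves of right `B_0`-modules from `B_0` to `B_i`,
that is the families of maps `B_0(W) → B_i(W)`, for `W` open in `Proj S`, that are linear over
`B_0(W)` and compatible with restriction. -/
@[ext]
structure SheafHom (i : ℕ) where
  app : ∀ W : Opens (ProjectiveSpectrum 𝒮), Sec 𝒮 𝒞 0 W →ₗ[R] Sec 𝒮 𝒞 i W
  map_mul : ∀ (W : Opens (ProjectiveSpectrum 𝒮)) (a b : Sec 𝒮 𝒞 0 W),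
    app W (Sec.mul a b) = Sec.mul (app W a) b
  map_res : ∀ (W W' : Opens (ProjectiveSpectrum 𝒮)) (h : W' ≤ W) (a : Sec 𝒮 𝒞 0 W),
    app W' (Sec.res h a) = Sec.res h (app W a)

namespace SheafHom

variable {𝒮 𝒞}

theorem app_injective {i : ℕ} :
    Function.Injective (SheafHom.app : SheafHom 𝒮 𝒞 i → _) := fun _ _ h => SheafHom.ext h

theorem ext_val {i : ℕ} {φ ψ : SheafHom 𝒮 𝒞 i} (h : ∀ W a, (φ.app W a).1 = (ψ.app W a).1) :
    φ = ψ :=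
  SheafHom.ext (funext fun W => LinearMap.ext fun a => Subtype.ext (h W a))

instance (i : ℕ) : Zero (SheafHom 𝒮 𝒞 i) :=
  ⟨{app := fun _ => 0
    map_mul := fun _ _ _ => Subtype.ext (zero_mul _).symm
    map_res := fun _ _ _ _ => rfl}⟩

instance (i : ℕ) : Add (SheafHom 𝒮 𝒞 i) :=
  ⟨fun φ ψ =>
   {app := fun W => φ.app W + ψ.app W
    map_mul := fun W a b => Subtype.ext <| by
      have e1 := congrArg Subtype.val (φ.map_mul W a b)
      have e2 := congrArg Subtype.val (ψ.map_mul W a b)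
      exact (congrArg₂ (· + ·) e1 e2).trans (add_mul _ _ _).symm
    map_res := fun W W' h a => by
      rw [LinearMap.add_apply, φ.map_res, ψ.map_res]
      rfl}⟩

instance (i : ℕ) : SMul R (SheafHom 𝒮 𝒞 i) :=
  ⟨fun r φ =>
   {app := fun W => r • φ.app W
    map_mul := fun W a b => Subtype.ext <| by
      have e1 := congrArg Subtype.val (φ.map_mul W a b)
      exact (congrArg (r • ·) e1).trans (smul_mul_assoc _ _ _).symm
    map_res := fun W W' h a => by
      rw [LinearMap.smul_apply, φ.map_res]
      rfl}⟩

instance (i : ℕ) : Neg (SheafHom 𝒮 𝒞 i) :=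
  ⟨fun φ =>
   {app := fun W => - φ.app W
    map_mul := fun W a b => Subtype.ext <| by
      have e1 := congrArg Subtype.val (φ.map_mul W a b)
      exact (congrArg (- ·) e1).trans (neg_mul _ _).symm
    map_res := fun W W' h a => by
      rw [LinearMap.neg_apply, φ.map_res]
      rfl}⟩

theorem zero_val {i : ℕ} (W : Opens (ProjectiveSpectrum 𝒮)) (a : Sec 𝒮 𝒞 0 W) :
    ((0 : SheafHom 𝒮 𝒞 i).app W a).1 = 0 := rfl

theorem add_val {i : ℕ} (φ ψ : SheafHom 𝒮 𝒞 i) (W : Opens (ProjectiveSpectrum 𝒮))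
    (a : Sec 𝒮 𝒞 0 W) : ((φ + ψ).app W a).1 = (φ.app W a).1 + (ψ.app W a).1 := rfl

theorem neg_val {i : ℕ} (φ : SheafHom 𝒮 𝒞 i) (W : Opens (ProjectiveSpectrum 𝒮))
    (a : Sec 𝒮 𝒞 0 W) : ((-φ).app W a).1 = -(φ.app W a).1 := rfl

theorem smul_val {i : ℕ} (r : R) (φ : SheafHom 𝒮 𝒞 i) (W : Opens (ProjectiveSpectrum 𝒮))
    (a : Sec 𝒮 𝒞 0 W) : ((r • φ).app W a).1 = r • (φ.app W a).1 := rfl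

instance (i : ℕ) : AddCommGroup (SheafHom 𝒮 𝒞 i) where
  add_assoc φ ψ χ := ext_val fun W a => by simp only [add_val, add_assoc]
  zero_add φ := ext_val fun W a => by simp only [add_val, zero_val, zero_add]
  add_zero φ := ext_val fun W a => by simp only [add_val, zero_val, add_zero]
  add_comm φ ψ := ext_val fun W a => by simp only [add_val, add_comm]
  neg_add_cancel φ := ext_val fun W a => by
    simp only [add_val, neg_val, zero_val, neg_add_cancel]
  nsmul := nsmulRec
  zsmul := zsmulRec

instance (i : ℕ) : Module R (SheafHom 𝒮 𝒞 i) where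
  one_smul φ := ext_val fun W a => by simp only [smul_val, one_smul]
  mul_smul r s φ := ext_val fun W a => by simp only [smul_val, mul_smul]
  smul_zero r := ext_val fun W a => by simp only [smul_val, zero_val, smul_zero]
  smul_add r φ ψ := ext_val fun W a => by simp only [smul_val, add_val, smul_add]
  add_smul r s φ := ext_val fun W a => by simp only [smul_val, add_val, add_smul]
  zero_smul φ := ext_val fun W a => by simp only [smul_val, zero_val, zero_smul]

/-- Two morphisms with the same degree and the same values are equal. -/
theorem sigma_ext {i j : ℕ} (hij : i = j) (φ : SheafHom 𝒮 𝒞 i) (ψ : SheafHom 𝒮 𝒞 j)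
    (h : ∀ W a, (φ.app W a).1 = (ψ.app W a).1) :
    (⟨i, φ⟩ : GradedMonoid fun i => SheafHom 𝒮 𝒞 i) = ⟨j, ψ⟩ := by
  subst hij
  rw [ext_val h]

variable (𝒮 𝒞) in
/-- Left multiplication by an element of weight `i` of `C`, as a morphism `B_0 → B_i`. -/
def ofElem {i : ℕ} {c : C} (hc : c ∈ 𝒞 i) : SheafHom 𝒮 𝒞 i where
  app W :=
    { toFun := fun a => ⟨(Sec.ofElem 𝒮 𝒞 hc W).1 * a.1,
        IsSection.mul 𝒮 𝒞 (Sec.ofElem 𝒮 𝒞 hc W).2 a.2⟩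
      map_add' := fun _ _ => Subtype.ext (mul_add _ _ _)
      map_smul' := fun _ _ => Subtype.ext (mul_smul_comm _ _ _) }
  map_mul _ _ _ := Subtype.ext (mul_assoc _ _ _).symm
  map_res _ _ _ _ := rfl

/-- The product of `ψ : B_0 → B_i` and `φ : B_0 → B_j`: the composition of `φ` with the twist
`ψ ⊗ B_j : B_j = B_0 ⊗ B_j → B_i ⊗ B_j = B_{i+j}` of `ψ`, which sends a section `b` of `B_j` to
`ψ(1) b`. -/
def comp {i j : ℕ} (ψ : SheafHom 𝒮 𝒞 i) (φ : SheafHom 𝒮 𝒞 j) : SheafHom 𝒮 𝒞 (i + j) where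
  app W :=
    { toFun := fun a => Sec.mul (ψ.app W (Sec.one 𝒮 𝒞 W)) (φ.app W a)
      map_add' := fun a b => Subtype.ext (by
        rw [map_add]
        exact mul_add _ _ _)
      map_smul' := fun r a => Subtype.ext (by
        rw [map_smul]
        exact mul_smul_comm _ _ _) }
  map_mul W a b := Subtype.ext (by
    have e := congrArg Subtype.val (φ.map_mul W a b)
    exact (congrArg ((ψ.app W (Sec.one 𝒮 𝒞 W)).1 * ·) e).trans (mul_assoc _ _ _).symm)
  map_res W W' h a := by
    have e : Sec.one 𝒮 𝒞 W' = Sec.res h (Sec.one 𝒮 𝒞 W) := rfl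
    change Sec.mul _ _ = Sec.res h (Sec.mul _ _)
    rw [φ.map_res, e, ψ.map_res]
    rfl

theorem comp_val {i j : ℕ} (ψ : SheafHom 𝒮 𝒞 i) (φ : SheafHom 𝒮 𝒞 j)
    (W : Opens (ProjectiveSpectrum 𝒮)) (a : Sec 𝒮 𝒞 0 W) :
    ((ψ.comp φ).app W a).1 = (ψ.app W (Sec.one 𝒮 𝒞 W)).1 * (φ.app W a).1 := rfl

theorem app_eq {i : ℕ} (φ : SheafHom 𝒮 𝒞 i) (W : Opens (ProjectiveSpectrum 𝒮))
    (a : Sec 𝒮 𝒞 0 W) : (φ.app W a).1 = (φ.app W (Sec.one 𝒮 𝒞 W)).1 * a.1 := by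
  have e : Sec.mul (Sec.one 𝒮 𝒞 W) a = a := Subtype.ext (one_mul a.1)
  have h := congrArg Subtype.val (φ.map_mul W (Sec.one 𝒮 𝒞 W) a)
  rw [e] at h
  exact h

instance : GradedMonoid.GMul (fun i => SheafHom 𝒮 𝒞 i) where
  mul ψ φ := ψ.comp φ

instance : GradedMonoid.GOne (fun i => SheafHom 𝒮 𝒞 i) where
  one :=
    { app := fun _ => LinearMap.id
      map_mul := fun _ _ _ => rfl
      map_res := fun _ _ _ _ => rfl }

theorem one_val (W : Opens (ProjectiveSpectrum 𝒮)) (a : Sec 𝒮 𝒞 0 W) :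
    ((GradedMonoid.GOne.one : SheafHom 𝒮 𝒞 0).app W a).1 = a.1 := rfl

theorem sec_one_val (W : Opens (ProjectiveSpectrum 𝒮)) : (Sec.one 𝒮 𝒞 W).1 = 1 := rfl

theorem mul_val {i j : ℕ} (ψ : SheafHom 𝒮 𝒞 i) (φ : SheafHom 𝒮 𝒞 j)
    (W : Opens (ProjectiveSpectrum 𝒮)) (a : Sec 𝒮 𝒞 0 W) :
    ((GradedMonoid.GMul.mul ψ φ : SheafHom 𝒮 𝒞 (i + j)).app W a).1 =
      (ψ.app W (Sec.one 𝒮 𝒞 W)).1 * (φ.app W a).1 := rfl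

instance : GradedMonoid.GMonoid (fun i => SheafHom 𝒮 𝒞 i) where
  one_mul := by
    rintro ⟨i, φ⟩
    refine sigma_ext (zero_add i) _ _ fun W a => ?_
    exact one_mul (φ.app W a).1
  mul_one := by
    rintro ⟨i, φ⟩
    refine sigma_ext (add_zero i) _ _ fun W a => ?_
    exact (app_eq φ W a).symm
  mul_assoc := by
    rintro ⟨i, φ⟩ ⟨j, ψ⟩ ⟨l, χ⟩
    refine sigma_ext (add_assoc i j l) _ _ fun W a => ?_
    exact mul_assoc (φ.app W (Sec.one 𝒮 𝒞 W)).1 (ψ.app W (Sec.one 𝒮 𝒞 W)).1 (χ.app W a).1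

instance : DirectSum.GSemiring (fun i => SheafHom 𝒮 𝒞 i) where
  mul_zero _ := ext_val fun _ _ => by rw [mul_val, zero_val, zero_val, mul_zero]
  zero_mul _ := ext_val fun _ _ => by rw [mul_val, zero_val, zero_val, zero_mul]
  mul_add _ _ _ := ext_val fun _ _ => by
    rw [mul_val, add_val, add_val, mul_val, mul_val, mul_add]
  add_mul _ _ _ := ext_val fun _ _ => by
    rw [mul_val, add_val, add_val, mul_val, mul_val, add_mul]
  natCast n := n • (GradedMonoid.GOne.one : SheafHom 𝒮 𝒞 0)
  natCast_zero := zero_nsmul _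
  natCast_succ n := succ_nsmul _ n

variable (𝒮 𝒞) in
/-- The scalars, as morphisms `B_0 → B_0`. -/
def scalar : R →+ SheafHom 𝒮 𝒞 0 where
  toFun r := r • GradedMonoid.GOne.one
  map_zero' := by rw [zero_smul]
  map_add' r s := by rw [add_smul]

theorem scalar_val (r : R) (W : Opens (ProjectiveSpectrum 𝒮)) (a : Sec 𝒮 𝒞 0 W) :
    ((scalar 𝒮 𝒞 r).app W a).1 = r • a.1 := rfl

instance : DirectSum.GAlgebra R (fun i => SheafHom 𝒮 𝒞 i) where
  toFun := scalar 𝒮 𝒞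
  map_one := ext_val fun W a => by rw [scalar_val, one_smul, one_val]
  map_mul r s := by
    refine sigma_ext (add_zero 0).symm _ _ fun W a => ?_
    rw [mul_val, scalar_val, scalar_val, scalar_val, sec_one_val, mul_smul, smul_one_mul]
  commutes r := by
    rintro ⟨i, φ⟩
    refine sigma_ext ((zero_add i).trans (add_zero i).symm) _ _ fun W a => ?_
    refine (mul_val (scalar 𝒮 𝒞 r) φ W a).trans (Eq.trans ?_ (mul_val φ (scalar 𝒮 𝒞 r) W a).symm)
    rw [scalar_val, scalar_val, sec_one_val, smul_one_mul, mul_smul_comm, ← app_eq φ W a]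
  smul_def r := by
    rintro ⟨i, φ⟩
    refine sigma_ext (zero_add i).symm _ _ fun W a => ?_
    refine (smul_val r φ W a).trans (Eq.trans ?_ (mul_val (scalar 𝒮 𝒞 r) φ W a).symm)
    rw [scalar_val, sec_one_val, smul_one_mul]

end SheafHom

end HalfGraded

/-! ## Families of quadrics

`V` is a vector space over a field `k` of characteristic zero. For a commutative `k`-algebra `A`,
the `A`-module `QuadraticMap k V A` is `A ⊗ Sym² V^∨`, the module of quadratic forms on `V` with
coefficients in `A`; for `A = k` it is `Sym² V^∨ = QuadraticForm k V`. -/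

namespace Quadrics

variable {k V : Type*} [Field k] [CharZero k] [AddCommGroup V] [Module k V]

/-- `A ⊗ Sym² V^∨`: the quadratic forms on `V` with coefficients in the `k`-algebra `A`. For `A = k`
these are the quadratic forms on `V`. -/
abbrev QuadForms (k V A : Type*) [Field k] [AddCommGroup V] [Module k V] [CommRing A]
    [Algebra k A] : Type _ :=
  QuadraticMap k V A

/-- A quadratic form on `V` with coefficients in `A`, as a quadratic form on `A ⊗ V` over `A`:
it sends `a ⊗ v` to `a² q(v)`. -/
def extend (A : Type*) [CommRing A] [Algebra k A] (q : QuadForms k V A) :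
    QuadraticForm A (A ⊗[k] V) :=
  (Algebra.TensorProduct.lmul'' k (S := A)).toLinearMap.compQuadraticMap
    (QuadraticMap.tmul (QuadraticMap.sq (R := A)) q)

theorem extend_tmul (A : Type*) [CommRing A] [Algebra k A] (q : QuadForms k V A) (a : A)
    (v : V) : extend A q (a ⊗ₜ v) = a * a * q v := by
  simp only [extend, LinearMap.compQuadraticMap_apply, QuadraticMap.tensorDistrib_tmul,
    QuadraticMap.sq_apply]
  exact Algebra.TensorProduct.lmul'_apply_tmul _ _

variable {R : Type*} [CommRing R] [Algebra k R]

/-- The change of coefficients of a family of quadratic forms along `e : R → R'`. -/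
def pullback {R' : Type*} [CommRing R'] [Algebra k R'] (e : R →ₐ[k] R')
    (U : Submodule R (QuadForms k V R)) : Submodule R' (QuadForms k V R') :=
  Submodule.span R' ((fun q => e.toLinearMap.compQuadraticMap q) '' (U : Set (QuadForms k V R)))

/-- The intersection in `ℙ(V_K)` of the quadrics from a linear system `U` over a field `K` is empty
(as a scheme: the quadrics have no common point over an algebraic closure of `K`). -/
def EmptyIntersection {K : Type*} [Field K] [Algebra k K] (U : Submodule K (QuadForms k V K)) :
    Prop :=
  ∀ x : AlgebraicClosure K ⊗[k] V,
    (∀ q ∈ U, extend (AlgebraicClosure K)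
      ((IsScalarTower.toAlgHom k K (AlgebraicClosure K)).toLinearMap.compQuadraticMap q) x = 0) →
    x = 0

/-- The fibre at `p ∈ Spec R` of a family `U` of linear systems of quadrics over `Spec R` has empty
intersection. -/
def EmptyIntersectionAt (U : Submodule R (QuadForms k V R)) (p : PrimeSpectrum R) : Prop :=
  EmptyIntersection (pullback (IsScalarTower.toAlgHom k R p.asIdeal.ResidueField) U)

/-- `U` is an `R`-point of the Grassmannian `Gr(n, Sym² V^∨)`: a submodule of `R ⊗ Sym² V^∨` which
is locally a direct summand, of rank `n`. -/
structure IsGrassmannianPoint (n : ℕ) (U : Submodule R (QuadForms k V R)) : Prop where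
  projective_quotient : Module.Projective R (QuadForms k V R ⧸ U)
  rank_eq : ∀ p : PrimeSpectrum R, Module.rankAtStalk U p = n

/-- `U` is an `R`-point of the locus in `Gr(n, Sym² V^∨)` of the linear systems of quadrics with
empty intersection. -/
structure IsCliffordPoint (n : ℕ) (U : Submodule R (QuadForms k V R)) : Prop
    extends IsGrassmannianPoint n U where
  emptyIntersection : ∀ p : PrimeSpectrum R, EmptyIntersectionAt U p

end Quadrics

/-! ## Clifford spaces -/

namespace CliffordSpace

open Quadrics

variable {k V R : Type*} [Field k] [CharZero k] [AddCommGroup V] [Module k V] [CommRing R]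
  [Algebra k R] (U : Submodule R (QuadForms k V R))

/-- The homogeneous coordinate ring `Sym(U^∨)` of `ℙ(U)`. -/
abbrev CoordRing : Type _ := SymmetricAlgebra R (Module.Dual R U)

/-- The grading of `Sym(U^∨)`. -/
abbrev coordGrading : ℕ → Submodule R (CoordRing U) := SymGrading.part R (Module.Dual R U)

/-- The quadratic map `q : V → U^∨` dual to the embedding of `U` into the space of quadratic forms:
`q(v)(u) = u(v)`. -/
def tautological : QuadraticMap k V (Module.Dual R U) where
  toFun v :=
    { toFun := fun u => u.1 v
      map_add' := fun _ _ => rfl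
      map_smul' := fun _ _ => rfl }
  toFun_smul a v := LinearMap.ext fun u => QuadraticMap.map_smul u.1 a v
  exists_companion' :=
    ⟨LinearMap.mk₂ k (fun v w =>
      { toFun := fun u => QuadraticMap.polar u.1 v w
        map_add' := fun u u' => QuadraticMap.polar_add u.1 u'.1 v w
        map_smul' := fun r u => QuadraticMap.polar_smul u.1 r v w })
      (fun v v' w => LinearMap.ext fun u => QuadraticMap.polar_add_left u.1 v v' w)
      (fun a v w => LinearMap.ext fun u => QuadraticMap.polar_smul_left u.1 a v w)
      (fun v w w' => LinearMap.ext fun u => QuadraticMap.polar_add_right u.1 v w w')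
      (fun a v w => LinearMap.ext fun u => QuadraticMap.polar_smul_right u.1 a v w),
     fun v w => LinearMap.ext fun u => by
      change u.1 (v + w) = u.1 v + u.1 w + QuadraticMap.polar u.1 v w
      simp [QuadraticMap.polar]⟩

/-- The universal quadratic form of the family, on `Sym(U^∨) ⊗ V` with values in `Sym(U^∨)`. -/
def form : QuadraticForm (CoordRing U) (CoordRing U ⊗[k] V) :=
  extend (CoordRing U)
    (((SymmetricAlgebra.ι R (Module.Dual R U)).restrictScalars k).compQuadraticMap
      (tautological U))

/-- The Clifford algebra of the universal quadratic form: the algebra over `Sym(U^∨)` generated by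
`V` with relations `v² = q(v) ∈ U^∨`. -/
abbrev Cliff : Type _ := CliffordAlgebra (form U)

/-- The generators `v ∈ V` of the Clifford algebra. -/
def gen (v : V) : Cliff U := CliffordAlgebra.ι (form U) (1 ⊗ₜ v)

/-- The weights on the Clifford algebra: `V` has weight `1`, `U^∨` has weight `2`. The part of
weight `i` corresponds to `⨁_s Λ^{i-2s} V ⊗ Sym^s(U^∨)`. -/
def weight (i : ℕ) : Submodule R (Cliff U) :=
  Submodule.span R {c | ∃ (s : ℕ) (f : CoordRing U) (l : List V), f ∈ coordGrading U s ∧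
    l.length + 2 * s = i ∧ c = algebraMap (CoordRing U) (Cliff U) f * (l.map (gen U)).prod}

theorem gen_mem (v : V) : gen U v ∈ weight U 1 :=
  Submodule.subset_span ⟨0, 1, [v], SetLike.GradedOne.one_mem, rfl, by simp⟩

instance : HalfGraded (coordGrading U) (weight U) where
  one_mem := Submodule.subset_span ⟨0, 1, [], SetLike.GradedOne.one_mem, rfl, by simp⟩
  mul_mem i j a b ha hb := by
    have h : weight U i * weight U j ≤ weight U (i + j) := by
      unfold weight
      rw [Submodule.span_mul_span, Submodule.span_le]
      rintro _ ⟨_, ⟨s, f, l, hf, hl, rfl⟩, _, ⟨s', f', l', hf', hl', rfl⟩, rfl⟩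
      refine Submodule.subset_span ⟨s + s', f * f', l ++ l', SetLike.GradedMul.mul_mem hf hf', ?_, ?_⟩
      · rw [List.length_append]
        omega
      · simp only [map_mul, List.map_append, List.prod_append]
        rw [mul_assoc, mul_assoc, ← mul_assoc _ (algebraMap _ _ f'), ← mul_assoc _ (List.prod _),
          Algebra.commutes f']
    exact h (Submodule.mul_mem_mul ha hb)
  algebraMap_mem d f hf := Submodule.subset_span ⟨d, f, [], hf, by simp, by simp⟩

/-- The component `Hom_{B_0}(B_0, B_i)` of degree `i` of the coordinate algebra. -/
def Component (i : ℕ) : Type _ := HalfGraded.SheafHom (coordGrading U) (weight U) i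

instance (i : ℕ) : AddCommGroup (Component U i) :=
  inferInstanceAs (AddCommGroup (HalfGraded.SheafHom (coordGrading U) (weight U) i))

instance (i : ℕ) : Module R (Component U i) :=
  inferInstanceAs (Module R (HalfGraded.SheafHom (coordGrading U) (weight U) i))

instance : DirectSum.GSemiring (Component U) :=
  inferInstanceAs (DirectSum.GSemiring (HalfGraded.SheafHom (coordGrading U) (weight U)))

instance : DirectSum.GAlgebra R (Component U) :=
  inferInstanceAs (DirectSum.GAlgebra R (HalfGraded.SheafHom (coordGrading U) (weight U)))

/-- The graded coordinate algebra `⨁_{i ≥ 0} Hom_{B_0}(B_0, B_i)` of the Clifford space. -/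
def CoordAlgebra : Type _ := ⨁ i : ℕ, Component U i

instance : Semiring (CoordAlgebra U) := inferInstanceAs (Semiring (⨁ i : ℕ, Component U i))

instance : Algebra R (CoordAlgebra U) := inferInstanceAs (Algebra R (⨁ i : ℕ, Component U i))

/-- The inclusion of the component of degree `i` in the coordinate algebra. -/
def incl (i : ℕ) : Component U i →ₗ[R] CoordAlgebra U :=
  DirectSum.lof R ℕ (Component U) i

/-- The elements of degree one of the coordinate algebra given by vectors of `V`, which are global
sections of `B_1 = (V ⊗ 𝒪) ⊕ …`. -/
def vector (v : V) : CoordAlgebra U :=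
  incl U 1 (HalfGraded.SheafHom.ofElem (coordGrading U) (weight U) (gen_mem U v))

/-- The Hilbert series `∑ dim(B_{U,i}) z^i` of the coordinate algebra of the Clifford space of a
linear system of quadrics over `k`. -/
def hilbertSeries (U : Submodule k (QuadForms k V k)) : PowerSeries ℚ :=
  PowerSeries.mk fun i => (Module.finrank k (Component U i) : ℚ)

end CliffordSpace

end

/-!
Write `S = Sym(U^∨)` and let `C` be the Clifford algebra of the universal quadratic form over `S`.

**The coordinate algebra is `C`.** A morphism of right `B_0`-modules `B_0 → B_i` is left
multiplication by its value at `1`, so `Hom_{B_0}(B_0, B_i)` is the module of global sections of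
`B_i` on `ℙ(U) = Proj S`. As an `S`-module `C` has a basis `b_I` indexed by the subsets `I` of a
basis of `V`, homogeneous with `b_I` of weight `|I|` (`CliffordSpace.basis`,
`CliffordSpace.basis_mem`): it is obtained from the exterior algebra by deforming along a bilinear
form with values of degree one. Hence `B_i` is the sum of the line bundles `𝒪(s)` indexed by the `I`
with `|I| + 2s = i`, and its global sections form the part of `C` of weight `i`, as soon as the
negative twists contribute nothing. This is automatic for `n > 1`; for `n = 1` only the weights
`|I| ≤ 1` occur, so that no `s` is negative. In the proof a section is multiplied by powers of local
coordinates on `U^∨` to come from `C`; the results agree as sections and are divided again by these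
powers, because polynomials `f_j` of one degree, at least `M` in the case of one variable, with
`X_k^M f_j = X_j^M f_k` are the multiples `X_j^M g` of one polynomial `g`
(`MvPolynomial.exists_eq_X_pow_mul_of_symm`). The denominators in `R` that this
requires generate the unit ideal (`HalfGraded.exists_eq_toStalk`). The outcome is
`HalfGraded.ofElemHom_bijective`, and `CliffordSpace.coordAlgebraEquiv` is the resulting isomorphism
of graded algebras, which is the identity on `V`.

**Flatness and base change.** With its basis over `S`, which is projective over `R`, the algebra `C`
is projective over `R`, and so are its weight components. As `U` is locally a direct summand, `V`
spans `U^∨` (`CliffordSpace.span_tautological`), so `C` is generated over `R` by `V`. Both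
`R' ⊗ C_U` and the Clifford algebra of the base change of `U` have the universal property of
`CliffordSpace.exists_algHom`, and the two homomorphisms that it provides are inverse to each other
on `V` (`CliffordSpace.exists_baseChangeEquiv`).

**Ranks.** By base change to residue fields it is enough to count over a field. The products of the
monomials `x^m` in a basis of `U^∨` with the `b_I` have weight `2|m| + |I|`, and correspond to the
exponent vectors `2m + 1_I`, hence to the monomials in `n` variables of that degree; there are
`(n + i - 1).choose i` of them in weight `i` (`CliffordSpace.finrank_weight`).

**The base of the family.** By the Nullstellensatz the quadrics have empty intersection if and only
if powers of all coordinates lie in the ideal that they generate. By Nakayama's lemma for the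
polynomials of one large degree this condition spreads out from a point of `Spec R` to a
neighbourhood (`Quadrics.emptyIntersectionAt_iff`), which gives openness and stability under base
change. Two linear systems are joined by linear interpolation between bases of them: over the
semilocal ring of the points `0` and `1` of the affine line the interpolating forms span a direct
summand with empty intersection everywhere, every point being a generization of `0` or of `1`
(`Quadrics.exists_family`).
-/

set_option linter.unusedSectionVars false

/-! ### Quadratic forms in coordinates -/

/-- `QuadraticMap.toBilin` is an upper triangular matrix of the quadratic map in a basis; unlike the
polar form it determines the map without division by two. -/
theorem QuadraticMap.eq_sum_toBilin {A M N ι : Type*} [CommRing A] [AddCommGroup M] [Module A M]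
    [AddCommGroup N] [Module A N] [Fintype ι] [LinearOrder ι] (q : QuadraticMap A M N)
    (b : Module.Basis ι A M) (v : M) :
    q v = ∑ i, ∑ j, (b.repr v i * b.repr v j) • q.toBilin b (b i) (b j) := by
  conv_lhs => rw [← QuadraticMap.toQuadraticMap_toBilin q b, ← b.sum_repr v]
  simp only [LinearMap.BilinMap.toQuadraticMap_apply, map_sum, LinearMap.sum_apply, map_smul,
    LinearMap.smul_apply, mul_smul, Finset.smul_sum]
  rw [Finset.sum_comm]
  refine Finset.sum_congr rfl fun i _ => Finset.sum_congr rfl fun j _ => ?_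
  rw [smul_comm]

namespace Quadrics

section Coordinates

variable {k V : Type*} [Field k] [CharZero k] [AddCommGroup V] [Module k V]
  {ι : Type*} [LinearOrder ι] (b : Module.Basis ι k V)
  {R : Type*} [CommRing R] [Algebra k R]

/-- The coefficients of a quadratic form with values in `R` in the basis `b` of `V`, as an upper
triangular matrix. -/
noncomputable def coeffs : QuadForms k V R →ₗ[R] ι → ι → R where
  toFun q i j := q.toBilin b (b i) (b j)
  map_add' q q' := by
    funext i j
    rw [QuadraticMap.add_toBilin]
    rfl
  map_smul' r q := by
    funext i j
    simp only [QuadraticMap.toBilin_apply, _root_.smul_apply, QuadraticMap.polar, smul_sub,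
      RingHom.id_apply, Pi.smul_apply, smul_ite, smul_zero]

theorem coeffs_apply (q : QuadForms k V R) (i j : ι) :
    coeffs b q i j = if i = j then q (b i) else
      if i < j then QuadraticMap.polar q (b i) (b j) else 0 :=
  QuadraticMap.toBilin_apply _ _ _ _

variable [Fintype ι]

theorem eq_sum_coeffs (q : QuadForms k V R) (v : V) :
    q v = ∑ i, ∑ j, algebraMap k R (b.repr v i * b.repr v j) * coeffs b q i j := by
  rw [QuadraticMap.eq_sum_toBilin q b v]
  exact Finset.sum_congr rfl fun i _ => Finset.sum_congr rfl fun j _ => Algebra.smul_def _ _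

/-- The quadratic form `∑ i j, m i j * x_i * x_j` with values in `R`. -/
noncomputable def ofCoeffs : (ι → ι → R) →ₗ[R] QuadForms k V R :=
  ∑ i, ∑ j, (LinearMap.toSpanSingleton R (QuadForms k V R)
    ((Algebra.linearMap k R).compQuadraticMap
      (QuadraticMap.linMulLin (b.coord i) (b.coord j)))) ∘ₗ
      LinearMap.proj j ∘ₗ LinearMap.proj (R := R) (φ := fun _ => ι → R) i

theorem ofCoeffs_apply (m : ι → ι → R) (v : V) :
    ofCoeffs b m v = ∑ i, ∑ j, algebraMap k R (b.repr v i * b.repr v j) * m i j := by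
  simp only [ofCoeffs, LinearMap.sum_apply, _root_.sum_apply]
  refine Finset.sum_congr rfl fun i _ => Finset.sum_congr rfl fun j _ => ?_
  simp [LinearMap.toSpanSingleton_apply, mul_comm]

theorem ofCoeffs_coeffs (q : QuadForms k V R) : ofCoeffs b (coeffs b q) = q :=
  QuadraticMap.ext fun v => by rw [ofCoeffs_apply, ← eq_sum_coeffs]

theorem coeffs_comp {R' : Type*} [CommRing R'] [Algebra k R'] (e : R →ₐ[k] R')
    (q : QuadForms k V R) (i j : ι) :
    coeffs b (e.toLinearMap.compQuadraticMap q) i j = e (coeffs b q i j) := by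
  simp only [coeffs_apply, LinearMap.compQuadraticMap_apply, AlgHom.toLinearMap_apply,
    QuadraticMap.polar]
  split_ifs <;> simp

theorem extend_eq_sum (A : Type*) [CommRing A] [Algebra k A] (q : QuadForms k V A)
    (x : A ⊗[k] V) : extend A q x =
      ∑ i, ∑ j, (b.baseChange A).repr x i * (b.baseChange A).repr x j * coeffs b q i j := by
  rw [QuadraticMap.eq_sum_toBilin (extend A q) (b.baseChange A) x]
  refine Finset.sum_congr rfl fun i _ => Finset.sum_congr rfl fun j _ => ?_
  rw [smul_eq_mul, QuadraticMap.toBilin_apply, coeffs_apply]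
  congr 1
  simp only [Module.Basis.baseChange_apply, QuadraticMap.polar, ← TensorProduct.tmul_add,
    extend_tmul, one_mul]

/-- The homogeneous polynomial of degree two defining a quadratic form. -/
noncomputable def toPoly (q : QuadForms k V R) : MvPolynomial ι R :=
  ∑ i, ∑ j, MvPolynomial.C (coeffs b q i j) * (MvPolynomial.X i * MvPolynomial.X j)

theorem toPoly_isHomogeneous (q : QuadForms k V R) : (toPoly b q).IsHomogeneous 2 :=
  MvPolynomial.IsHomogeneous.sum _ _ _ fun i _ => MvPolynomial.IsHomogeneous.sum _ _ _ fun j _ =>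
    (zero_add 2) ▸ (MvPolynomial.isHomogeneous_C ι _).mul
      ((MvPolynomial.isHomogeneous_X R i).mul (MvPolynomial.isHomogeneous_X R j))

theorem toPoly_comp {R' : Type*} [CommRing R'] [Algebra k R'] (e : R →ₐ[k] R')
    (q : QuadForms k V R) :
    toPoly b (e.toLinearMap.compQuadraticMap q) = (toPoly b q).map e.toRingHom := by
  simp [toPoly, coeffs_comp]

theorem toPoly_add (q q' : QuadForms k V R) : toPoly b (q + q') = toPoly b q + toPoly b q' := by
  simp [toPoly, add_mul, Finset.sum_add_distrib]

theorem toPoly_smul (r : R) (q : QuadForms k V R) :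
    toPoly b (r • q) = MvPolynomial.C r * toPoly b q := by
  simp [toPoly, Finset.mul_sum, mul_assoc]

/-- The value of a quadratic form at a point of `A ⊗ V` is the value of its polynomial at the
coordinates of the point. -/
theorem eval₂_toPoly {A : Type*} [CommRing A] [Algebra k A] (e : R →ₐ[k] A)
    (q : QuadForms k V R) (x : A ⊗[k] V) :
    MvPolynomial.eval₂ e.toRingHom (fun i => (b.baseChange A).repr x i) (toPoly b q) =
      extend A (e.toLinearMap.compQuadraticMap q) x := by
  rw [extend_eq_sum b]
  simp only [toPoly, MvPolynomial.eval₂_sum, MvPolynomial.eval₂_mul, MvPolynomial.eval₂_C,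
    MvPolynomial.eval₂_X, coeffs_comp]
  exact Finset.sum_congr rfl fun i _ => Finset.sum_congr rfl fun j _ => mul_comm _ _

/-- The ideal of the intersection of the quadrics of a family. -/
noncomputable def polyIdeal (U : Submodule R (QuadForms k V R)) : Ideal (MvPolynomial ι R) :=
  Ideal.span (toPoly b '' U)

theorem polyIdeal_pullback {R' : Type*} [CommRing R'] [Algebra k R'] (e : R →ₐ[k] R')
    (U : Submodule R (QuadForms k V R)) :
    polyIdeal b (pullback e U) = (polyIdeal b U).map (MvPolynomial.map e.toRingHom) := by
  rw [polyIdeal, polyIdeal, Ideal.map_span]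
  apply le_antisymm
  · rw [Ideal.span_le]
    rintro _ ⟨q, hq, rfl⟩
    change q ∈ pullback e U at hq
    induction hq using Submodule.span_induction with
    | mem q hq =>
      obtain ⟨q, hq, rfl⟩ := hq
      refine Ideal.subset_span ⟨toPoly b q, ⟨q, hq, rfl⟩, ?_⟩
      exact (toPoly_comp b e q).symm
    | zero => simp [toPoly]
    | add q q' _ _ h h' => rw [toPoly_add]; exact add_mem h h'
    | smul r q _ h => rw [toPoly_smul]; exact Ideal.mul_mem_left _ _ h
  · rw [Ideal.span_le]
    rintro _ ⟨_, ⟨q, hq, rfl⟩, rfl⟩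
    refine Ideal.subset_span ⟨_, Submodule.subset_span ⟨q, hq, rfl⟩, toPoly_comp b e q⟩

/-- The projective Nullstellensatz: a linear system has empty intersection if and only if powers of
all the coordinates lie in the ideal that it generates. -/
theorem emptyIntersection_iff {K : Type*} [Field K] [Algebra k K]
    (U : Submodule K (QuadForms k V K)) :
    EmptyIntersection U ↔ ∀ i, MvPolynomial.X i ∈ (polyIdeal b U).radical := by
  have hz : ∀ x : AlgebraicClosure K ⊗[k] V,
      (∀ q ∈ U, extend (AlgebraicClosure K)
      ((IsScalarTower.toAlgHom k K (AlgebraicClosure K)).toLinearMap.compQuadraticMap q) x = 0) ↔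
      (fun i => (b.baseChange _).repr x i) ∈
        MvPolynomial.zeroLocus (AlgebraicClosure K) (polyIdeal b U) := by
    intro x
    rw [polyIdeal, MvPolynomial.zeroLocus_span]
    simp only [Set.mem_ofPred_eq, Set.forall_mem_image, ← eval₂_toPoly b]
    rfl
  have hr := MvPolynomial.vanishingIdeal_zeroLocus_eq_radical (K := AlgebraicClosure K)
    (polyIdeal b U)
  rw [← hr]
  constructor
  · intro h i x hx
    have := h ((b.baseChange (AlgebraicClosure K)).equivFun.symm x)
      ((hz _).2 (by
        convert hx using 1
        funext i
        exact congrFun ((b.baseChange (AlgebraicClosure K)).equivFun.apply_symm_apply x) i))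
    rw [LinearEquiv.map_eq_zero_iff] at this
    simp [this]
  · intro h x hx
    rw [← (b.baseChange (AlgebraicClosure K)).repr.map_eq_zero_iff]
    ext i
    simpa using h i _ ((hz x).1 hx)

end Coordinates

end Quadrics

/-! ### Spreading out the Nullstellensatz -/

section SpreadingOut

variable {ι R : Type*} [Fintype ι] [CommRing R]

/-- After multiplication by a denominator, a polynomial over the residue field that lies in the
extension of an ideal `I` is the reduction of an element of `I`. -/
theorem Ideal.exists_map_eq_C_mul_of_mem_map_residueField (I : Ideal (MvPolynomial ι R))
    (p : Ideal R) [p.IsPrime] {f : MvPolynomial ι p.ResidueField}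
    (hf : f ∈ I.map (MvPolynomial.map (algebraMap R p.ResidueField))) :
    ∃ r ∉ p, ∃ g ∈ I, MvPolynomial.map (algebraMap R p.ResidueField) g =
      MvPolynomial.C (algebraMap R p.ResidueField r) * f := by
  have hp1 : (1 : R) ∉ p := (Ideal.ne_top_iff_one p).1 (Ideal.IsPrime.ne_top ‹_›)
  have hadd : ∀ (J : Ideal (MvPolynomial ι R)) (f f' : MvPolynomial ι p.ResidueField),
      (∃ r ∉ p, ∃ g ∈ J, MvPolynomial.map (algebraMap R p.ResidueField) g =
        MvPolynomial.C (algebraMap R p.ResidueField r) * f) →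
      (∃ r ∉ p, ∃ g ∈ J, MvPolynomial.map (algebraMap R p.ResidueField) g =
        MvPolynomial.C (algebraMap R p.ResidueField r) * f') →
      (∃ r ∉ p, ∃ g ∈ J, MvPolynomial.map (algebraMap R p.ResidueField) g =
        MvPolynomial.C (algebraMap R p.ResidueField r) * (f + f')) := by
    rintro J f f' ⟨r, hr, g, hg, e⟩ ⟨r', hr', g', hg', e'⟩
    refine ⟨r * r', fun h => (Ideal.IsPrime.mem_or_mem ‹_› h).elim hr hr',
      MvPolynomial.C r' * g + MvPolynomial.C r * g',
      J.add_mem (J.mul_mem_left _ hg) (J.mul_mem_left _ hg'), ?_⟩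
    simp only [map_add, map_mul, MvPolynomial.map_C, e, e']
    ring
  -- For the unit ideal this is the clearing of denominators in the coefficients.
  have htop : ∀ f : MvPolynomial ι p.ResidueField, ∃ r ∉ p, ∃ g ∈ (⊤ : Ideal (MvPolynomial ι R)),
      MvPolynomial.map (algebraMap R p.ResidueField) g =
        MvPolynomial.C (algebraMap R p.ResidueField r) * f := by
    intro f
    induction f using MvPolynomial.induction_on with
    | C a =>
      obtain ⟨x, y, hy, rfl⟩ := IsFractionRing.div_surjective (A := R ⧸ p) a
      obtain ⟨x, rfl⟩ := Ideal.Quotient.mk_surjective x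
      obtain ⟨y, rfl⟩ := Ideal.Quotient.mk_surjective y
      have hy0 : Ideal.Quotient.mk p y ≠ 0 := nonZeroDivisors.ne_zero hy
      refine ⟨y, fun h => hy0 (Ideal.Quotient.eq_zero_iff_mem.2 h), MvPolynomial.C x, trivial, ?_⟩
      have hy1 : algebraMap R p.ResidueField y ≠ 0 := by
        rwa [Ne, Ideal.algebraMap_residueField_eq_zero, ← Ideal.Quotient.eq_zero_iff_mem]
      rw [MvPolynomial.map_C, ← map_mul]
      congr 1
      change algebraMap R p.ResidueField x = algebraMap R p.ResidueField y *
        (algebraMap R p.ResidueField x / algebraMap R p.ResidueField y)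
      field_simp
    | add f f' h h' => exact hadd ⊤ f f' h h'
    | mul_X f i h =>
      obtain ⟨r, hr, g, -, e⟩ := h
      exact ⟨r, hr, g * MvPolynomial.X i, trivial, by simp [e, mul_assoc]⟩
  rw [Ideal.map] at hf
  induction hf using Submodule.span_induction with
  | mem f hf =>
    obtain ⟨g, hg, rfl⟩ := hf
    exact ⟨1, hp1, g, hg, by simp⟩
  | zero => exact ⟨1, hp1, 0, I.zero_mem, by simp⟩
  | add f f' _ _ h h' => exact hadd I f f' h h'
  | smul a f _ h =>
    obtain ⟨r, hr, g, hg, e⟩ := h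
    obtain ⟨r', hr', g', -, e'⟩ := htop a
    refine ⟨r' * r, fun h => (Ideal.IsPrime.mem_or_mem ‹_› h).elim hr' hr, g' * g,
      I.mul_mem_left _ hg, ?_⟩
    simp only [map_mul, e, e', smul_eq_mul]
    ring

attribute [local instance] MvPolynomial.gradedAlgebra in
/-- If powers of the variables lie in the extension of a homogeneous ideal to the residue field at
`p`, then they do so over a neighbourhood of `p`. This is Nakayama's lemma for the quotient of the
polynomials of one large degree. -/
theorem Ideal.IsHomogeneous.exists_C_mul_X_pow_mem {I : Ideal (MvPolynomial ι R)}
    (hI : I.IsHomogeneous (MvPolynomial.homogeneousSubmodule ι R)) (p : Ideal R) [hp : p.IsPrime]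
    (h : ∀ i, MvPolynomial.X i ∈
      (I.map (MvPolynomial.map (algebraMap R p.ResidueField))).radical) :
    ∃ r ∉ p, ∃ N : ℕ, ∀ i, MvPolynomial.C r * MvPolynomial.X i ^ N ∈ I := by
  classical
  choose d hd using h
  set e := ∑ i, d i
  -- In degree `M` every monomial has an exponent larger than `e`, hence is divisible by some
  -- `X i ^ d i`.
  set M := Fintype.card ι * e + 1 with hM
  let φ := MvPolynomial.map (σ := ι) (algebraMap R p.ResidueField)
  have hmon : ∀ a : ι →₀ ℕ, a.degree = M → MvPolynomial.monomial a 1 ∈ I.map φ := by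
    intro a ha
    obtain ⟨i, hi⟩ : ∃ i, e < a i := by
      by_contra! hc
      have h1 : a.degree ≤ ∑ _i : ι, e := by
        rw [Finsupp.degree_eq_sum]
        exact Finset.sum_le_sum fun i _ => hc i
      simp only [Finset.sum_const, Finset.card_univ, smul_eq_mul] at h1
      omega
    have h2 : d i ≤ a i := (Finset.single_le_sum (fun _ _ => Nat.zero_le _)
      (Finset.mem_univ i)).trans hi.le
    have h3 : MvPolynomial.monomial a (1 : p.ResidueField) =
        MvPolynomial.monomial (a - Finsupp.single i (d i)) 1 * MvPolynomial.X i ^ d i := by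
      rw [MvPolynomial.X_pow_eq_monomial, MvPolynomial.monomial_mul, one_mul, tsub_add_cancel_of_le]
      simpa using h2
    rw [h3]
    exact Ideal.mul_mem_left _ _ (hd i)
  -- `P ⧸ J` is the part of degree `M` of the quotient by `I`, a finitely generated `R`-module.
  let P := MvPolynomial.homogeneousSubmodule ι R M
  have : Module.Finite R P := Module.Finite.of_fg (MvPolynomial.homogeneousSubmodule_fg ι R M)
  let J : Submodule R P := (I.restrictScalars R).comap P.subtype
  let mon : (ι →₀ ℕ) → P ⧸ J := fun a => if ha : a.degree = M then
    J.mkQ ⟨MvPolynomial.monomial a 1, MvPolynomial.isHomogeneous_monomial 1 ha⟩ else 0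
  have hsum : ∀ f : P, J.mkQ f = ∑ a ∈ f.1.support, f.1.coeff a • mon a := by
    intro f
    have h1 : f = ∑ a ∈ f.1.support.attach, f.1.coeff a.1 •
        (⟨MvPolynomial.monomial a.1 1, MvPolynomial.isHomogeneous_monomial 1
          (by
            have h := f.2 (MvPolynomial.mem_support_iff.1 a.2)
            rw [Finsupp.degree_eq_weight_one]
            exact h)⟩ : P) := by
      ext1
      rw [AddSubmonoidClass.coe_finsetSum]
      simp only [SetLike.val_smul, MvPolynomial.smul_monomial, smul_eq_mul, mul_one]
      conv_lhs => rw [f.1.as_sum, ← Finset.sum_attach]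
    conv_lhs => rw [h1]
    rw [map_sum, ← Finset.sum_attach f.1.support]
    refine Finset.sum_congr rfl fun a _ => ?_
    have h : a.1.degree = M := by
      rw [Finsupp.degree_eq_weight_one]
      exact f.2 (MvPolynomial.mem_support_iff.1 a.2)
    rw [map_smul]
    simp only [mon]
    rw [dif_pos h]
  -- The fibre of `P ⧸ J` at `p` is spanned by the monomials, which vanish there by `hmon`: a multiple
  -- of the monomial is congruent to an element of `I` modulo `p`.
  have hker : ∀ a, (1 : p.ResidueField) ⊗ₜ[R] mon a = 0 := by
    intro a
    by_cases ha : a.degree = M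
    swap
    · simp only [mon]
      rw [dif_neg ha, tmul_zero]
    obtain ⟨r, hr, g, hg, e⟩ := I.exists_map_eq_C_mul_of_mem_map_residueField p (hmon a ha)
    have hg' := MvPolynomial.homogeneousComponent_mem_of_mem hI hg M
    let g' : P := ⟨MvPolynomial.homogeneousComponent M g,
      MvPolynomial.homogeneousComponent_isHomogeneous M g⟩
    let m : P := ⟨MvPolynomial.monomial a 1, MvPolynomial.isHomogeneous_monomial 1 ha⟩
    have hm : J.mkQ m = mon a := by simp only [mon]; rw [dif_pos ha]
    have hc : ∀ b, algebraMap R p.ResidueField ((r • m - g').1.coeff b) = 0 := by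
      intro b
      have h1 : (r • m - g').1 = r • MvPolynomial.monomial a 1 -
        MvPolynomial.homogeneousComponent M g := rfl
      rw [h1, MvPolynomial.coeff_sub, MvPolynomial.coeff_homogeneousComponent,
        MvPolynomial.coeff_smul]
      have h2 := congrArg (MvPolynomial.coeff b) e
      rw [MvPolynomial.coeff_map, MvPolynomial.coeff_C_mul] at h2
      split_ifs with hb
      · rw [map_sub, h2, smul_eq_mul, map_mul]
        simp only [MvPolynomial.coeff_monomial]
        split_ifs <;> simp
      · rw [MvPolynomial.coeff_monomial, if_neg (by rintro rfl; exact hb ha)]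
        simp
    have h3 : (1 : p.ResidueField) ⊗ₜ[R] J.mkQ (r • m - g') = 0 := by
      rw [hsum, tmul_sum]
      refine Finset.sum_eq_zero fun b _ => ?_
      rw [tmul_smul, smul_tmul', Algebra.smul_def, hc, zero_mul, zero_tmul]
    have h4 : J.mkQ g' = 0 := by
      rw [Submodule.mkQ_apply, Submodule.Quotient.mk_eq_zero]
      exact hg'
    rw [map_sub, h4, sub_zero, map_smul, hm, tmul_smul, smul_tmul', Algebra.smul_def, mul_one] at h3
    have h5 : algebraMap R p.ResidueField r ≠ 0 := by
      rwa [Ne, Ideal.algebraMap_residueField_eq_zero]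
    have h6 := congrArg ((algebraMap R p.ResidueField r)⁻¹ • ·) h3
    simpa [smul_tmul', inv_mul_cancel₀ h5] using h6
  have hsup : (⟨p, hp⟩ : PrimeSpectrum R) ∉ Module.support R (P ⧸ J) := by
    rw [Module.mem_support_iff_nontrivial_residueField_tensorProduct, not_nontrivial_iff_subsingleton]
    refine ⟨fun x y => ?_⟩
    have hz : ∀ x : p.ResidueField ⊗[R] (P ⧸ J), x = 0 := by
      intro x
      induction x using TensorProduct.induction_on with
      | zero => rfl
      | add x y hx hy => rw [hx, hy, add_zero]
      | tmul z x =>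
        obtain ⟨f, rfl⟩ := J.mkQ_surjective x
        have : (1 : p.ResidueField) ⊗ₜ[R] J.mkQ f = 0 := by
          rw [hsum, tmul_sum]
          exact Finset.sum_eq_zero fun a _ => by rw [tmul_smul, hker, smul_zero]
        have h1 := congrArg (z • ·) this
        simpa [smul_tmul'] using h1
    exact (hz x).trans (hz y).symm
  -- Nakayama's lemma: as the fibre at `p` vanishes, some `r ∉ p` annihilates `P ⧸ J`.
  rw [Module.mem_support_iff_of_finite, SetLike.not_le_iff_exists] at hsup
  obtain ⟨r, hr, hrp⟩ := hsup
  refine ⟨r, hrp, M, fun i => ?_⟩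
  rw [Module.mem_annihilator] at hr
  let m : P := ⟨MvPolynomial.X i ^ M, MvPolynomial.isHomogeneous_X_pow i M⟩
  have h1 := hr (J.mkQ m)
  rw [← map_smul, Submodule.mkQ_apply, Submodule.Quotient.mk_eq_zero] at h1
  have h2 : r • (MvPolynomial.X i ^ M : MvPolynomial ι R) ∈ I := h1
  rwa [MvPolynomial.smul_eq_C_mul] at h2

end SpreadingOut

namespace Quadrics

variable {k V : Type*} [Field k] [CharZero k] [AddCommGroup V] [Module k V]
  {ι : Type*} [LinearOrder ι] [Fintype ι] (b : Module.Basis ι k V)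
  {R : Type*} [CommRing R] [Algebra k R]

attribute [local instance] MvPolynomial.gradedAlgebra in
theorem polyIdeal_isHomogeneous (U : Submodule R (QuadForms k V R)) :
    (polyIdeal b U).IsHomogeneous (MvPolynomial.homogeneousSubmodule ι R) := by
  refine Ideal.homogeneous_span _ _ ?_
  rintro _ ⟨q, -, rfl⟩
  exact ⟨2, toPoly_isHomogeneous b q⟩

theorem emptyIntersectionAt_iff_radical (U : Submodule R (QuadForms k V R)) (p : PrimeSpectrum R) :
    EmptyIntersectionAt U p ↔ ∀ i, MvPolynomial.X i ∈
      ((polyIdeal b U).map (MvPolynomial.map (algebraMap R p.asIdeal.ResidueField))).radical := by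
  rw [EmptyIntersectionAt, emptyIntersection_iff b, polyIdeal_pullback]
  rfl

/-- The quadrics have empty intersection at `p` if and only if, over a neighbourhood of `p`, powers
of all the coordinates lie in the ideal that they generate. -/
theorem emptyIntersectionAt_iff (U : Submodule R (QuadForms k V R)) (p : PrimeSpectrum R) :
    EmptyIntersectionAt U p ↔
      ∃ r ∉ p.asIdeal, ∃ N : ℕ, ∀ i, MvPolynomial.C r * MvPolynomial.X i ^ N ∈ polyIdeal b U := by
  rw [emptyIntersectionAt_iff_radical b]
  constructor
  · exact fun h => (polyIdeal_isHomogeneous b U).exists_C_mul_X_pow_mem p.asIdeal h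
  · rintro ⟨r, hr, N, h⟩ i
    refine ⟨N, ?_⟩
    have h1 := Ideal.mem_map_of_mem (MvPolynomial.map (algebraMap R p.asIdeal.ResidueField)) (h i)
    simp only [map_mul, MvPolynomial.map_C, map_pow, MvPolynomial.map_X] at h1
    have h2 : algebraMap R p.asIdeal.ResidueField r ≠ 0 := by
      rwa [Ne, Ideal.algebraMap_residueField_eq_zero]
    have h3 := Ideal.mul_mem_left _
      (MvPolynomial.C (algebraMap R p.asIdeal.ResidueField r)⁻¹) h1
    rwa [← mul_assoc, ← map_mul, inv_mul_cancel₀ h2, map_one, one_mul] at h3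

theorem isOpen_emptyIntersectionAt [FiniteDimensional k V] (U : Submodule R (QuadForms k V R)) :
    IsOpen {p : PrimeSpectrum R | EmptyIntersectionAt U p} := by
  rw [isOpen_iff_forall_mem_open]
  intro p hp
  let b := Module.finBasis k V
  obtain ⟨r, hr, N, h⟩ := (emptyIntersectionAt_iff b U p).1 hp
  exact ⟨PrimeSpectrum.basicOpen r, fun q hq => (emptyIntersectionAt_iff b U q).2 ⟨r, hq, N, h⟩,
    PrimeSpectrum.isOpen_basicOpen, hr⟩

theorem EmptyIntersectionAt.pullback [FiniteDimensional k V] {R' : Type*} [CommRing R']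
    [Algebra k R'] (e : R →ₐ[k] R') {U : Submodule R (QuadForms k V R)} {p : PrimeSpectrum R'}
    (h : EmptyIntersectionAt U (p.comap e.toRingHom)) :
    EmptyIntersectionAt (pullback e U) p := by
  let b := Module.finBasis k V
  obtain ⟨r, hr, N, h⟩ := (emptyIntersectionAt_iff b U _).1 h
  refine (emptyIntersectionAt_iff b _ p).2 ⟨e r, hr, N, fun i => ?_⟩
  rw [polyIdeal_pullback]
  have h1 := Ideal.mem_map_of_mem (MvPolynomial.map e.toRingHom) (h i)
  simpa using h1

end Quadrics

/-! ### Points of the Grassmannian and their base change -/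

theorem Submodule.projective_quotient_of_retraction {R M : Type*} [CommRing R] [AddCommGroup M]
    [Module R M] [Module.Projective R M] {U : Submodule R M} (π : M →ₗ[R] M) (h : ∀ x, π x ∈ U)
    (h' : ∀ u ∈ U, π u = u) : Module.Projective R (M ⧸ U) := by
  have h0 : U ≤ LinearMap.ker (LinearMap.id - π : M →ₗ[R] M) := fun u hu => by simp [h' u hu]
  refine Module.Projective.of_split (M := M) (U.liftQ _ h0) U.mkQ ?_
  refine Submodule.linearMap_qext _ (LinearMap.ext fun x => ?_)
  simp only [LinearMap.comp_apply, Submodule.mkQ_apply, Submodule.liftQ_apply,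
    LinearMap.sub_apply, LinearMap.id_apply]
  rw [Submodule.Quotient.eq]
  simpa using h x

theorem Submodule.exists_retraction {R M : Type*} [CommRing R] [AddCommGroup M]
    [Module R M] (U : Submodule R M) [Module.Projective R (M ⧸ U)] :
    ∃ ρ : M →ₗ[R] U, ∀ u : U, ρ u = u := by
  obtain ⟨s, hs⟩ := Module.projective_lifting_property U.mkQ LinearMap.id U.mkQ_surjective
  have h : ∀ x, (LinearMap.id - s ∘ₗ U.mkQ : M →ₗ[R] M) x ∈ U := by
    intro x
    rw [← Submodule.Quotient.mk_eq_zero, ← Submodule.mkQ_apply]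
    have := LinearMap.congr_fun hs (U.mkQ x)
    simp only [LinearMap.comp_apply, LinearMap.id_apply] at this
    simp only [LinearMap.sub_apply, LinearMap.id_apply, LinearMap.comp_apply, map_sub, this, sub_self]
  refine ⟨(LinearMap.id - s ∘ₗ U.mkQ : M →ₗ[R] M).codRestrict U h, fun u => ?_⟩
  · ext1
    simp [(Submodule.Quotient.mk_eq_zero U).2 u.2]

namespace Quadrics

variable {k V : Type*} [Field k] [CharZero k] [AddCommGroup V] [Module k V]

section Finite

variable [FiniteDimensional k V] {R : Type*} [CommRing R] [Algebra k R]

instance : Module.Projective R (QuadForms k V R) := by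
  let b := Module.finBasis k V
  exact Module.Projective.of_split (coeffs b) (ofCoeffs b) (LinearMap.ext (ofCoeffs_coeffs b))

instance : Module.Finite R (QuadForms k V R) := by
  let b := Module.finBasis k V
  exact Module.Finite.of_surjective (ofCoeffs b)
    (Function.LeftInverse.surjective (g := coeffs b) (ofCoeffs_coeffs b))

variable {U : Submodule R (QuadForms k V R)} {n : ℕ}

theorem IsGrassmannianPoint.projective (hU : IsGrassmannianPoint n U) : Module.Projective R U := by
  have := hU.projective_quotient
  obtain ⟨ρ, hρ⟩ := U.exists_retraction
  exact Module.Projective.of_split U.subtype ρ (LinearMap.ext hρ)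

theorem IsGrassmannianPoint.finite (hU : IsGrassmannianPoint n U) : Module.Finite R U := by
  have := hU.projective_quotient
  obtain ⟨ρ, hρ⟩ := U.exists_retraction
  exact Module.Finite.of_surjective ρ fun u => ⟨u, hρ u⟩

end Finite

section BaseChange

variable {R : Type*} [CommRing R] [Algebra k R] (R' : Type*) [CommRing R'] [Algebra k R']
  [Algebra R R'] [IsScalarTower k R R']

/-- The extension of coefficients of quadratic forms from `R` to `R'`. -/
def baseMap : QuadForms k V R →ₗ[R] QuadForms k V R' where
  toFun q := (IsScalarTower.toAlgHom k R R').toLinearMap.compQuadraticMap q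
  map_add' q q' := QuadraticMap.ext fun v => by simp
  map_smul' r q := QuadraticMap.ext fun v => by simp [Algebra.smul_def]

theorem baseMap_apply (q : QuadForms k V R) (v : V) :
    baseMap R' q v = algebraMap R R' (q v) := rfl

theorem coeffs_baseMap {ι : Type*} [LinearOrder ι] [Fintype ι] (b : Module.Basis ι k V)
    (q : QuadForms k V R) (i j : ι) :
    coeffs b (baseMap R' q) i j = algebraMap R R' (coeffs b q i j) :=
  coeffs_comp b _ q i j

/-- The base change of the module of quadratic forms: the quadratic forms over `R'` are spanned freely
by the same products of coordinates as those over `R`. -/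
theorem isBaseChange_baseMap [FiniteDimensional k V] :
    IsBaseChange R' (baseMap R' : QuadForms k V R →ₗ[R] QuadForms k V R') := by
  classical
  let b := Module.finBasis k V
  -- The product of the coordinates `i` and `j`. It depends only on the pair up to order, and `coeffs`
  -- is upper triangular, so that these forms span but are not linearly independent.
  let E : Fin (Module.finrank k V) → Fin (Module.finrank k V) → QuadForms k V R :=
    fun i j => ofCoeffs b (Pi.single i (Pi.single j 1))
  have hE : ∀ q : QuadForms k V R, q = ∑ i, ∑ j, coeffs b q i j • E i j := by
    intro q
    conv_lhs => rw [← ofCoeffs_coeffs b q]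
    simp only [E, ← map_smul, ← map_sum]
    congr 1
    funext i j
    simp [Finset.sum_apply, Pi.single_apply, ite_apply]
  have hE' : ∀ i j, baseMap R' (E i j) = ofCoeffs b (Pi.single i (Pi.single j 1)) := by
    intro i j
    refine QuadraticMap.ext fun v => ?_
    simp only [baseMap_apply, E, ofCoeffs_apply, map_sum, map_mul,
      ← IsScalarTower.algebraMap_apply k R R']
    refine Finset.sum_congr rfl fun i' _ => Finset.sum_congr rfl fun j' _ => ?_
    congr 1
    simp only [Pi.single_apply, ite_apply, Pi.zero_apply]
    split_ifs <;> simp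
  let g : QuadForms k V R' →ₗ[R'] R' ⊗[R] QuadForms k V R :=
    ∑ i, ∑ j, (LinearMap.toSpanSingleton R' _ (1 ⊗ₜ E i j)) ∘ₗ LinearMap.proj j ∘ₗ
      LinearMap.proj (R := R') (φ := fun _ => _ → R') i ∘ₗ coeffs b
  have hg : ∀ q, g q = ∑ i, ∑ j, coeffs b q i j ⊗ₜ E i j := by
    intro q
    simp [g, LinearMap.toSpanSingleton_apply, smul_tmul']
  refine IsBaseChange.of_equiv (LinearEquiv.ofLinearMap (LinearMap.liftBaseChange R' (baseMap R')) g
    (LinearMap.ext fun q => ?_) ?_) fun q => ?_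
  · have h1 : q = ∑ i, ∑ j, coeffs b q i j • ofCoeffs b (Pi.single i (Pi.single j 1)) := by
      conv_lhs => rw [← ofCoeffs_coeffs b q]
      simp only [← map_smul, ← map_sum]
      congr 1
      funext i j
      simp [Finset.sum_apply, Pi.single_apply, ite_apply]
    simp only [LinearMap.comp_apply, hg, map_sum, LinearMap.liftBaseChange_tmul, hE',
      LinearMap.id_apply]
    exact h1.symm
  · ext q
    simp only [AlgebraTensorModule.curry_apply, LinearMap.restrictScalars_comp, curry_apply,
      LinearMap.comp_apply, LinearMap.restrictScalars_apply, LinearMap.liftBaseChange_tmul, one_smul, hg,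
      LinearMap.id_apply, coeffs_baseMap]
    conv_rhs => rw [hE q]
    simp only [tmul_sum, tmul_smul, smul_tmul', Algebra.smul_def, mul_one]
  · simp

variable (U : Submodule R (QuadForms k V R))

/-- The extension of coefficients of the members of a family of linear systems. -/
def pullbackMap : U →ₗ[R] pullback (IsScalarTower.toAlgHom k R R') U where
  toFun u := ⟨baseMap R' u.1, Submodule.subset_span ⟨u.1, u.2, rfl⟩⟩
  map_add' u u' := Subtype.ext (map_add (baseMap R') u.1 u'.1)
  map_smul' r u := Subtype.ext (map_smul (baseMap R') r u.1)

theorem liftBaseChange_pullbackMap_surjective :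
    Function.Surjective (LinearMap.liftBaseChange R' (pullbackMap R' U)) := by
  rintro ⟨q, hq⟩
  obtain ⟨x, hx⟩ : ∃ x, (LinearMap.liftBaseChange R' (pullbackMap R' U) x).1 = q := by
    induction hq using Submodule.span_induction with
    | mem q hq =>
      obtain ⟨q, hq, rfl⟩ := hq
      exact ⟨1 ⊗ₜ ⟨q, hq⟩, by simp; rfl⟩
    | zero => exact ⟨0, by simp⟩
    | add q q' _ _ h h' =>
      obtain ⟨x, hx⟩ := h
      obtain ⟨y, hy⟩ := h'
      exact ⟨x + y, by simp [hx, hy]⟩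
    | smul r q _ h =>
      obtain ⟨x, hx⟩ := h
      exact ⟨r • x, by simp [hx]⟩
  exact ⟨x, Subtype.ext hx⟩

variable {U} {n : ℕ} [FiniteDimensional k V]

/-- A retraction of `R' ⊗ Sym² V^∨` onto the base change of a direct summand. -/
theorem exists_retraction_pullback [Module.Projective R (QuadForms k V R ⧸ U)] :
    ∃ ρ : QuadForms k V R' →ₗ[R'] R' ⊗[R] U, ∀ x : R' ⊗[R] U,
      ρ (LinearMap.liftBaseChange R' (pullbackMap R' U) x).1 = x := by
  obtain ⟨ρ, hρ⟩ := U.exists_retraction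
  have hb := isBaseChange_baseMap (k := k) (V := V) (R := R) R'
  refine ⟨hb.lift (TensorProduct.mk R R' U 1 ∘ₗ ρ), fun x => ?_⟩
  induction x using TensorProduct.induction_on with
  | zero => simp
  | add x y hx hy =>
    rw [map_add, Submodule.coe_add, map_add, hx, hy]
  | tmul r u =>
    rw [LinearMap.liftBaseChange_tmul, Submodule.coe_smul, map_smul]
    have : (pullbackMap R' U u).1 = baseMap R' u.1 := rfl
    rw [this, hb.lift_eq]
    simp [hρ, smul_tmul']

/-- As `U` is a direct summand, the submodule of `R' ⊗ Sym² V^∨` that it generates is its base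
change. -/
theorem isBaseChange_pullbackMap [Module.Projective R (QuadForms k V R ⧸ U)] :
    IsBaseChange R' (pullbackMap R' U) := by
  obtain ⟨ρ, hρ⟩ := exists_retraction_pullback R' (U := U)
  have h : Function.Bijective (LinearMap.liftBaseChange R' (pullbackMap R' U)) :=
    ⟨Function.LeftInverse.injective (g := ρ ∘ Subtype.val) hρ,
      liftBaseChange_pullbackMap_surjective R' U⟩
  refine IsBaseChange.of_equiv (LinearEquiv.ofBijective _ h) fun u => ?_
  rw [LinearEquiv.ofBijective_apply, LinearMap.liftBaseChange_tmul, one_smul]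

theorem rankAtStalk_pullback_toAlgHom [Module.Projective R (QuadForms k V R ⧸ U)]
    (p : PrimeSpectrum R') :
    Module.rankAtStalk (pullback (IsScalarTower.toAlgHom k R R') U) p =
      Module.rankAtStalk U (p.comap (algebraMap R R')) := by
  obtain ⟨ρ, hρ⟩ := U.exists_retraction
  have : Module.Projective R U := Module.Projective.of_split U.subtype ρ (LinearMap.ext hρ)
  have : Module.Finite R U := Module.Finite.of_surjective ρ fun u => ⟨u, hρ u⟩
  exact (Module.rankAtStalk_isBaseChange (isBaseChange_pullbackMap R' (U := U)) p)

theorem IsGrassmannianPoint.pullback_toAlgHom (hU : IsGrassmannianPoint n U) :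
    IsGrassmannianPoint n (pullback (IsScalarTower.toAlgHom k R R') U) := by
  have := hU.projective_quotient
  obtain ⟨ρ, hρ⟩ := exists_retraction_pullback R' (U := U)
  constructor
  · refine Submodule.projective_quotient_of_retraction
      (Submodule.subtype _ ∘ₗ LinearMap.liftBaseChange R' (pullbackMap R' U) ∘ₗ ρ)
      (fun q => Subtype.prop _) fun q hq => ?_
    obtain ⟨x, hx⟩ := liftBaseChange_pullbackMap_surjective R' U ⟨q, hq⟩
    have hx' := congrArg Subtype.val hx
    simp only at hx'
    simp only [LinearMap.comp_apply, Submodule.subtype_apply]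
    rw [← hx', hρ]
  · intro p
    rw [rankAtStalk_pullback_toAlgHom]
    exact hU.rank_eq _

theorem IsCliffordPoint.pullback_toAlgHom (hU : IsCliffordPoint n U) :
    IsCliffordPoint n (pullback (IsScalarTower.toAlgHom k R R') U) :=
  { hU.toIsGrassmannianPoint.pullback_toAlgHom R' with
    emptyIntersection := fun _ => EmptyIntersectionAt.pullback _ (hU.emptyIntersection _) }

end BaseChange

section Pullback

variable [FiniteDimensional k V] {R : Type*} [CommRing R] [Algebra k R] {R' : Type*} [CommRing R']
  [Algebra k R'] {U : Submodule R (QuadForms k V R)} {n : ℕ}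

theorem rankAtStalk_pullback [Module.Projective R (QuadForms k V R ⧸ U)] (e : R →ₐ[k] R')
    (p : PrimeSpectrum R') :
    Module.rankAtStalk (pullback e U) p = Module.rankAtStalk U (p.comap e.toRingHom) := by
  let := e.toRingHom.toAlgebra
  have : IsScalarTower k R R' := IsScalarTower.of_algebraMap_eq fun x => (e.commutes x).symm
  exact rankAtStalk_pullback_toAlgHom R' p

theorem IsCliffordPoint.pullback (hU : IsCliffordPoint n U) (e : R →ₐ[k] R') :
    IsCliffordPoint n (pullback e U) := by
  let := e.toRingHom.toAlgebra
  have : IsScalarTower k R R' := IsScalarTower.of_algebraMap_eq fun x => (e.commutes x).symm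
  exact hU.pullback_toAlgHom R'

end Pullback

/-- Over the base field the points of the locus are the linear systems of the right dimension with
empty intersection. -/
theorem isCliffordPoint_iff [FiniteDimensional k V] {n : ℕ} (U : Submodule k (QuadForms k V k)) :
    IsCliffordPoint n U ↔ Module.finrank k U = n ∧ EmptyIntersection U := by
  let b := Module.finBasis k V
  have := Module.Free.of_divisionRing k U
  have h0 : ∀ p : PrimeSpectrum k, EmptyIntersectionAt U p ↔ EmptyIntersection U := by
    intro p
    rw [emptyIntersectionAt_iff b, emptyIntersection_iff b]
    constructor
    · rintro ⟨r, hr, N, h⟩ i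
      refine ⟨N, ?_⟩
      have hr0 : r ≠ 0 := by
        rintro rfl
        exact hr (zero_mem _)
      have h3 := Ideal.mul_mem_left _ (MvPolynomial.C r⁻¹) (h i)
      rwa [← mul_assoc, ← map_mul, inv_mul_cancel₀ hr0, map_one, one_mul] at h3
    · intro h
      choose N hN using h
      refine ⟨1, (Ideal.ne_top_iff_one _).1 p.2.ne_top, ∑ i, N i, fun i => ?_⟩
      rw [map_one, one_mul]
      exact Ideal.pow_mem_of_pow_mem _ (hN i)
        (Finset.single_le_sum (fun _ _ => Nat.zero_le _) (Finset.mem_univ i))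
  constructor
  · intro h
    have h1 := h.rank_eq default
    rw [Module.rankAtStalk_eq_finrank_of_free] at h1
    exact ⟨h1, (h0 default).1 (h.emptyIntersection default)⟩
  · rintro ⟨h1, h2⟩
    refine ⟨⟨inferInstance, fun p => ?_⟩, fun p => (h0 p).2 h2⟩
    rw [Module.rankAtStalk_eq_finrank_of_free]
    exact h1

end Quadrics

/-! ### Connecting two linear systems -/

open Polynomial in
/-- The polynomials in one variable that vanish neither at `0` nor at `1`. -/
def Polynomial.nonvanishingZeroOne (k : Type*) [Field k] : Submonoid k[X] where
  carrier := {h | h.eval 0 ≠ 0 ∧ h.eval 1 ≠ 0}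
  one_mem' := by simp
  mul_mem' := by
    rintro f g ⟨h0, h1⟩ ⟨h0', h1'⟩
    exact ⟨by simp [h0, h0'], by simp [h1, h1']⟩

/-- The semilocal ring of the points `0` and `1` of the affine line. -/
def SemilocalLine (k : Type*) [Field k] : Type _ :=
  Localization (Polynomial.nonvanishingZeroOne k)

namespace SemilocalLine

open Polynomial

variable (k : Type*) [Field k]

noncomputable instance : CommRing (SemilocalLine k) :=
  inferInstanceAs (CommRing (Localization (Polynomial.nonvanishingZeroOne k)))

noncomputable instance : Algebra k[X] (SemilocalLine k) :=
  inferInstanceAs (Algebra k[X] (Localization (Polynomial.nonvanishingZeroOne k)))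

noncomputable instance : Algebra k (SemilocalLine k) :=
  ((algebraMap k[X] (SemilocalLine k)).comp C).toAlgebra

instance : IsScalarTower k k[X] (SemilocalLine k) := IsScalarTower.of_algebraMap_eq fun _ => rfl

instance : IsLocalization (Polynomial.nonvanishingZeroOne k) (SemilocalLine k) :=
  inferInstanceAs (IsLocalization _ (Localization (Polynomial.nonvanishingZeroOne k)))

theorem nonvanishing_le : Polynomial.nonvanishingZeroOne k ≤ nonZeroDivisors k[X] := by
  intro h hh
  rw [mem_nonZeroDivisors_iff_ne_zero]
  rintro rfl
  exact hh.1 eval_zero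

instance : IsDomain (SemilocalLine k) :=
  IsLocalization.isDomain_of_le_nonZeroDivisors (SemilocalLine k) (nonvanishing_le k)

instance : IsPrincipalIdealRing (SemilocalLine k) where
  principal J := by
    obtain ⟨g, hg⟩ := IsPrincipalIdealRing.principal (J.under k[X])
    refine ⟨algebraMap _ _ g, ?_⟩
    rw [← IsLocalization.map_under (Polynomial.nonvanishingZeroOne k) (SemilocalLine k) J, hg]
    change Ideal.map _ (Ideal.span {g}) = Ideal.span _
    rw [Ideal.map_span, Set.image_singleton]

/-- The coordinate on the line. -/
noncomputable def coord : SemilocalLine k := algebraMap k[X] _ X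

theorem algebraMap_C (c : k) :
    algebraMap k[X] (SemilocalLine k) (C c) = algebraMap k (SemilocalLine k) c :=
  (IsScalarTower.algebraMap_apply k k[X] (SemilocalLine k) c).symm

variable {k}

/-- Evaluation at a point `c` which is `0` or `1`. -/
noncomputable def evalAt (c : k) (hc : c = 0 ∨ c = 1) : SemilocalLine k →ₐ[k] k :=
  IsLocalization.liftAlgHom (M := Polynomial.nonvanishingZeroOne k) (f := Polynomial.aeval c)
    fun h => by
      rw [isUnit_iff_ne_zero]
      obtain rfl | rfl := hc
      · exact h.2.1
      · exact h.2.2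

theorem evalAt_algebraMap (c : k) (hc : c = 0 ∨ c = 1) (f : k[X]) :
    evalAt c hc (algebraMap _ _ f) = f.eval c := by
  simp [evalAt]

theorem evalAt_coord (c : k) (hc : c = 0 ∨ c = 1) : evalAt c hc (coord k) = c := by
  simp [coord, evalAt_algebraMap]

theorem isUnit_of_evalAt_ne_zero (x : SemilocalLine k) (h0 : evalAt 0 (Or.inl rfl) x ≠ 0)
    (h1 : evalAt 1 (Or.inr rfl) x ≠ 0) : IsUnit x := by
  obtain ⟨⟨f, m⟩, hf⟩ := IsLocalization.surj (Polynomial.nonvanishingZeroOne k) x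
  have h : ∀ c hc, f.eval c = evalAt c hc x * m.1.eval c := by
    intro c hc
    rw [← evalAt_algebraMap c hc, ← evalAt_algebraMap c hc, ← map_mul, hf]
  have hfu : IsUnit (algebraMap _ (SemilocalLine k) f) :=
    IsLocalization.map_units (SemilocalLine k) (⟨f, by
      rw [h 0 (Or.inl rfl)]
      exact mul_ne_zero h0 m.2.1, by
      rw [h 1 (Or.inr rfl)]
      exact mul_ne_zero h1 m.2.2⟩ : Polynomial.nonvanishingZeroOne k)
  rw [← hf] at hfu
  exact isUnit_of_mul_isUnit_left hfu

theorem exists_eq_mul_of_evalAt_eq_zero (c : k) (hc : c = 0 ∨ c = 1) (x : SemilocalLine k)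
    (h : evalAt c hc x = 0) : ∃ y, x = (coord k - algebraMap k _ c) * y := by
  obtain ⟨⟨f, m⟩, hf⟩ := IsLocalization.surj (Polynomial.nonvanishingZeroOne k) x
  have hm := IsLocalization.map_units (SemilocalLine k) m
  have h' : f.eval c = 0 := by
    have := congrArg (evalAt c hc) hf
    rw [map_mul, h, zero_mul, evalAt_algebraMap] at this
    exact this.symm
  obtain ⟨g, rfl⟩ := Polynomial.dvd_iff_isRoot.2 h'
  obtain ⟨v, hv⟩ := hm
  refine ⟨algebraMap _ _ g * ↑v⁻¹, ?_⟩
  rw [map_mul, map_sub, algebraMap_C] at hf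
  rw [← mul_assoc]
  change _ = (algebraMap k[X] _ X - _) * _ * _
  rw [← hf, ← hv]
  simp

/-- A multiplicative property that holds for units and for the local parameters at `0` and at `1`
holds for all nonzero elements. -/
theorem induction_of_ne_zero {P : SemilocalLine k → Prop} (hu : ∀ x, IsUnit x → P x)
    (hmul : ∀ x y, P x → P y → P (x * y))
    (hc : ∀ (c : k) (_ : c = 0 ∨ c = 1), P (coord k - algebraMap k _ c))
    (x : SemilocalLine k) (hx : x ≠ 0) : P x := by
  have hirr : ∀ (c : k), c = 0 ∨ c = 1 → ¬ IsUnit (coord k - algebraMap k _ c) := by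
    intro c hc h
    have := h.map (evalAt c hc)
    simp [evalAt_coord] at this
  induction x using WfDvdMonoid.induction_on_irreducible with
  | zero => exact absurd rfl hx
  | unit x h => exact hu x h
  | mul a i ha hi ih =>
    obtain ⟨c, h0, h⟩ : ∃ c, ∃ hc : c = 0 ∨ c = 1, evalAt c hc i = 0 := by
      by_contra! h
      exact hi.not_isUnit (isUnit_of_evalAt_ne_zero i (h _ _) (h _ _))
    obtain ⟨y, rfl⟩ := exists_eq_mul_of_evalAt_eq_zero c h0 i h
    exact hmul _ _ (hmul _ _ (hc c h0)
      (hu _ ((of_irreducible_mul hi).resolve_left (hirr c h0)))) (ih ha)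

end SemilocalLine

theorem Submodule.exists_linearIndependent_span_eq {k E : Type*} [Field k] [AddCommGroup E]
    [Module k E] [FiniteDimensional k E] (U : Submodule k E) {n : ℕ}
    (h : Module.finrank k U = n) :
    ∃ u : Fin n → E, LinearIndependent k u ∧ Submodule.span k (Set.range u) = U := by
  let b := Module.finBasisOfFinrankEq k U h
  refine ⟨fun i => (b i).1, b.linearIndependent.map' U.subtype U.ker_subtype, ?_⟩
  have h2 := congrArg (Submodule.map U.subtype) b.span_eq
  rw [Submodule.map_span, Submodule.map_top, Submodule.range_subtype, ← Set.range_comp] at h2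
  exact h2

theorem Submodule.free_of_smul_eq_zero {A E : Type*} [CommRing A] [IsDomain A]
    [IsPrincipalIdealRing A] [AddCommGroup E] [Module A E] (U : Submodule A E) [Module.Finite A U]
    (h : ∀ x : A, x ≠ 0 → ∀ e : E, x • e = 0 → e = 0) : Module.Free A U := by
  have : Module.IsTorsionFree A U := by
    refine Module.IsTorsionFree.of_smul_eq_zero fun x y hxy => ?_
    rw [or_iff_not_imp_left]
    exact fun hx => Subtype.ext (h x hx y (congrArg Subtype.val hxy))
  exact Module.free_of_finite_type_torsion_free'

namespace Quadrics

variable {k V : Type*} [Field k] [CharZero k] [AddCommGroup V] [Module k V]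
  [FiniteDimensional k V] {R : Type*} [CommRing R] [Algebra k R]

/-- The condition of empty intersection is stable under generization. -/
theorem emptyIntersectionAt_of_le {U : Submodule R (QuadForms k V R)} {p q : PrimeSpectrum R}
    (hpq : p.asIdeal ≤ q.asIdeal) (h : EmptyIntersectionAt U q) : EmptyIntersectionAt U p := by
  let b := Module.finBasis k V
  obtain ⟨r, hr, N, h⟩ := (emptyIntersectionAt_iff b U q).1 h
  exact (emptyIntersectionAt_iff b U p).2 ⟨r, fun h => hr (hpq h), N, h⟩

/-- The condition at a `k`-point can be checked over `k`, which is the residue field. -/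
theorem emptyIntersectionAt_of_pullback {U : Submodule R (QuadForms k V R)} (e : R →ₐ[k] k)
    (h : EmptyIntersection (pullback e U)) (p : PrimeSpectrum R)
    (hp : p.asIdeal = RingHom.ker e.toRingHom) : EmptyIntersectionAt U p := by
  let b := Module.finBasis k V
  rw [emptyIntersectionAt_iff_radical b]
  rw [emptyIntersection_iff b, polyIdeal_pullback] at h
  have h1 : algebraMap R p.asIdeal.ResidueField =
      (algebraMap k p.asIdeal.ResidueField).comp e.toRingHom := by
    ext x
    have h2 : x - algebraMap k R (e x) ∈ p.asIdeal := by
      rw [hp, RingHom.mem_ker]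
      simp
    rw [← Ideal.algebraMap_residueField_eq_zero, map_sub, sub_eq_zero] at h2
    rw [h2, ← IsScalarTower.algebraMap_apply]
    rfl
  intro i
  obtain ⟨N, hN⟩ := h i
  refine ⟨N, ?_⟩
  have h3 := Ideal.mem_map_of_mem (MvPolynomial.map (algebraMap k p.asIdeal.ResidueField)) hN
  rw [Ideal.map_map, map_pow, MvPolynomial.map_X] at h3
  have h4 : MvPolynomial.map (σ := Fin (Module.finrank k V)) (algebraMap R p.asIdeal.ResidueField) =
      (MvPolynomial.map (algebraMap k p.asIdeal.ResidueField)).comp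
        (MvPolynomial.map e.toRingHom) := by
    rw [h1]
    exact MvPolynomial.ringHom_ext (fun r => by simp) fun i => by simp
  rw [h4]
  exact h3

/-- Any two linear systems of the locus are specializations of one family over the semilocal ring of
two points on the line, namely the family spanned by the forms that interpolate linearly between
bases of the two systems. -/
theorem exists_family {n : ℕ} (U : k → Submodule k (QuadForms k V k))
    (hU : ∀ c, c = 0 ∨ c = 1 → IsCliffordPoint n (U c)) :
    ∃ W : Submodule (SemilocalLine k) (QuadForms k V (SemilocalLine k)), IsCliffordPoint n W ∧
      ∀ c hc, pullback (SemilocalLine.evalAt c hc) W = U c := by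
  have hbasis : ∀ c, c = 0 ∨ c = 1 → ∃ u : Fin n → QuadForms k V k,
      LinearIndependent k u ∧ Submodule.span k (Set.range u) = U c := by
    intro c hc
    exact Submodule.exists_linearIndependent_span_eq _ ((isCliffordPoint_iff _).1 (hU c hc)).1
  obtain ⟨u₀, hu₀, hs₀⟩ := hbasis 0 (Or.inl rfl)
  obtain ⟨u₁, hu₁, hs₁⟩ := hbasis 1 (Or.inr rfl)
  let w : Fin n → QuadForms k V (SemilocalLine k) := fun i =>
    (1 - SemilocalLine.coord k) • baseMap _ (u₀ i) + SemilocalLine.coord k • baseMap _ (u₁ i)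
  have hw : ∀ c hc, ∃ u : Fin n → QuadForms k V k, LinearIndependent k u ∧
      Submodule.span k (Set.range u) = U c ∧
      ∀ i v, SemilocalLine.evalAt c hc (w i v) = u i v := by
    intro c hc
    obtain rfl | rfl := id hc
    · refine ⟨u₀, hu₀, hs₀, fun i v => ?_⟩
      simp [w, baseMap_apply, SemilocalLine.evalAt_coord]
    · refine ⟨u₁, hu₁, hs₁, fun i v => ?_⟩
      simp [w, baseMap_apply, SemilocalLine.evalAt_coord]
  let W := Submodule.span (SemilocalLine k) (Set.range w)
  have hpull : ∀ c hc, pullback (SemilocalLine.evalAt c hc) W = U c := by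
    intro c hc
    obtain ⟨u, -, hs, hu⟩ := hw c hc
    rw [← hs]
    apply le_antisymm
    · rw [pullback, Submodule.span_le]
      rintro _ ⟨q, hq, rfl⟩
      change q ∈ W at hq
      let f : QuadForms k V (SemilocalLine k) → QuadForms k V k :=
        fun q => (SemilocalLine.evalAt c hc).toLinearMap.compQuadraticMap q
      change f q ∈ Submodule.span k (Set.range u)
      induction hq using Submodule.span_induction with
      | mem q hq =>
        obtain ⟨i, rfl⟩ := hq
        exact Submodule.subset_span ⟨i, QuadraticMap.ext fun v => (hu i v).symm⟩
      | zero =>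
        rw [show f 0 = 0 from QuadraticMap.ext fun v => by simp [f]]
        exact Submodule.zero_mem _
      | add q q' _ _ h h' =>
        rw [show f (q + q') = f q + f q' from QuadraticMap.ext fun v => by simp [f]]
        exact Submodule.add_mem _ h h'
      | smul r q _ h =>
        rw [show f (r • q) = SemilocalLine.evalAt c hc r • f q from
          QuadraticMap.ext fun v => by simp [f]]
        exact Submodule.smul_mem _ _ h
    · rw [Submodule.span_le]
      rintro _ ⟨i, rfl⟩
      exact Submodule.subset_span ⟨w i, Submodule.subset_span ⟨i, rfl⟩,
        QuadraticMap.ext fun v => hu i v⟩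
  -- The family `W` is saturated: if the combination of the `w i` with coefficients `a i` is divisible
  -- by a local parameter at `c`, so are the `a i`, because the `w i` are linearly independent at `c`.
  -- So the quotient by `W` is torsion free, hence free, over this principal ideal domain.
  have hsat : ∀ x : SemilocalLine k, x ≠ 0 → ∀ q, x • q ∈ W → q ∈ W := by
    refine SemilocalLine.induction_of_ne_zero ?_ ?_ ?_
    · rintro _ ⟨x, rfl⟩ q hq
      have := W.smul_mem (↑x⁻¹ : SemilocalLine k) hq
      rwa [smul_smul, Units.inv_mul, one_smul] at this
    · intro x y hx hy q hq
      rw [mul_smul] at hq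
      exact hy _ (hx _ hq)
    · intro c hc q hq
      obtain ⟨u, hu, -, huw⟩ := hw c hc
      obtain ⟨a, ha⟩ := (Submodule.mem_span_range_iff_exists_fun _).1 hq
      have h0 : ∀ i, SemilocalLine.evalAt c hc (a i) = 0 := by
        rw [Fintype.linearIndependent_iff] at hu
        refine hu _ (QuadraticMap.ext fun v => ?_)
        have h1 := congrArg (SemilocalLine.evalAt c hc) (DFunLike.congr_fun ha v)
        simp only [_root_.sum_apply, _root_.smul_apply, map_sum, smul_eq_mul, map_mul, huw, map_sub,
          SemilocalLine.evalAt_coord, AlgHom.commutes] at h1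
        simpa [_root_.sum_apply] using h1
      choose d hd using fun i => SemilocalLine.exists_eq_mul_of_evalAt_eq_zero c hc (a i) (h0 i)
      have hne : SemilocalLine.coord k - algebraMap k _ c ≠ 0 := by
        intro h
        obtain rfl | rfl := id hc
        · have := congrArg (SemilocalLine.evalAt 1 (Or.inr rfl)) h
          simp [SemilocalLine.evalAt_coord] at this
        · have := congrArg (SemilocalLine.evalAt 0 (Or.inl rfl)) h
          simp [SemilocalLine.evalAt_coord] at this
      have hq' : q = ∑ i, d i • w i := by
        refine QuadraticMap.ext fun v => mul_left_cancel₀ hne ?_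
        have h1 := DFunLike.congr_fun ha v
        simp only [_root_.sum_apply, _root_.smul_apply, smul_eq_mul, hd] at h1
        rw [← h1]
        simp [_root_.sum_apply, Finset.mul_sum, mul_assoc]
      rw [hq']
      exact W.sum_mem fun i _ => W.smul_mem _ (Submodule.subset_span ⟨i, rfl⟩)
  have hfin : Module.Finite (SemilocalLine k) W :=
    Module.Finite.of_fg (Submodule.fg_span (Set.finite_range w))
  have htorsion : Module.IsTorsionFree (SemilocalLine k) (QuadForms k V (SemilocalLine k) ⧸ W) := by
    refine Module.IsTorsionFree.of_smul_eq_zero fun x y hxy => ?_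
    obtain ⟨q, rfl⟩ := W.mkQ_surjective y
    rw [or_iff_not_imp_left]
    intro hx
    rw [← map_smul, Submodule.mkQ_apply, Submodule.Quotient.mk_eq_zero] at hxy
    rw [Submodule.mkQ_apply, Submodule.Quotient.mk_eq_zero]
    exact hsat x hx q hxy
  have hfree : Module.Free (SemilocalLine k) (QuadForms k V (SemilocalLine k) ⧸ W) :=
    Module.free_of_finite_type_torsion_free'
  have hproj : Module.Projective (SemilocalLine k) (QuadForms k V (SemilocalLine k) ⧸ W) :=
    Module.Projective.of_free
  have hWproj : Module.Projective (SemilocalLine k) W := by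
    obtain ⟨ρ, hρ⟩ := W.exists_retraction
    exact Module.Projective.of_split W.subtype ρ (LinearMap.ext hρ)
  have hWfree : Module.Free (SemilocalLine k) W := by
    refine W.free_of_smul_eq_zero fun x hx q hxq => QuadraticMap.ext fun v => ?_
    exact (mul_eq_zero.1 (DFunLike.congr_fun hxq v)).resolve_left hx
  -- As `W` is free, its rank can be read off at the point `0`.
  have hrank : Module.finrank (SemilocalLine k) W = n := by
    have h1 := rankAtStalk_pullback (U := W) (SemilocalLine.evalAt (0 : k) (Or.inl rfl)) default
    conv_rhs at h1 => rw [Module.rankAtStalk_eq_finrank_of_free]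
    have h2 := (hU 0 (Or.inl rfl)).rank_eq default
    rw [← hpull 0 (Or.inl rfl)] at h2
    exact h1.symm.trans h2
  refine ⟨W, ⟨⟨hproj, fun p => ?_⟩, fun p => ?_⟩, hpull⟩
  · rw [Module.rankAtStalk_eq_finrank_of_free]
    exact hrank
  · have hempty : ∀ c hc, ∀ q : PrimeSpectrum (SemilocalLine k),
        q.asIdeal = RingHom.ker (SemilocalLine.evalAt c hc).toRingHom →
          EmptyIntersectionAt W q := fun c hc q hq =>
      emptyIntersectionAt_of_pullback _ (hpull c hc ▸ ((isCliffordPoint_iff _).1 (hU c hc)).2) q hq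
    -- An element that vanishes neither at `0` nor at `1` is a unit. So a prime ideal lies in the
    -- union of the maximal ideals of these points, hence in one of them by prime avoidance.
    have hsub : (p.asIdeal : Set (SemilocalLine k)) ⊆
        (RingHom.ker (SemilocalLine.evalAt (0 : k) (Or.inl rfl)).toRingHom : Set _) ∪
        (RingHom.ker (SemilocalLine.evalAt (1 : k) (Or.inr rfl)).toRingHom : Set _) := by
      intro x hx
      by_contra h
      rw [Set.mem_union, not_or] at h
      exact p.2.ne_top (Ideal.eq_top_of_isUnit_mem _ hx
        (SemilocalLine.isUnit_of_evalAt_ne_zero x h.1 h.2))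
    rw [Ideal.subset_union] at hsub
    obtain h | h := hsub
    · exact emptyIntersectionAt_of_le (q := ⟨_, RingHom.ker_isPrime _⟩) h (hempty _ _ _ rfl)
    · exact emptyIntersectionAt_of_le (q := ⟨_, RingHom.ker_isPrime _⟩) h (hempty _ _ _ rfl)

end Quadrics

/-! ### Local coordinates on a projective module -/

/-- A finitely generated projective module of rank `n` at `p` is free with denominators over a
neighbourhood of `p`: after multiplication by some `r ∉ p` it becomes isomorphic to `Rⁿ`. -/
theorem Module.exists_comp_eq_smul_of_rankAtStalk {R L : Type*} [CommRing R] [AddCommGroup L]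
    [Module R L] [Module.Finite R L] [Module.Projective R L] {n : ℕ} (p : PrimeSpectrum R)
    (h : Module.rankAtStalk L p = n) :
    ∃ r ∉ p.asIdeal, ∃ (F : (Fin n → R) →ₗ[R] L) (G : L →ₗ[R] (Fin n → R)),
      F ∘ₗ G = r • LinearMap.id ∧ G ∘ₗ F = r • LinearMap.id := by
  let Rp := Localization.AtPrime p.asIdeal
  let Lp := LocalizedModule p.asIdeal.primeCompl L
  have : Module.FinitePresentation R L := Module.finitePresentation_of_projective R L
  have : Module.Free Rp Lp := Module.free_of_flat_of_isLocalRing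
  let b : Module.Basis (Fin n) Rp Lp := Module.finBasisOfFinrankEq Rp Lp h
  let e : Lp ≃ₗ[R] (Fin n → Rp) := b.equivFun.restrictScalars R
  let f : L →ₗ[R] Lp := LocalizedModule.mkLinearMap p.asIdeal.primeCompl L
  let g : (Fin n → R) →ₗ[R] (Fin n → Rp) :=
    LinearMap.pi fun i => Algebra.linearMap R Rp ∘ₗ LinearMap.proj i
  have : IsLocalizedModule p.asIdeal.primeCompl g := inferInstance
  obtain ⟨G, s₁, h₁⟩ := Module.FinitePresentation.exists_lift_of_isLocalizedModule
    p.asIdeal.primeCompl g (e.toLinearMap ∘ₗ f)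
  obtain ⟨F, s₂, h₂⟩ := Module.FinitePresentation.exists_lift_of_isLocalizedModule
    p.asIdeal.primeCompl f (e.symm.toLinearMap ∘ₗ g)
  have h₁' : ∀ x, g (G x) = s₁.1 • e (f x) := fun x => LinearMap.congr_fun h₁ x
  have h₂' : ∀ x, f (F x) = s₂.1 • e.symm (g x) := fun x => LinearMap.congr_fun h₂ x
  -- `F` and `G` are inverse to each other up to `s₁ s₂` after localization. The elements `s₃` and `s₄`
  -- make this hold over `R`.
  obtain ⟨s₃, h₃⟩ := Module.Finite.exists_smul_of_comp_eq_of_isLocalizedModule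
    p.asIdeal.primeCompl f (F ∘ₗ G) ((s₁.1 * s₂.1) • LinearMap.id) (by
      ext x
      simp only [LinearMap.comp_apply, LinearMap.smul_apply, LinearMap.id_apply, h₂', h₁', map_smul,
        LinearEquiv.symm_apply_apply, smul_smul, mul_comm])
  obtain ⟨s₄, h₄⟩ := Module.Finite.exists_smul_of_comp_eq_of_isLocalizedModule
    p.asIdeal.primeCompl g (G ∘ₗ F) ((s₁.1 * s₂.1) • LinearMap.id) (LinearMap.ext fun x => by
      simp only [LinearMap.comp_apply, LinearMap.smul_apply, LinearMap.id_apply, h₂', h₁', map_smul,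
        LinearEquiv.apply_symm_apply, smul_smul])
  have h₃' : ∀ x, s₃.1 • F (G x) = s₃.1 • (s₁.1 * s₂.1) • x := fun x => LinearMap.congr_fun h₃ x
  have h₄' : ∀ x, s₄.1 • G (F x) = s₄.1 • (s₁.1 * s₂.1) • x := fun x => LinearMap.congr_fun h₄ x
  refine ⟨s₁.1 * s₂.1 * (s₃.1 * s₄.1), (s₁ * s₂ * (s₃ * s₄)).2, F, (s₃.1 * s₄.1) • G, ?_, ?_⟩
  · refine LinearMap.ext fun x => ?_
    simp only [LinearMap.comp_apply, LinearMap.smul_apply, LinearMap.id_apply, map_smul]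
    rw [mul_comm s₃.1, mul_smul, h₃']
    simp only [smul_smul]
    congr 1
    ring
  · refine LinearMap.ext fun x => ?_
    simp only [LinearMap.comp_apply, LinearMap.smul_apply, LinearMap.id_apply]
    rw [mul_smul, h₄']
    simp only [smul_smul]
    congr 1
    ring

/-! ### Divisibility by powers of variables -/

namespace MvPolynomial

variable {σ R : Type*} [CommRing R]

theorem coeff_add_single_X_pow_mul (k : σ) (M : ℕ) (m : σ →₀ ℕ) (f : MvPolynomial σ R) :
    coeff (m + Finsupp.single k M) (X k ^ M * f) = coeff m f := by
  rw [X_pow_eq_monomial, add_comm, coeff_monomial_mul, one_mul]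

theorem X_pow_mul_cancel {k : σ} {M : ℕ} {f g : MvPolynomial σ R}
    (h : X k ^ M * f = X k ^ M * g) : f = g := by
  ext m
  rw [← coeff_add_single_X_pow_mul k M, h, coeff_add_single_X_pow_mul]

theorem exists_eq_X_pow_mul {k : σ} {M : ℕ} {f : MvPolynomial σ R}
    (h : ∀ m, coeff m f ≠ 0 → M ≤ m k) : ∃ g, f = X k ^ M * g := by
  have h1 := (monomial_one_dvd_iff_modMonomial_eq_zero (i := Finsupp.single k M) (x := f)).2 (by
    ext m
    by_cases hm : Finsupp.single k M ≤ m
    · rw [coeff_modMonomial_of_le _ hm, coeff_zero]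
    · rw [coeff_modMonomial_of_not_le _ hm, coeff_zero]
      by_contra h0
      exact hm (by simpa using h m h0))
  obtain ⟨g, hg⟩ := h1
  exact ⟨g, by rw [hg, X_pow_eq_monomial]⟩

/-- The vanishing of the first Koszul cohomology of the powers of the variables, in high degrees
for one variable and in all degrees for more variables: a family of fractions `f j / X j ^ M` that
agree is a polynomial. -/
theorem exists_eq_X_pow_mul_of_symm [Fintype σ] [Nonempty σ] {M e : ℕ}
    (hn : 1 < Fintype.card σ ∨ M ≤ e) (f : σ → MvPolynomial σ R)
    (hf : ∀ j, (f j).IsHomogeneous e) (h : ∀ j k, X k ^ M * f j = X j ^ M * f k) :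
    ∃ g, (∀ k, f k = X k ^ M * g) ∧ (M ≤ e → g.IsHomogeneous (e - M)) ∧ (e < M → g = 0) := by
  classical
  have hdeg : ∀ j m, coeff m (f j) ≠ 0 → m.degree = e := by
    intro j m hm
    rw [Finsupp.degree_eq_weight_one]
    exact hf j hm
  let j : σ := Classical.arbitrary σ
  obtain ⟨g, hg⟩ : ∃ g, f j = X j ^ M * g := by
    refine exists_eq_X_pow_mul fun m hm => ?_
    -- With a second variable `X k`, compare the coefficients in `X k ^ M * f j = X j ^ M * f k`. With
    -- only one variable a form of degree `e ≥ M` is divisible by its power.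
    by_cases hex : ∃ k, k ≠ j
    · obtain ⟨k, hk⟩ := hex
      rw [← coeff_add_single_X_pow_mul k M, h, X_pow_eq_monomial, coeff_monomial_mul'] at hm
      by_contra hlt
      refine hm (if_neg fun hle => hlt ?_)
      have := hle j
      simpa [Finsupp.single_apply, hk] using this
    · push Not at hex
      have h1 : Fintype.card σ = 1 := Fintype.card_eq_one_iff.2 ⟨j, hex⟩
      have h2 := hdeg j m hm
      rw [Finsupp.degree_eq_sum, Fintype.sum_eq_single j fun k hk => absurd (hex k) hk] at h2
      omega
  have hgm : ∀ m, coeff m g ≠ 0 → m.degree + M = e := by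
    intro m hm
    rw [← coeff_add_single_X_pow_mul j M, ← hg] at hm
    have := hdeg j _ hm
    simpa using this
  refine ⟨g, fun k => ?_, fun hM m hm => ?_, fun hM => ?_⟩
  · apply X_pow_mul_cancel (k := j) (M := M)
    rw [h k j, hg]
    ring
  · have := hgm m hm
    rw [Finsupp.degree_eq_weight_one] at this
    change Finsupp.weight 1 m + M = e at this
    omega
  · ext m
    rw [coeff_zero]
    by_contra hm
    have := hgm m hm
    omega

end MvPolynomial

/-! ### Symmetric algebras in local coordinates -/

namespace SymGrading

variable {R L σ : Type*} [CommRing R] [AddCommGroup L] [Module R L] [Fintype σ]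

theorem ι_mem_part (l : L) : SymmetricAlgebra.ι R L l ∈ part R L 1 := by
  rw [part, pow_one]
  exact LinearMap.mem_range_self _ l

/-- The homomorphism from a symmetric algebra to a polynomial ring given by linear forms. -/
noncomputable def toPoly (G : L →ₗ[R] (σ → R)) : SymmetricAlgebra R L →ₐ[R] MvPolynomial σ R :=
  SymmetricAlgebra.lift (∑ j, (LinearMap.proj j ∘ₗ G).smulRight (MvPolynomial.X j))

theorem toPoly_ι (G : L →ₗ[R] (σ → R)) (l : L) :
    toPoly G (SymmetricAlgebra.ι R L l) = ∑ j, G l j • MvPolynomial.X j := by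
  rw [toPoly, SymmetricAlgebra.lift_ι_apply, LinearMap.sum_apply]
  rfl

/-- The homomorphism from a polynomial ring to a symmetric algebra sending the variables to the
images of the basis vectors. -/
noncomputable def ofPoly [DecidableEq σ] (F : (σ → R) →ₗ[R] L) :
    MvPolynomial σ R →ₐ[R] SymmetricAlgebra R L :=
  MvPolynomial.aeval fun j => SymmetricAlgebra.ι R L (F (Pi.single j 1))

theorem toPoly_isHomogeneous (G : L →ₗ[R] (σ → R)) {d : ℕ} {x : SymmetricAlgebra R L}
    (hx : x ∈ part R L d) : (toPoly G x).IsHomogeneous d := by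
  induction hx using Submodule.pow_induction_on_left' with
  | algebraMap r =>
    rw [AlgHom.commutes]
    exact MvPolynomial.isHomogeneous_C _ r
  | add x y i hx hy ihx ihy =>
    rw [map_add]
    exact ihx.add ihy
  | mem_mul m hm i x hx ih =>
    obtain ⟨l, rfl⟩ := hm
    rw [map_mul, toPoly_ι, Nat.succ_eq_add_one, add_comm]
    refine MvPolynomial.IsHomogeneous.mul ?_ ih
    exact MvPolynomial.IsHomogeneous.sum _ _ _ fun j _ =>
      (MvPolynomial.homogeneousSubmodule σ R 1).smul_mem _ (MvPolynomial.isHomogeneous_X R j)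

variable [DecidableEq σ]

theorem ofPoly_mem_part (F : (σ → R) →ₗ[R] L) {d : ℕ} {f : MvPolynomial σ R}
    (hf : f.IsHomogeneous d) : ofPoly F f ∈ part R L d := by
  have h : f ∈ MvPolynomial.homogeneousSubmodule σ R d := hf
  rw [← MvPolynomial.homogeneousSubmodule_one_pow,
    MvPolynomial.homogeneousSubmodule_one_eq_span_X] at h
  have h1 := Submodule.mem_map_of_mem (f := (ofPoly F).toLinearMap) h
  rw [Submodule.map_pow, Submodule.map_span] at h1
  refine pow_le_pow_left' (b := LinearMap.range (SymmetricAlgebra.ι R L)) ?_ d h1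
  rw [Submodule.span_le]
  rintro _ ⟨_, ⟨j, rfl⟩, rfl⟩
  exact ⟨F (Pi.single j 1), by simp [ofPoly]⟩

/-- If `F` and `G` are inverse up to the denominator `r`, then the induced maps between the symmetric
algebra and the polynomial ring are so up to `r ^ d` in degree `d`. -/
theorem ofPoly_toPoly {F : (σ → R) →ₗ[R] L} {G : L →ₗ[R] (σ → R)} {r : R}
    (h : F ∘ₗ G = r • LinearMap.id) {d : ℕ} {x : SymmetricAlgebra R L} (hx : x ∈ part R L d) :
    ofPoly F (toPoly G x) = r ^ d • x := by
  induction hx using Submodule.pow_induction_on_left' with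
  | algebraMap r => rw [AlgHom.commutes, AlgHom.commutes, pow_zero, one_smul]
  | add x y i hx hy ihx ihy => rw [map_add, map_add, ihx, ihy, smul_add]
  | mem_mul m hm i x hx ih =>
    obtain ⟨l, rfl⟩ := hm
    have h1 : ofPoly F (toPoly G (SymmetricAlgebra.ι R L l)) = r • SymmetricAlgebra.ι R L l := by
      have h2 : F (G l) = r • l := LinearMap.congr_fun h l
      rw [← map_smul, ← h2]
      conv_rhs => rw [pi_eq_sum_univ' (G l), map_sum, map_sum]
      rw [toPoly_ι, map_sum]
      refine Finset.sum_congr rfl fun j _ => ?_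
      rw [map_smul, map_smul, map_smul, ofPoly, MvPolynomial.aeval_X]
    rw [map_mul, map_mul, ih, h1, smul_mul_smul_comm, Nat.succ_eq_add_one, pow_succ']

theorem toPoly_ι_single {F : (σ → R) →ₗ[R] L} {G : L →ₗ[R] (σ → R)} {r : R}
    (h : G ∘ₗ F = r • LinearMap.id) (j : σ) :
    toPoly G (SymmetricAlgebra.ι R L (F (Pi.single j 1))) = r • MvPolynomial.X j := by
  have h1 : G (F (Pi.single j 1)) = r • Pi.single j 1 := LinearMap.congr_fun h _
  rw [toPoly_ι, h1, Finset.sum_eq_single j]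
  · simp
  · intro i _ hi
    simp [hi]
  · simp

/-- The images of the coordinates are nonzerodivisors up to powers of the denominator. -/
theorem smul_eq_zero_of_pow_mul {F : (σ → R) →ₗ[R] L} {G : L →ₗ[R] (σ → R)} {r : R}
    (hFG : F ∘ₗ G = r • LinearMap.id) (hGF : G ∘ₗ F = r • LinearMap.id) {d N : ℕ}
    {x : SymmetricAlgebra R L} (hx : x ∈ part R L d) (j : σ)
    (h : SymmetricAlgebra.ι R L (F (Pi.single j 1)) ^ N * x = 0) : r ^ (N + d) • x = 0 := by
  have h1 := congrArg (toPoly G) h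
  rw [map_mul, map_pow, toPoly_ι_single hGF, map_zero, smul_pow, smul_mul_assoc,
    ← mul_smul_comm] at h1
  have h2 : r ^ N • toPoly G x = 0 := by
    apply MvPolynomial.X_pow_mul_cancel (k := j) (M := N)
    rw [h1, mul_zero]
  rw [pow_add, mul_smul, ← ofPoly_toPoly hFG hx, ← map_smul, h2, map_zero]

/-- The vanishing of the first Koszul cohomology of powers of the coordinates, up to powers of the
denominator. -/
theorem exists_smul_eq_pow_mul [Nonempty σ] {F : (σ → R) →ₗ[R] L} {G : L →ₗ[R] (σ → R)} {r : R}
    (hFG : F ∘ₗ G = r • LinearMap.id) (hGF : G ∘ₗ F = r • LinearMap.id) {e M : ℕ}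
    (hn : 1 < Fintype.card σ ∨ M ≤ e) (a : σ → SymmetricAlgebra R L)
    (ha : ∀ j, a j ∈ part R L e)
    (h : ∀ j k, SymmetricAlgebra.ι R L (F (Pi.single k 1)) ^ M * a j =
      SymmetricAlgebra.ι R L (F (Pi.single j 1)) ^ M * a k) :
    ∃ b, (M ≤ e → b ∈ part R L (e - M)) ∧ (e < M → b = 0) ∧
      ∀ j, r ^ (M + e) • a j = SymmetricAlgebra.ι R L (F (Pi.single j 1)) ^ M * b := by
  obtain ⟨g, hg, hg1, hg2⟩ := MvPolynomial.exists_eq_X_pow_mul_of_symm hn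
    (fun j => r ^ M • toPoly G (a j)) (fun j =>
      (MvPolynomial.homogeneousSubmodule σ R e).smul_mem _ (toPoly_isHomogeneous G (ha j)))
    (fun j k => by
      have := congrArg (toPoly G) (h j k)
      simp only [map_mul, map_pow, toPoly_ι_single hGF, smul_pow, smul_mul_assoc] at this
      rw [mul_smul_comm, this, mul_smul_comm])
  refine ⟨ofPoly F g, fun hM => ofPoly_mem_part F (hg1 hM), fun hM => by rw [hg2 hM, map_zero],
    fun j => ?_⟩
  have h1 := congrArg (ofPoly F) (hg j)
  rw [map_smul, ofPoly_toPoly hFG (ha j), map_mul, map_pow, smul_smul, ← pow_add] at h1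
  rw [h1, ofPoly, MvPolynomial.aeval_X]

/-- The symmetric algebra of a projective module is a retract of the one of a free module, which is a
polynomial ring. -/
instance projective_symmetricAlgebra [Module.Projective R L] :
    Module.Projective R (SymmetricAlgebra R L) := by
  obtain ⟨s, hs⟩ := Module.projective_lifting_property (Finsupp.linearCombination R (id : L → L))
    LinearMap.id (Finsupp.linearCombination_id_surjective R L)
  refine Module.Projective.of_split (M := SymmetricAlgebra R (L →₀ R))
    (SymmetricAlgebra.lift (SymmetricAlgebra.ι R (L →₀ R) ∘ₗ s)).toLinearMap
    (SymmetricAlgebra.lift (SymmetricAlgebra.ι R L ∘ₗ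
      Finsupp.linearCombination R (id : L → L))).toLinearMap ?_
  have h : (SymmetricAlgebra.lift (SymmetricAlgebra.ι R L ∘ₗ
      Finsupp.linearCombination R (id : L → L))).comp
      (SymmetricAlgebra.lift (SymmetricAlgebra.ι R (L →₀ R) ∘ₗ s)) = AlgHom.id R _ := by
    refine SymmetricAlgebra.algHom_ext (LinearMap.ext fun l => ?_)
    have := LinearMap.congr_fun hs l
    change SymmetricAlgebra.lift _ (SymmetricAlgebra.lift _ (SymmetricAlgebra.ι R L l)) = _
    rw [SymmetricAlgebra.lift_ι_apply]
    change SymmetricAlgebra.lift _ (SymmetricAlgebra.ι R _ (s l)) = _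
    rw [SymmetricAlgebra.lift_ι_apply]
    exact congrArg (SymmetricAlgebra.ι R L) this
  exact LinearMap.ext fun x => DFunLike.congr_fun h x

theorem part_fg [Module.Finite R L] (d : ℕ) : (part R L d).FG := by
  refine Submodule.FG.pow ?_ d
  rw [← Submodule.map_top]
  exact (Module.Finite.fg_top (R := R) (M := L)).map _

end SymGrading

/-! ### Generators and relations of the Clifford algebra -/

/-- A quadratic map on a scalar extension is determined by its values on the original module. -/
theorem QuadraticMap.eq_zero_of_one_tmul {k S V N : Type*} [CommRing k] [CommRing S] [Algebra k S]
    [AddCommGroup V] [Module k V] [AddCommGroup N] [Module S N]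
    (Q : QuadraticMap S (S ⊗[k] V) N) (h : ∀ v, Q (1 ⊗ₜ v) = 0) (x : S ⊗[k] V) : Q x = 0 := by
  have hs : ∀ (s : S) (v : V), s ⊗ₜ[k] v = s • ((1 : S) ⊗ₜ[k] v) := fun s v => by
    rw [TensorProduct.smul_tmul', smul_eq_mul, mul_one]
  have h2 : ∀ x y, QuadraticMap.polar Q x y = 0 := by
    intro x y
    induction x using TensorProduct.induction_on with
    | zero => rw [QuadraticMap.polar_zero_left]
    | add x x' hx hx' => rw [QuadraticMap.polar_add_left, hx, hx', add_zero]
    | tmul s v =>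
      induction y using TensorProduct.induction_on with
      | zero => rw [QuadraticMap.polar_zero_right]
      | add y y' hy hy' => rw [QuadraticMap.polar_add_right, hy, hy', add_zero]
      | tmul t w =>
        rw [hs s, hs t, QuadraticMap.polar_smul_left, QuadraticMap.polar_smul_right,
          QuadraticMap.polar, ← TensorProduct.tmul_add, h, h, h, sub_zero, sub_zero, smul_zero,
          smul_zero]
  induction x using TensorProduct.induction_on with
  | zero => rw [QuadraticMap.map_zero]
  | tmul s v => rw [hs, QuadraticMap.map_smul, h, smul_zero]
  | add x y hx hy =>
    have h3 := h2 x y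
    rwa [QuadraticMap.polar, hx, hy, sub_zero, sub_zero] at h3

namespace DirectSum

variable {R C : Type*} [CommRing R] [Ring C] [Algebra R C] {𝒞 : ℕ → Submodule R C}
  [SetLike.GradedMonoid 𝒞]

theorem of_commute_of {i j : ℕ} {x : 𝒞 i} {y : 𝒞 j} (h : x.1 * y.1 = y.1 * x.1) :
    DirectSum.of (fun i => 𝒞 i) i x * DirectSum.of (fun i => 𝒞 i) j y =
      DirectSum.of (fun i => 𝒞 i) j y * DirectSum.of (fun i => 𝒞 i) i x := by
  rw [DirectSum.of_mul_of, DirectSum.of_mul_of]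
  exact DirectSum.of_eq_of_gradedMonoid_eq (Sigma.subtype_ext (add_comm _ _) h)

theorem of_commute {i : ℕ} {x : 𝒞 i} (h : ∀ c : C, x.1 * c = c * x.1) (a : ⨁ i, 𝒞 i) :
    DirectSum.of (fun i => 𝒞 i) i x * a = a * DirectSum.of (fun i => 𝒞 i) i x := by
  induction a using DirectSum.induction_on with
  | zero => rw [mul_zero, zero_mul]
  | add x y hx hy => rw [mul_add, add_mul, hx, hy]
  | of i x => exact of_commute_of (h _)

theorem of_mul_of_eq {i j l : ℕ} {x : 𝒞 i} {y : 𝒞 j} {z : 𝒞 l} (hl : i + j = l)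
    (h : x.1 * y.1 = z.1) : DirectSum.of (fun i => 𝒞 i) i x * DirectSum.of (fun i => 𝒞 i) j y =
      DirectSum.of (fun i => 𝒞 i) l z := by
  rw [DirectSum.of_mul_of]
  exact DirectSum.of_eq_of_gradedMonoid_eq (Sigma.subtype_ext hl h)

/-- The element `c` has degree `i`, and the candidate `φ` for the decomposition into homogeneous
elements maps it accordingly. -/
def Lifts (φ : C →ₐ[R] ⨁ i, 𝒞 i) (i : ℕ) (c : C) : Prop :=
  ∃ h : c ∈ 𝒞 i, φ c = DirectSum.of (fun i => 𝒞 i) i ⟨c, h⟩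

namespace Lifts

variable {φ : C →ₐ[R] ⨁ i, 𝒞 i}

theorem add {i : ℕ} {x y : C} (hx : Lifts φ i x) (hy : Lifts φ i y) : Lifts φ i (x + y) := by
  obtain ⟨hx, ex⟩ := hx
  obtain ⟨hy, ey⟩ := hy
  refine ⟨Submodule.add_mem _ hx hy, ?_⟩
  rw [map_add, ex, ey, ← map_add]
  rfl

theorem mul {i j : ℕ} {x y : C} (hx : Lifts φ i x) (hy : Lifts φ j y) :
    Lifts φ (i + j) (x * y) := by
  obtain ⟨hx, ex⟩ := hx
  obtain ⟨hy, ey⟩ := hy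
  refine ⟨SetLike.GradedMul.mul_mem hx hy, ?_⟩
  rw [map_mul, ex, ey, DirectSum.of_mul_of]
  rfl

theorem scalar (r : R) : Lifts φ 0 (algebraMap R C r) :=
  ⟨SetLike.algebraMap_mem_graded 𝒞 r, φ.commutes r⟩

theorem one : Lifts φ 0 1 := by
  rw [← map_one (algebraMap R C)]
  exact scalar 1

theorem zero (i : ℕ) : Lifts φ i 0 := ⟨Submodule.zero_mem _, (map_zero φ).trans
  (map_zero (DirectSum.of (fun i => 𝒞 i) i)).symm⟩

theorem coe {i : ℕ} {c : C} (h : Lifts φ i c) : (DirectSum.coeAlgHom 𝒞).comp φ c = c := by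
  obtain ⟨h, e⟩ := h
  rw [AlgHom.comp_apply, e, DirectSum.coeAlgHom_of]

end Lifts

end DirectSum

namespace CliffordSpace

open Quadrics

variable {k V R : Type*} [Field k] [CharZero k] [AddCommGroup V] [Module k V] [CommRing R]
  [Algebra k R] (U : Submodule R (QuadForms k V R))

theorem form_one_tmul (v : V) :
    form U (1 ⊗ₜ v) = SymmetricAlgebra.ι R (Module.Dual R U) (tautological U v) := by
  rw [form, extend_tmul, one_mul, one_mul]
  rfl

theorem gen_mul_gen (v : V) : gen U v * gen U v = algebraMap (CoordRing U) (Cliff U)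
    (SymmetricAlgebra.ι R (Module.Dual R U) (tautological U v)) := by
  rw [gen, CliffordAlgebra.ι_sq_scalar, form_one_tmul]

theorem gen_add (v w : V) : gen U (v + w) = gen U v + gen U w := by
  rw [gen, TensorProduct.tmul_add, map_add]
  rfl

theorem algebraMap_smul_tmul (a : k) (v : V) : (1 : CoordRing U) ⊗ₜ[k] (a • v) =
    algebraMap R (CoordRing U) (algebraMap k R a) • ((1 : CoordRing U) ⊗ₜ[k] v) := by
  rw [TensorProduct.tmul_smul, TensorProduct.smul_tmul', TensorProduct.smul_tmul',
    Algebra.smul_def a, ← IsScalarTower.algebraMap_apply, smul_eq_mul]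

theorem gen_smul (a : k) (v : V) : gen U (a • v) = algebraMap k R a • gen U v := by
  rw [gen, algebraMap_smul_tmul, map_smul, algebraMap_smul]
  rfl

/-- Every linear form on `U` is a combination of the evaluations at the vectors of `V`, because it
extends to a linear form on `R ⊗ Sym² V^∨`. The latter is a combination of the coefficients of a
quadratic form in a basis of `V`, and these are combinations of evaluations. -/
theorem span_tautological [FiniteDimensional k V] [Module.Projective R (QuadForms k V R ⧸ U)] :
    Submodule.span R (Set.range (tautological U)) = ⊤ := by
  classical
  obtain ⟨ρ, hρ⟩ := U.exists_retraction
  let b := Module.finBasis k V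
  refine eq_top_iff.2 fun f _ => ?_
  have h2 : ∀ v w : V, QuadraticMap.polar (tautological U) v w ∈
      Submodule.span R (Set.range (tautological U)) := fun v w => by
    refine Submodule.sub_mem _ (Submodule.sub_mem _ ?_ ?_) ?_ <;>
      exact Submodule.subset_span ⟨_, rfl⟩
  let t : Fin (Module.finrank k V) → Fin (Module.finrank k V) → Module.Dual R U := fun i j =>
    if i = j then tautological U (b i) else
      if i < j then QuadraticMap.polar (tautological U) (b i) (b j) else 0
  have ht : ∀ i j, t i j ∈ Submodule.span R (Set.range (tautological U)) := fun i j => by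
    dsimp only [t]
    split_ifs
    · exact Submodule.subset_span ⟨_, rfl⟩
    · exact h2 _ _
    · exact Submodule.zero_mem _
  have htu : ∀ i j (u : U), t i j u = coeffs b u.1 i j := fun i j u => by
    rw [coeffs_apply]
    dsimp only [t]
    split_ifs <;> rfl
  have hf : f = ∑ i, ∑ j, f (ρ (ofCoeffs b (Pi.single i (Pi.single j 1)))) • t i j := by
    refine LinearMap.ext fun u => ?_
    have h3 : u = ∑ i, ∑ j, coeffs b u.1 i j •
        ρ (ofCoeffs b (Pi.single i (Pi.single j 1))) := by
      conv_lhs => rw [← hρ u, ← ofCoeffs_coeffs b u.1]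
      have h4 : coeffs b u.1 = ∑ i, ∑ j, coeffs b u.1 i j •
          (Pi.single i (Pi.single j 1) :
            Fin (Module.finrank k V) → Fin (Module.finrank k V) → R) := by
        ext i j
        simp [Finset.sum_apply, Pi.single_apply, ite_apply]
      conv_lhs => rw [h4]
      simp only [map_sum, map_smul]
    conv_lhs => rw [h3]
    simp only [map_sum, map_smul, LinearMap.sum_apply, LinearMap.smul_apply, htu, smul_eq_mul]
    exact Finset.sum_congr rfl fun i _ => Finset.sum_congr rfl fun j _ => mul_comm _ _
  rw [hf]
  exact Submodule.sum_mem _ fun i _ => Submodule.sum_mem _ fun j _ =>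
    Submodule.smul_mem _ _ (ht i j)

theorem algebraMap_mul_gen (s : CoordRing U) (v : V) :
    CliffordAlgebra.ι (form U) (s ⊗ₜ v) = algebraMap (CoordRing U) (Cliff U) s * gen U v := by
  rw [← Algebra.smul_def, gen, ← map_smul, TensorProduct.smul_tmul', smul_eq_mul, mul_one]

theorem adjoin_ι_union_gen : Algebra.adjoin R
    (Set.range (fun l => algebraMap (CoordRing U) (Cliff U) (SymmetricAlgebra.ι R _ l)) ∪
      Set.range (gen U)) = ⊤ := by
  set E := Algebra.adjoin R
    (Set.range (fun l => algebraMap (CoordRing U) (Cliff U) (SymmetricAlgebra.ι R _ l)) ∪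
      Set.range (gen U))
  have hg : ∀ v, gen U v ∈ E := fun v => Algebra.subset_adjoin (Or.inr ⟨v, rfl⟩)
  have hs : ∀ s : CoordRing U, algebraMap (CoordRing U) (Cliff U) s ∈ E := by
    intro s
    induction s using SymmetricAlgebra.induction with
    | algebraMap r =>
      rw [← IsScalarTower.algebraMap_apply]
      exact Subalgebra.algebraMap_mem _ r
    | ι l => exact Algebra.subset_adjoin (Or.inl ⟨l, rfl⟩)
    | mul x y hx hy =>
      rw [map_mul]
      exact Subalgebra.mul_mem _ hx hy
    | add x y hx hy =>
      rw [map_add]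
      exact Subalgebra.add_mem _ hx hy
  rw [Algebra.eq_top_iff]
  intro c
  induction c using CliffordAlgebra.induction with
  | algebraMap s => exact hs s
  | ι x =>
    induction x using TensorProduct.induction_on with
    | zero =>
      rw [map_zero]
      exact Subalgebra.zero_mem _
    | tmul s v =>
      rw [algebraMap_mul_gen]
      exact Subalgebra.mul_mem _ (hs s) (hg v)
    | add x y hx hy =>
      rw [map_add]
      exact Subalgebra.add_mem _ hx hy
  | mul x y hx hy => exact Subalgebra.mul_mem _ hx hy
  | add x y hx hy => exact Subalgebra.add_mem _ hx hy

/-- The Clifford algebra is generated over `R` by the vectors of `V`. -/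
theorem adjoin_gen [FiniteDimensional k V] [Module.Projective R (QuadForms k V R ⧸ U)] :
    Algebra.adjoin R (Set.range (gen U)) = ⊤ := by
  rw [eq_top_iff, ← adjoin_ι_union_gen, Algebra.adjoin_le_iff, Set.union_subset_iff]
  refine ⟨?_, Algebra.subset_adjoin⟩
  rintro _ ⟨l, rfl⟩
  have hg : ∀ v, gen U v ∈ Algebra.adjoin R (Set.range (gen U)) :=
    fun v => Algebra.subset_adjoin ⟨v, rfl⟩
  have hl : l ∈ Submodule.span R (Set.range (tautological U)) := by
    rw [span_tautological]
    trivial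
  change algebraMap (CoordRing U) (Cliff U) (SymmetricAlgebra.ι R _ l) ∈
    Algebra.adjoin R (Set.range (gen U))
  induction hl using Submodule.span_induction with
  | mem l hl =>
    obtain ⟨v, rfl⟩ := hl
    rw [← gen_mul_gen]
    exact Subalgebra.mul_mem _ (hg v) (hg v)
  | zero =>
    rw [map_zero, map_zero]
    exact Subalgebra.zero_mem _
  | add x y _ _ hx hy =>
    rw [map_add, map_add]
    exact Subalgebra.add_mem _ hx hy
  | smul r x _ hx =>
    rw [map_smul, Algebra.algebraMap_eq_smul_one, smul_assoc, ← Algebra.algebraMap_eq_smul_one]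
    exact Subalgebra.smul_mem _ hx r

theorem algHom_ext_gen [FiniteDimensional k V] [Module.Projective R (QuadForms k V R ⧸ U)]
    {A : Type*} [Ring A] [Algebra R A] {φ ψ : Cliff U →ₐ[R] A}
    (h : ∀ v, φ (gen U v) = ψ (gen U v)) : φ = ψ := by
  refine AlgHom.ext_of_adjoin_eq_top (adjoin_gen U) ?_
  rintro _ ⟨v, rfl⟩
  exact h v

/-- The universal property of the Clifford algebra as an algebra over `R`: a homomorphism to `A` is
given by central elements for the linear forms on `U` and by square roots of the `q(v)`. -/
theorem exists_algHom {A : Type*} [Ring A] [Algebra R A] (α : Module.Dual R U →ₗ[R] A)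
    (hα : ∀ l a, α l * a = a * α l) (β : V →ₛₗ[algebraMap k R] A)
    (hβ : ∀ v, β v * β v = α (tautological U v)) :
    ∃ φ : Cliff U →ₐ[R] A,
      (∀ l, φ (algebraMap (CoordRing U) (Cliff U) (SymmetricAlgebra.ι R _ l)) = α l) ∧
        ∀ v, φ (gen U v) = β v := by
  -- `A` becomes an algebra over `Sym(U^∨)` through its center, and the universal property of the
  -- Clifford algebra over `Sym(U^∨)` applies.
  let γ : CoordRing U →ₐ[R] Subalgebra.center R A :=
    SymmetricAlgebra.lift (LinearMap.codRestrict (Subalgebra.toSubmodule (Subalgebra.center R A)) α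
      fun l => (Subalgebra.mem_center_iff (R := R) (A := A)).2 fun a => (hα l a).symm)
  have hγι : ∀ l, (γ (SymmetricAlgebra.ι R _ l) : A) = α l := fun l => by
    dsimp only [γ]
    rw [SymmetricAlgebra.lift_ι_apply]
    rfl
  let aS : Algebra (CoordRing U) A :=
    ((Subalgebra.center R A).val.toRingHom.comp γ.toRingHom).toAlgebra' fun s a =>
      (Subalgebra.mem_center_iff.1 (γ s).2 a).symm
  have hS : ∀ s, algebraMap (CoordRing U) A s = γ s := fun s => rfl
  have tS : IsScalarTower R (CoordRing U) A := IsScalarTower.of_algebraMap_eq fun r => by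
    rw [hS, AlgHom.commutes]
    rfl
  let ak : Algebra k A := Algebra.compHom A (algebraMap k R)
  have hk : ∀ (a : k) (x : A), a • x = algebraMap k R a • x := fun a x => rfl
  have tk : IsScalarTower k (CoordRing U) A := IsScalarTower.of_algebraMap_eq fun a => by
    rw [IsScalarTower.algebraMap_apply k R (CoordRing U), ← IsScalarTower.algebraMap_apply R]
    rfl
  let β' : V →ₗ[k] A :=
    { toFun := β
      map_add' := map_add β
      map_smul' := fun a v => by rw [map_smulₛₗ, RingHom.id_apply, hk] }
  let B : CoordRing U ⊗[k] V →ₗ[CoordRing U] A := LinearMap.liftBaseChange (CoordRing U) β'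
  have hB : ∀ v, B (1 ⊗ₜ v) = β v := fun v => by
    simp only [B, LinearMap.liftBaseChange_tmul, one_smul]
    rfl
  have hB2 : ∀ x, B x * B x = algebraMap (CoordRing U) A (form U x) := fun x =>
    sub_eq_zero.1 (QuadraticMap.eq_zero_of_one_tmul
      (LinearMap.BilinMap.toQuadraticMap ((LinearMap.mul (CoordRing U) A).compl₁₂ B B) -
        (Algebra.linearMap (CoordRing U) A).compQuadraticMap (form U)) (fun v => by
          change B (1 ⊗ₜ v) * B (1 ⊗ₜ v) -
            algebraMap (CoordRing U) A (form U (1 ⊗ₜ v)) = 0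
          rw [hB, form_one_tmul, hβ, hS, hγι, sub_self]) x)
  let φ := CliffordAlgebra.lift (form U) ⟨B, hB2⟩
  refine ⟨φ.restrictScalars R, fun l => ?_, fun v => ?_⟩
  · rw [AlgHom.restrictScalars_apply, AlgHom.commutes, hS, hγι]
  · rw [AlgHom.restrictScalars_apply, gen, CliffordAlgebra.lift_ι_apply, hB]

/-! ### The weight grading -/

/-- The elements of weight `i` are sums of products of an element of `Sym^s(U^∨)` and `i - 2s`
vectors. -/
theorem weight_induction {i : ℕ} {p : Cliff U → Prop} {c : Cliff U} (hc : c ∈ weight U i)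
    (h0 : p 0) (hadd : ∀ x y, p x → p y → p (x + y))
    (hmem : ∀ (s : ℕ) (f : CoordRing U) (l : List V), f ∈ coordGrading U s →
      l.length + 2 * s = i → p (algebraMap (CoordRing U) (Cliff U) f * (l.map (gen U)).prod)) :
    p c := by
  induction hc using Submodule.closure_induction with
  | zero => exact h0
  | add x y _ _ hx hy => exact hadd x y hx hy
  | smul_mem r x hx =>
    obtain ⟨s, f, l, hf, hl, rfl⟩ := hx
    rw [← smul_mul_assoc, ← algebraMap_smul (CoordRing U) r, Algebra.smul_def, ← map_mul,
      ← Algebra.smul_def]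
    exact hmem s (r • f) l (Submodule.smul_mem _ r hf) hl

theorem algebraMap_ι_mem (l : Module.Dual R U) :
    algebraMap (CoordRing U) (Cliff U) (SymmetricAlgebra.ι R _ l) ∈ weight U 2 :=
  HalfGraded.algebraMap_mem (𝒮 := coordGrading U) 1 _ (SymGrading.ι_mem_part l)

/-- The generators, as a map that is semilinear along `k → R`. -/
noncomputable def genMap : V →ₛₗ[algebraMap k R] Cliff U where
  toFun := gen U
  map_add' := gen_add U
  map_smul' := gen_smul U

/-- The linear forms on `U` in the direct sum of the parts of the Clifford algebra. -/
noncomputable def gradedι : Module.Dual R U →ₗ[R] ⨁ i, weight U i :=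
  DirectSum.lof R ℕ (fun i => weight U i) 2 ∘ₗ LinearMap.codRestrict (weight U 2)
    ((IsScalarTower.toAlgHom R (CoordRing U) (Cliff U)).toLinearMap ∘ₗ SymmetricAlgebra.ι R _)
      (algebraMap_ι_mem U)

/-- The generators in the direct sum of the parts of the Clifford algebra. -/
noncomputable def gradedGen : V →ₛₗ[algebraMap k R] ⨁ i, weight U i :=
  (DirectSum.lof R ℕ (fun i => weight U i) 1).comp
    (LinearMap.codRestrict (weight U 1) (genMap U) (gen_mem U))

/-- The decomposition of the Clifford algebra into parts, given by its universal property. -/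
theorem exists_algHom_directSum : ∃ φ : Cliff U →ₐ[R] ⨁ i, weight U i,
    (∀ l, φ (algebraMap (CoordRing U) (Cliff U) (SymmetricAlgebra.ι R _ l)) = gradedι U l) ∧
      ∀ v, φ (gen U v) = gradedGen U v :=
  exists_algHom U (A := ⨁ i, weight U i) (gradedι U)
    (fun l a => DirectSum.of_commute (fun c =>
      Algebra.commutes (A := Cliff U) (SymmetricAlgebra.ι R (Module.Dual R U) l) c) a) (gradedGen U)
    fun v => DirectSum.of_mul_of_eq rfl (gen_mul_gen U v)

/-- The homomorphism to the direct sum of the parts is the identity on each part. -/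
theorem lifts {φ : Cliff U →ₐ[R] ⨁ i, weight U i}
    (hι : ∀ l, φ (algebraMap (CoordRing U) (Cliff U) (SymmetricAlgebra.ι R _ l)) = gradedι U l)
    (hg : ∀ v, φ (gen U v) = gradedGen U v) {i : ℕ} {c : Cliff U} (hc : c ∈ weight U i) :
    DirectSum.Lifts φ i c := by
  have Pl : ∀ l : List V, DirectSum.Lifts φ l.length (l.map (gen U)).prod := by
    intro l
    induction l with
    | nil =>
      rw [List.map_nil, List.prod_nil, List.length_nil]
      exact .one
    | cons v l ih =>
      rw [List.map_cons, List.prod_cons, List.length_cons, add_comm]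
      exact .mul ⟨gen_mem U v, hg v⟩ ih
  have Ps : ∀ (s : ℕ) (f : CoordRing U), f ∈ coordGrading U s →
      DirectSum.Lifts φ (2 * s) (algebraMap (CoordRing U) (Cliff U) f) := by
    intro s f hf
    induction hf using Submodule.pow_induction_on_left' with
    | algebraMap r =>
      rw [← IsScalarTower.algebraMap_apply]
      exact .scalar r
    | add x y i hx hy ihx ihy =>
      rw [map_add]
      exact .add ihx ihy
    | mem_mul m hm i x hx ih =>
      obtain ⟨l, rfl⟩ := hm
      rw [map_mul, Nat.succ_eq_add_one, mul_add, add_comm]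
      exact .mul ⟨algebraMap_ι_mem U l, hι l⟩ ih
  refine weight_induction U hc (.zero i) (fun _ _ => .add) fun s f l hf hl => ?_
  rw [← hl, add_comm]
  exact .mul (Ps s f hf) (Pl l)

theorem coeAlgHom_comp {φ : Cliff U →ₐ[R] ⨁ i, weight U i}
    (hι : ∀ l, φ (algebraMap (CoordRing U) (Cliff U) (SymmetricAlgebra.ι R _ l)) = gradedι U l)
    (hg : ∀ v, φ (gen U v) = gradedGen U v) :
    (DirectSum.coeAlgHom (weight U)).comp φ = AlgHom.id R (Cliff U) := by
  refine AlgHom.ext_of_adjoin_eq_top (adjoin_ι_union_gen U) ?_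
  rintro _ (⟨l, rfl⟩ | ⟨v, rfl⟩)
  · exact (lifts U hι hg (algebraMap_ι_mem U l)).coe
  · exact (lifts U hι hg (gen_mem U v)).coe

/-- The Clifford algebra is the direct sum of its parts: the defining relations `v² = q(v)` are
homogeneous of weight two. -/
noncomputable instance : GradedAlgebra (weight U) :=
  GradedAlgebra.ofAlgHom _ (exists_algHom_directSum U).choose
    (coeAlgHom_comp U (exists_algHom_directSum U).choose_spec.1
      (exists_algHom_directSum U).choose_spec.2)
    fun _ x => (lifts U (exists_algHom_directSum U).choose_spec.1
      (exists_algHom_directSum U).choose_spec.2 x.2).2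

end CliffordSpace

/-! ### Homogeneous bases of weighted algebras -/

namespace HalfGraded

section

variable {R S C : Type*} [CommRing R] [CommRing S] [Algebra R S] [Ring C] [Algebra R C]
  [Algebra S C] {𝒮 : ℕ → Submodule R S} {𝒞 : ℕ → Submodule R C} [HalfGraded 𝒮 𝒞]

theorem smul_mem {d i : ℕ} {f : S} {c : C} (hf : f ∈ 𝒮 d) (hc : c ∈ 𝒞 i) :
    f • c ∈ 𝒞 (i + 2 * d) := by
  rw [Algebra.smul_def, add_comm]
  exact SetLike.GradedMul.mul_mem (HalfGraded.algebraMap_mem d f hf) hc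

end

variable {R S C I : Type*} [CommRing R] [CommRing S] [Algebra R S] [Ring C] [Algebra R C]
  [Algebra S C] [IsScalarTower R S C] {𝒮 : ℕ → Submodule R S} [GradedAlgebra 𝒮]
  {𝒞 : ℕ → Submodule R C} [GradedAlgebra 𝒞] [HalfGraded 𝒮 𝒞] (B : Module.Basis I S C) {deg : I → ℕ}
  (hB : ∀ a, B a ∈ 𝒞 (deg a))

theorem mem_iff_decompose {i : ℕ} {c : C} : c ∈ 𝒞 i ↔ (decompose 𝒞 c i : C) = c :=
  ⟨fun h => decompose_of_mem_same 𝒞 h, fun h => h ▸ SetLike.coe_mem _⟩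

open Classical in
/-- The part of a coefficient `f` that contributes to the weight `i` in the product of `f` with an
element of weight `e`: the component of degree `(i - e) / 2` if `i - e` is even and nonnegative, and
zero otherwise. -/
noncomputable def coeffPart (𝒮 : ℕ → Submodule R S) [GradedAlgebra 𝒮] (i e : ℕ) : S →+ S :=
  if e ≤ i ∧ 2 ∣ i - e then (GradedRing.proj 𝒮 ((i - e) / 2)) else 0

theorem coeffPart_of_eq {i e d : ℕ} (h : e + 2 * d = i) (f : S) :
    coeffPart 𝒮 i e f = decompose 𝒮 f d := by
  have hd : (i - e) / 2 = d := by omega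
  rw [coeffPart, if_pos ⟨by omega, ⟨d, by omega⟩⟩, hd]
  rfl

theorem coeffPart_of_ne {i e : ℕ} (h : ∀ d, e + 2 * d ≠ i) (f : S) : coeffPart 𝒮 i e f = 0 := by
  rw [coeffPart, if_neg fun ⟨h1, d, hd⟩ => h d (by omega)]
  rfl

theorem decompose_smul_coe {e : ℕ} {b : C} (hb : b ∈ 𝒞 e) (i : ℕ) (f : S) :
    (decompose 𝒞 (f • b) i : C) = coeffPart 𝒮 i e f • b := by
  induction f using DirectSum.Decomposition.inductionOn 𝒮 with
  | zero => rw [zero_smul, decompose_zero, map_zero, zero_smul]; rfl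
  | @homogeneous d f =>
    have hf : f.1 • b ∈ 𝒞 (e + 2 * d) := smul_mem f.2 hb
    by_cases h : e + 2 * d = i
    · rw [coeffPart_of_eq h, decompose_coe, DirectSum.of_eq_same,
        decompose_of_mem_same 𝒞 (h ▸ hf)]
    · rw [decompose_of_mem_ne 𝒞 hf h]
      by_cases h' : ∃ d', e + 2 * d' = i
      · obtain ⟨d', h'⟩ := h'
        rw [coeffPart_of_eq h', decompose_coe, DirectSum.of_eq_of_ne, ZeroMemClass.coe_zero,
          zero_smul]
        rintro rfl
        exact h h'
      · push Not at h'
        rw [coeffPart_of_ne h', zero_smul]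
  | add x y hx hy =>
    rw [add_smul, decompose_add, map_add, add_smul, ← hx, ← hy]
    rfl

include hB in
theorem repr_decompose [Fintype I] (i : ℕ) (c : C) (a : I) :
    B.repr (decompose 𝒞 c i : C) a = coeffPart 𝒮 i (deg a) (B.repr c a) := by
  have h : (decompose 𝒞 c i : C) = ∑ a, coeffPart 𝒮 i (deg a) (B.repr c a) • B a := by
    conv_lhs => rw [← B.sum_repr c]
    rw [decompose_sum, DFinsupp.finsetSum_apply, AddSubmonoidClass.coe_finsetSum]
    exact Finset.sum_congr rfl fun a _ => decompose_smul_coe (hB a) i _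
  rw [h, B.repr_sum_self]

include hB in
/-- In a homogeneous basis the coefficients of a homogeneous element are homogeneous. -/
theorem repr_mem [Fintype I] {i d : ℕ} {c : C} (hc : c ∈ 𝒞 i) {a : I} (h : deg a + 2 * d = i) :
    B.repr c a ∈ 𝒮 d := by
  have h1 := repr_decompose (𝒮 := 𝒮) B hB i c a
  rw [mem_iff_decompose.1 hc, coeffPart_of_eq h] at h1
  rw [h1]
  exact SetLike.coe_mem _

include hB in
theorem repr_eq_zero (𝒮 : ℕ → Submodule R S) [GradedAlgebra 𝒮] [HalfGraded 𝒮 𝒞] [Fintype I]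
    {i : ℕ} {c : C} (hc : c ∈ 𝒞 i) {a : I} (h : ∀ d, deg a + 2 * d ≠ i) : B.repr c a = 0 := by
  have h1 := repr_decompose (𝒮 := 𝒮) B hB i c a
  rwa [mem_iff_decompose.1 hc, coeffPart_of_ne h] at h1

include hB in
theorem fg_of_basis [Fintype I] (h𝒮 : ∀ d, (𝒮 d).FG) (i : ℕ) : (𝒞 i).FG := by
  classical
  have h : 𝒞 i = ⨆ a : I, ⨆ d : Fin (i + 1), if deg a + 2 * d.1 = i then
      (𝒮 d.1).map ((LinearMap.toSpanSingleton S C (B a)).restrictScalars R) else ⊥ := by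
    refine le_antisymm (fun c hc => ?_) (iSup_le fun a => iSup_le fun d => ?_)
    · rw [← B.sum_repr c]
      refine Submodule.sum_mem _ fun a _ => ?_
      by_cases h' : ∃ d, deg a + 2 * d = i
      · obtain ⟨d, h'⟩ := h'
        refine Submodule.mem_iSup_of_mem a (Submodule.mem_iSup_of_mem ⟨d, by omega⟩ ?_)
        rw [if_pos h']
        exact ⟨_, repr_mem B hB hc h', rfl⟩
      · push Not at h'
        rw [repr_eq_zero B hB 𝒮 hc h', zero_smul]
        exact Submodule.zero_mem _
    · split_ifs with h
      · rintro _ ⟨f, hf, rfl⟩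
        rw [← h]
        exact smul_mem hf (hB a)
      · exact bot_le
  rw [h]
  refine Submodule.fg_iSup _ fun a => Submodule.fg_iSup _ fun d => ?_
  split_ifs
  · exact (h𝒮 _).map _
  · exact Submodule.fg_bot

end HalfGraded

theorem DirectSum.projective_of_decomposition {R C : Type*} [CommRing R] [AddCommGroup C]
    [Module R C] [Module.Projective R C] (𝒞 : ℕ → Submodule R C) [DirectSum.Decomposition 𝒞]
    (i : ℕ) : Module.Projective R (𝒞 i) := by
  refine Module.Projective.of_split (𝒞 i).subtype
    (DirectSum.component R ℕ (fun i => 𝒞 i) i ∘ₗ (decomposeLinearEquiv 𝒞).toLinearMap) ?_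
  refine LinearMap.ext fun x => Subtype.ext ?_
  exact decompose_of_mem_same 𝒞 x.2

/-! ### A homogeneous basis of the Clifford algebra -/

theorem ExteriorAlgebra.basis_apply_prod {S M I : Type*} [LinearOrder I] [CommRing S]
    [AddCommGroup M] [Module S M] (b : Module.Basis I S M) (s : Finset I) :
    b.ExteriorAlgebra s = ((List.ofFn (Set.powersetCard.ofFinEmbEquiv.symm
      (Set.powersetCard.prodEquiv.symm s).2)).map fun i => CliffordAlgebra.ι 0 (b i)).prod := by
  rw [ExteriorAlgebra.basis_apply, List.map_ofFn]
  rfl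

namespace HalfGraded

variable {R S M : Type*} [CommRing R] [CommRing S] [Algebra R S] [AddCommGroup M] [Module S M]
  {Q : QuadraticForm S M} [Algebra R (CliffordAlgebra Q)]
  [IsScalarTower R S (CliffordAlgebra Q)] {𝒮 : ℕ → Submodule R S}
  [GradedAlgebra 𝒮] {𝒞 : ℕ → Submodule R (CliffordAlgebra Q)}

theorem contractLeft_prod_mem [HalfGraded 𝒮 𝒞] {V : Type*} {g : V → M}
    (hg : ∀ v, CliffordAlgebra.ι Q (g v) ∈ 𝒞 1)
    {d : Module.Dual S M} (hd : ∀ v, d (g v) ∈ 𝒮 1) (hp : ∀ l : List V,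
      (l.map fun v => CliffordAlgebra.ι Q (g v)).prod ∈ 𝒞 l.length) (l : List V) :
    CliffordAlgebra.contractLeft d (l.map fun v => CliffordAlgebra.ι Q (g v)).prod ∈
      𝒞 (l.length + 1) := by
  induction l with
  | nil =>
    rw [List.map_nil, List.prod_nil, CliffordAlgebra.contractLeft_one]
    exact Submodule.zero_mem _
  | cons v l ih =>
    rw [List.map_cons, List.prod_cons, CliffordAlgebra.contractLeft_ι_mul, List.length_cons]
    refine Submodule.sub_mem _ (smul_mem (hd v) (hp l)) ?_
    rw [add_comm (l.length + 1)]
    exact SetLike.GradedMul.mul_mem (hg v) ih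

/-- The deformation along a bilinear form sends a product of `l.length` vectors in the exterior
algebra to an element of the same weight, when contractions with this form raise the weight by one:
the deformation of `v * c` is `v` times the deformation `c'` of `c` minus the contraction of `c'` with
`B v`. -/
theorem changeForm_prod_mem [SetLike.GradedMonoid 𝒞] {V : Type*} {g : V → M}
    (hg : ∀ v, CliffordAlgebra.ι Q (g v) ∈ 𝒞 1)
    {B : LinearMap.BilinForm S M} (h : B.toQuadraticMap = Q - 0)
    (hB : ∀ (v : V) (i : ℕ) (c : CliffordAlgebra Q), c ∈ 𝒞 i →
      CliffordAlgebra.contractLeft (B (g v)) c ∈ 𝒞 (i + 1)) (l : List V) :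
    CliffordAlgebra.changeForm h (l.map fun v => CliffordAlgebra.ι 0 (g v)).prod ∈
      𝒞 l.length := by
  induction l with
  | nil =>
    rw [List.map_nil, List.prod_nil, CliffordAlgebra.changeForm_one]
    exact SetLike.GradedOne.one_mem
  | cons i l ih =>
    rw [List.map_cons, List.prod_cons, CliffordAlgebra.changeForm_ι_mul, List.length_cons]
    refine Submodule.sub_mem _ ?_ (hB _ _ _ ih)
    rw [add_comm]
    exact SetLike.GradedMul.mul_mem (hg _) ih

theorem changeForm_basis_mem [SetLike.GradedMonoid 𝒞] {I : Type*} [LinearOrder I]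
    (b : Module.Basis I S M) (hg : ∀ v, CliffordAlgebra.ι Q (b v) ∈ 𝒞 1)
    {B : LinearMap.BilinForm S M} (h : B.toQuadraticMap = Q - 0)
    (hB : ∀ (v : I) (i : ℕ) (c : CliffordAlgebra Q), c ∈ 𝒞 i →
      CliffordAlgebra.contractLeft (B (b v)) c ∈ 𝒞 (i + 1)) (s : Finset I) :
    b.ExteriorAlgebra.map (CliffordAlgebra.changeFormEquiv h) s ∈ 𝒞 s.card := by
  rw [Module.Basis.map_apply, CliffordAlgebra.changeFormEquiv_apply,
    ExteriorAlgebra.basis_apply_prod]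
  have h1 := changeForm_prod_mem hg h hB (List.ofFn
    (Set.powersetCard.ofFinEmbEquiv.symm (Set.powersetCard.prodEquiv.symm s).2))
  rw [List.length_ofFn] at h1
  exact h1

end HalfGraded

namespace CliffordSpace

open Quadrics

variable {k V R : Type*} [Field k] [CharZero k] [AddCommGroup V] [Module k V] [CommRing R]
  [Algebra k R] (U : Submodule R (QuadForms k V R)) {ι : Type*} [LinearOrder ι]
  (b : Module.Basis ι k V)

theorem form_one_tmul_mem (v : V) : form U (1 ⊗ₜ v) ∈ coordGrading U 1 := by
  rw [form_one_tmul]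
  exact SymGrading.ι_mem_part _

theorem prod_gen_mem (l : List V) : (l.map (gen U)).prod ∈ weight U l.length :=
  Submodule.subset_span ⟨0, 1, l, SetLike.GradedOne.one_mem, by rw [mul_zero, add_zero],
    by rw [map_one, one_mul]⟩

/-- Contraction with a functional with values of degree one raises the weight by one: it removes a
vector, of weight one, and multiplies with a linear form on `U`, of weight two. -/
theorem contractLeft_mem {d : Module.Dual (CoordRing U) (CoordRing U ⊗[k] V)}
    (hd : ∀ v : V, d (1 ⊗ₜ v) ∈ coordGrading U 1) {i : ℕ} {c : Cliff U} (hc : c ∈ weight U i) :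
    CliffordAlgebra.contractLeft d c ∈ weight U (i + 1) := by
  refine weight_induction U (p := fun c => CliffordAlgebra.contractLeft d c ∈ weight U (i + 1)) hc
    ?_ (fun x y hx hy => ?_) fun s f l hf hl => ?_
  · rw [map_zero]
    exact Submodule.zero_mem _
  · rw [map_add]
    exact Submodule.add_mem _ hx hy
  · have h := HalfGraded.contractLeft_prod_mem (𝒮 := coordGrading U) (gen_mem U) hd
      (prod_gen_mem U) l
    rw [CliffordAlgebra.contractLeft_algebraMap_mul, ← Algebra.smul_def, ← hl,
      show l.length + 2 * s + 1 = l.length + 1 + 2 * s by ring]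
    exact HalfGraded.smul_mem hf h

/-- A bilinear form whose associated quadratic form is the universal one. -/
noncomputable def bilin : LinearMap.BilinForm (CoordRing U) (CoordRing U ⊗[k] V) :=
  (form U).toBilin (b.baseChange (CoordRing U))

theorem bilin_toQuadraticMap : (bilin U b).toQuadraticMap = form U - 0 :=
  QuadraticMap.ext fun x => by
    rw [bilin, QuadraticMap.toQuadraticMap_toBilin, _root_.sub_apply, _root_.zero_apply,
      sub_zero]

theorem bilin_mem (i : ι) (v : V) : bilin U b (1 ⊗ₜ b i) (1 ⊗ₜ v) ∈ coordGrading U 1 := by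
  have hv : v ∈ Submodule.span k (Set.range b) := by
    rw [b.span_eq]
    trivial
  induction hv using Submodule.span_induction with
  | mem x hx =>
    obtain ⟨j, rfl⟩ := hx
    rw [← Module.Basis.baseChange_apply, ← Module.Basis.baseChange_apply, bilin,
      QuadraticMap.toBilin_apply]
    split_ifs
    · rw [Module.Basis.baseChange_apply]
      exact form_one_tmul_mem U _
    · rw [QuadraticMap.polar, Module.Basis.baseChange_apply, Module.Basis.baseChange_apply,
        ← TensorProduct.tmul_add]
      exact Submodule.sub_mem _ (Submodule.sub_mem _ (form_one_tmul_mem U _)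
        (form_one_tmul_mem U _)) (form_one_tmul_mem U _)
    · exact Submodule.zero_mem _
  | zero =>
    rw [TensorProduct.tmul_zero, map_zero]
    exact Submodule.zero_mem _
  | add x y _ _ hx hy =>
    rw [TensorProduct.tmul_add, map_add]
    exact Submodule.add_mem _ hx hy
  | smul a x _ hx =>
    rw [algebraMap_smul_tmul, map_smul, algebraMap_smul]
    exact Submodule.smul_mem _ _ hx

/-- The products of distinct basis vectors, deformed from the exterior algebra to the Clifford
algebra: a basis over `Sym(U^∨)`. -/
noncomputable def basis : Module.Basis (Finset ι) (CoordRing U) (Cliff U) :=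
  (b.baseChange (CoordRing U)).ExteriorAlgebra.map
    (CliffordAlgebra.changeFormEquiv (bilin_toQuadraticMap U b))

theorem ι_baseChange_mem (i : ι) :
    CliffordAlgebra.ι (form U) (b.baseChange (CoordRing U) i) ∈ weight U 1 := by
  have h := gen_mem U (b i)
  rwa [gen, ← Module.Basis.baseChange_apply] at h

theorem contractLeft_bilin_mem (i : ι) (j : ℕ) (c : Cliff U) (hc : c ∈ weight U j) :
    CliffordAlgebra.contractLeft (bilin U b (b.baseChange (CoordRing U) i)) c ∈
      weight U (j + 1) := by
  refine contractLeft_mem U (fun v => ?_) hc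
  rw [Module.Basis.baseChange_apply]
  exact bilin_mem U b i v

theorem basis_mem (I : Finset ι) : basis U b I ∈ weight U I.card :=
  HalfGraded.changeForm_basis_mem (b.baseChange (CoordRing U)) (ι_baseChange_mem U b)
    (bilin_toQuadraticMap U b) (contractLeft_bilin_mem U b) I

variable [FiniteDimensional k V] {U} {n : ℕ}

theorem finite_weight [Module.Finite R U] [Module.Projective R U] (i : ℕ) :
    Module.Finite R (weight U i) :=
  Module.Finite.iff_fg.2 (HalfGraded.fg_of_basis (𝒮 := coordGrading U)
    (basis U (Module.finBasis k V)) (basis_mem U _) (SymGrading.part_fg (R := R)) i)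

theorem projective_cliff [Module.Finite R U] [Module.Projective R U] :
    Module.Projective R (Cliff U) := by
  classical
  exact Module.Projective.of_equiv ((finsuppLequivDFinsupp R).symm ≪≫ₗ
    ((basis U (Module.finBasis k V)).repr.restrictScalars R).symm)

theorem projective_weight [Module.Finite R U] [Module.Projective R U] (i : ℕ) :
    Module.Projective R (weight U i) := by
  have := projective_cliff (U := U)
  exact DirectSum.projective_of_decomposition (weight U) i

end CliffordSpace

/-! ### Stalks -/

namespace HalfGraded

section Stalks

variable {R S C : Type*} [CommRing R] [CommRing S] [Algebra R S] [Ring C] [Algebra R C]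
  [Algebra S C] {𝒮 : ℕ → Submodule R S} [GradedAlgebra 𝒮]

/-- The map from `C` to its stalk at a point. -/
noncomputable def toStalk (y : ProjectiveSpectrum 𝒮) : C →ₗ[S] Stalk 𝒮 C y :=
  LocalizedModule.mkLinearMap y.asHomogeneousIdeal.toIdeal.primeCompl C

theorem toStalk_eq_zero {y : ProjectiveSpectrum 𝒮} {c : C} :
    toStalk y c = 0 ↔ ∃ g ∉ y.asHomogeneousIdeal, g • c = 0 := by
  refine (IsLocalizedModule.eq_zero_iff y.asHomogeneousIdeal.toIdeal.primeCompl
    (LocalizedModule.mkLinearMap y.asHomogeneousIdeal.toIdeal.primeCompl C)).trans ⟨?_, ?_⟩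
  · rintro ⟨g, hg⟩
    exact ⟨g.1, g.2, hg⟩
  · rintro ⟨g, hg, h⟩
    exact ⟨⟨g, hg⟩, h⟩

theorem smul_stalk_cancel {y : ProjectiveSpectrum 𝒮} {g : S} (hg : g ∉ y.asHomogeneousIdeal)
    {s t : Stalk 𝒮 C y} (h : g • s = g • t) : s = t :=
  IsLocalizedModule.smul_injective (S := y.asHomogeneousIdeal.toIdeal.primeCompl)
    (LocalizedModule.mkLinearMap y.asHomogeneousIdeal.toIdeal.primeCompl C) ⟨g, hg⟩ h

theorem smul_stalk_mk {y : ProjectiveSpectrum 𝒮} (c : C)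
    (f : y.asHomogeneousIdeal.toIdeal.primeCompl) :
    f.1 • (Stalk.mk 𝒮 c f : Stalk 𝒮 C y) = toStalk y c := by
  refine (LocalizedModule.smul'_mk _ _ _).trans ?_
  exact LocalizedModule.mk_cancel f c

/-- The Nullstellensatz on `Proj`: a homogeneous element of positive degree that vanishes wherever a
homogeneous ideal does has a power in this ideal. -/
theorem exists_pow_mem {A : Ideal S} (hA : A.IsHomogeneous 𝒮) {x : S} {d : ℕ} (hd : 0 < d)
    (hx : x ∈ 𝒮 d)
    (h : ∀ y : ProjectiveSpectrum 𝒮, x ∉ y.asHomogeneousIdeal → ∃ g ∈ A, g ∉ y.asHomogeneousIdeal) :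
    ∃ N, x ^ N ∈ A := by
  change x ∈ A.radical
  rw [hA.radical_eq, Submodule.mem_sInf]
  rintro J ⟨hJ, hAJ, hJp⟩
  by_contra hxJ
  obtain ⟨g, hg, hgJ⟩ := h ⟨⟨J, hJ⟩, hJp, fun hle =>
    hxJ (hle (HomogeneousIdeal.mem_irrelevant_of_mem 𝒮 hd hx))⟩ hxJ
  exact hgJ (hAJ hg)

variable [IsScalarTower R S C] {𝒞 : ℕ → Submodule R C} [GradedAlgebra 𝒞] [HalfGraded 𝒮 𝒞]

theorem annihilator_isHomogeneous {w : ℕ} {c : C} (hc : c ∈ 𝒞 w) :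
    (LinearMap.ker (LinearMap.toSpanSingleton S C c)).IsHomogeneous 𝒮 := by
  intro d f hf
  have h : f • c = 0 := hf
  have h1 := decompose_smul_coe (𝒮 := 𝒮) hc (w + 2 * d) f
  rw [h, coeffPart_of_eq rfl, decompose_zero] at h1
  exact h1.symm

/-- An element that vanishes in all stalks over a basic open set is killed by a power of its
equation. -/
theorem exists_pow_smul_eq_zero {w : ℕ} {c : C} (hc : c ∈ 𝒞 w) {x : S} {d : ℕ} (hd : 0 < d)
    (hx : x ∈ 𝒮 d) (h : ∀ y : ProjectiveSpectrum 𝒮, x ∉ y.asHomogeneousIdeal → toStalk y c = 0) :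
    ∃ N, x ^ N • c = 0 := by
  refine exists_pow_mem (annihilator_isHomogeneous (𝒮 := 𝒮) hc) hd hx fun y hy => ?_
  obtain ⟨g, hg, hgc⟩ := toStalk_eq_zero.1 (h y hy)
  exact ⟨g, hgc, hg⟩

variable (𝒞) in
/-- The elements of `S` whose homogeneous components are global denominators for the section `s` of
`B_i`: multiplied by such a component of degree `d`, it comes from an element of weight `i + 2d`. -/
noncomputable def denominators (i : ℕ) (s : ∀ y : ProjectiveSpectrum 𝒮, Stalk 𝒮 C y) : Ideal S where
  carrier := {f | ∀ d, ∃ c ∈ 𝒞 (i + 2 * d), ∀ y, (decompose 𝒮 f d : S) • s y = toStalk y c}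
  zero_mem' d := ⟨0, Submodule.zero_mem _, fun y => by
    rw [decompose_zero, DirectSum.zero_apply, ZeroMemClass.coe_zero, zero_smul, map_zero]⟩
  add_mem' {f g} hf hg d := by
    obtain ⟨c, hc, h⟩ := hf d
    obtain ⟨c', hc', h'⟩ := hg d
    refine ⟨c + c', Submodule.add_mem _ hc hc', fun y => ?_⟩
    rw [LinearMap.map_add, ← h, ← h', ← add_smul, decompose_add]
    rfl
  smul_mem' g f hf d := by
    induction g using DirectSum.Decomposition.inductionOn 𝒮 with
    | zero => exact ⟨0, Submodule.zero_mem _, fun y => by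
        rw [zero_smul, decompose_zero, DirectSum.zero_apply, ZeroMemClass.coe_zero, zero_smul,
          map_zero]⟩
    | @homogeneous e g =>
      by_cases hed : e ≤ d
      · obtain ⟨c, hc, h⟩ := hf (d - e)
        refine ⟨g.1 • c, ?_, fun y => ?_⟩
        · have := smul_mem (𝒮 := 𝒮) g.2 hc
          rwa [show i + 2 * (d - e) + 2 * e = i + 2 * d by omega] at this
        · rw [smul_eq_mul, coe_decompose_mul_of_left_mem_of_le 𝒮 g.2 hed, mul_smul, h, map_smul]
      · refine ⟨0, Submodule.zero_mem _, fun y => ?_⟩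
        rw [smul_eq_mul, coe_decompose_mul_of_left_mem_of_not_le 𝒮 g.2 hed, zero_smul, map_zero]
    | add x z hx hz =>
      obtain ⟨c, hc, h⟩ := hx
      obtain ⟨c', hc', h'⟩ := hz
      refine ⟨c + c', Submodule.add_mem _ hc hc', fun y => ?_⟩
      rw [LinearMap.map_add, ← h, ← h', ← add_smul, add_smul x, decompose_add]
      rfl

theorem mem_denominators {i d : ℕ} {s : ∀ y : ProjectiveSpectrum 𝒮, Stalk 𝒮 C y} {f : S}
    (hf : f ∈ 𝒮 d) : f ∈ denominators 𝒞 i s ↔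
      ∃ c ∈ 𝒞 (i + 2 * d), ∀ y, f • s y = toStalk y c := by
  constructor
  · intro h
    have := h d
    rwa [decompose_of_mem_same 𝒮 hf] at this
  · intro h e
    by_cases hde : d = e
    · subst hde
      rwa [decompose_of_mem_same 𝒮 hf]
    · refine ⟨0, Submodule.zero_mem _, fun y => ?_⟩
      rw [decompose_of_mem_ne 𝒮 hf hde, zero_smul, map_zero]

theorem denominators_isHomogeneous (i : ℕ) (s : ∀ y : ProjectiveSpectrum 𝒮, Stalk 𝒮 C y) :
    (denominators 𝒞 i s).IsHomogeneous 𝒮 := fun d _ hf =>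
  (mem_denominators (SetLike.coe_mem _)).2 (hf d)

/-- The homogeneous elements of positive degree that are denominators of the section `s` over the
complement of their zero set. -/
def localDenominators (𝒞 : ℕ → Submodule R C) (i : ℕ)
    (s : ∀ y : ProjectiveSpectrum 𝒮, Stalk 𝒮 C y) : Set S :=
  {h | ∃ d, 0 < d ∧ h ∈ 𝒮 d ∧ ∃ c ∈ 𝒞 (i + 2 * d), ∀ y : ProjectiveSpectrum 𝒮,
    h ∉ y.asHomogeneousIdeal → h • s y = toStalk y c}

/-- Every point of `Proj` has a neighbourhood that is the complement of the zero set of a local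
denominator of a given section. -/
theorem exists_localDenominator {T : Set S} (hT1 : ∀ x ∈ T, x ∈ 𝒮 1)
    (hT : ∀ y : ProjectiveSpectrum 𝒮, ∃ x ∈ T, x ∉ y.asHomogeneousIdeal) {i : ℕ}
    (s : Sec 𝒮 𝒞 i ⊤) (y : ProjectiveSpectrum 𝒮) :
    ∃ h ∈ localDenominators 𝒞 i (fun y => s.1 ⟨y, Opens.mem_top y⟩), h ∉ y.asHomogeneousIdeal := by
  obtain ⟨W, hyW, -, d, c, f, hc, hf, hs⟩ := s.2 ⟨y, Opens.mem_top y⟩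
  obtain ⟨x, hxT, hxy⟩ := hT y
  obtain ⟨_, ⟨g, rfl⟩, hyg, hgW⟩ := (ProjectiveSpectrum.isTopologicalBasis_basic_opens
    𝒮).exists_subset_of_mem_open hyW W.2
  have hg : g ∉ y.asHomogeneousIdeal := hyg
  obtain ⟨e, he⟩ : ∃ e, (decompose 𝒮 g e : S) ∉ y.asHomogeneousIdeal := by
    classical
    by_contra! h
    refine hg ?_
    rw [← sum_support_decompose 𝒮 g]
    exact Ideal.sum_mem _ fun e _ => h e
  have hyp := y.isPrime
  have hfy : f ∉ y.asHomogeneousIdeal := (hs ⟨y, Opens.mem_top y⟩ hyW).1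
  -- The factor `f` is the denominator near `y`, the factor `g_e` restricts to a neighbourhood where
  -- the fraction is valid, and `x` makes the degree positive.
  refine ⟨x * (decompose 𝒮 g e * f), ⟨1 + (e + d), by omega, SetLike.GradedMul.mul_mem (hT1 x hxT)
    (SetLike.GradedMul.mul_mem (SetLike.coe_mem _) hf), x • (decompose 𝒮 g e : S) • c, ?_,
    fun z hz => ?_⟩, ?_⟩
  · have := smul_mem (𝒮 := 𝒮) (hT1 x hxT)
      (smul_mem (𝒮 := 𝒮) (SetLike.coe_mem (decompose 𝒮 g e)) hc)
    rwa [show i + 2 * d + 2 * e + 2 * 1 = i + 2 * (1 + (e + d)) by ring] at this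
  · have hgz : g ∉ z.asHomogeneousIdeal := fun h => hz
      (Ideal.mul_mem_left _ _ (Ideal.mul_mem_right _ _ (z.asHomogeneousIdeal.2 e h)))
    obtain ⟨h1, h2⟩ := hs ⟨z, Opens.mem_top z⟩ (hgW hgz)
    have h3 : f • s.1 ⟨z, Opens.mem_top z⟩ = toStalk z c := by
      rw [h2]
      exact smul_stalk_mk c ⟨f, h1⟩
    rw [mul_smul, mul_smul, map_smul, map_smul]
    exact congrArg _ (congrArg _ h3)
  · exact fun h => (hyp.mem_or_mem h).elim hxy fun h => (hyp.mem_or_mem h).elim he hfy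

/-- `Proj` is covered by the complements of the zero sets of finitely many local denominators, being
quasi-compact when it is covered by those of finitely many elements of degree one. -/
theorem exists_finset_localDenominators {T : Finset S} (hT1 : ∀ x ∈ T, x ∈ 𝒮 1)
    (hT : ∀ y : ProjectiveSpectrum 𝒮, ∃ x ∈ T, x ∉ y.asHomogeneousIdeal) {i : ℕ}
    (s : Sec 𝒮 𝒞 i ⊤) :
    ∃ H : Finset S, (∀ h ∈ H, h ∈ localDenominators 𝒞 i (fun y => s.1 ⟨y, Opens.mem_top y⟩)) ∧
      ∀ y : ProjectiveSpectrum 𝒮, ∃ h ∈ H, h ∉ y.asHomogeneousIdeal := by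
  classical
  set D := localDenominators 𝒞 i (fun y => s.1 ⟨y, Opens.mem_top y⟩)
  have h1 : ∀ x ∈ T, ∃ (H : Finset S) (N : ℕ), ↑H ⊆ D ∧ x ^ N ∈ Ideal.span (H : Set S) := by
    intro x hx
    obtain ⟨N, hN⟩ := exists_pow_mem (𝒮 := 𝒮) (A := Ideal.span D)
      (Ideal.homogeneous_span 𝒮 D fun h ⟨d, _, hd, _⟩ => ⟨d, hd⟩) one_pos (hT1 x hx)
      fun y _ => by
        obtain ⟨h, hh, hy⟩ := exists_localDenominator (T := ↑T) hT1 hT s y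
        exact ⟨h, Ideal.subset_span hh, hy⟩
    obtain ⟨H, hH, hx⟩ := Submodule.mem_span_finite_of_mem_span hN
    exact ⟨H, N, hH, hx⟩
  choose! H N hH hx using h1
  refine ⟨T.biUnion H, fun h hh => ?_, fun y => ?_⟩
  · obtain ⟨x, hxT, hh⟩ := Finset.mem_biUnion.1 hh
    exact hH x hxT hh
  · obtain ⟨x, hxT, hxy⟩ := hT y
    by_contra! h
    have hyp := y.isPrime
    refine hxy (hyp.mem_of_pow_mem (N x) ?_)
    refine (Ideal.span_le.2 fun a ha => ?_) (hx x hxT)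
    exact h a (Finset.mem_biUnion.2 ⟨x, hxT, ha⟩)

/-- Multiplied by a high power of an element of degree one, a global section comes from `C`. -/
theorem exists_pow_mem_denominators {T : Finset S} (hT1 : ∀ x ∈ T, x ∈ 𝒮 1)
    (hT : ∀ y : ProjectiveSpectrum 𝒮, ∃ x ∈ T, x ∉ y.asHomogeneousIdeal) {i : ℕ}
    (s : Sec 𝒮 𝒞 i ⊤) {x : S} (hx : x ∈ 𝒮 1) :
    ∃ N, x ^ N ∈ denominators 𝒞 i (fun y => s.1 ⟨y, Opens.mem_top y⟩) := by
  obtain ⟨H, hH, hHy⟩ := exists_finset_localDenominators hT1 hT s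
  set t : ∀ y : ProjectiveSpectrum 𝒮, Stalk 𝒮 C y := fun y => s.1 ⟨y, Opens.mem_top y⟩
  refine exists_pow_mem (denominators_isHomogeneous i t) one_pos hx fun y _ => ?_
  obtain ⟨h, hh, hhy⟩ := hHy y
  obtain ⟨d, hd, hhd, c, hc, hhc⟩ := hH h hh
  -- If `h` and `a` are local denominators with numerators `c` and `c'`, then `c / h = c' / a` where
  -- both are defined, so a power of `h * a` kills `a • c - h • c'`.
  have h1 : ∀ a ∈ H, ∃ (c' : C) (N : ℕ), (∀ y : ProjectiveSpectrum 𝒮, a ∉ y.asHomogeneousIdeal →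
      a • t y = toStalk y c') ∧ (h * a) ^ N • (a • c - h • c') = 0 := by
    intro a ha
    obtain ⟨d', hd', had, c', hc', hac⟩ := hH a ha
    have hw : a • c - h • c' ∈ 𝒞 (i + 2 * (d + d')) := by
      refine Submodule.sub_mem _ ?_ ?_
      · have := smul_mem (𝒮 := 𝒮) had hc
        rwa [show i + 2 * d + 2 * d' = i + 2 * (d + d') by ring] at this
      · have := smul_mem (𝒮 := 𝒮) hhd hc'
        rwa [show i + 2 * d' + 2 * d = i + 2 * (d + d') by ring] at this
    obtain ⟨N, hN⟩ := exists_pow_smul_eq_zero (𝒮 := 𝒮) hw (Nat.add_pos_left hd d')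
      (SetLike.GradedMul.mul_mem hhd had) fun z hz => by
        have h2 : h ∉ z.asHomogeneousIdeal := fun h2 => hz (Ideal.mul_mem_right _ _ h2)
        have h3 : a ∉ z.asHomogeneousIdeal := fun h3 => hz (Ideal.mul_mem_left _ _ h3)
        rw [LinearMap.map_sub, map_smul, map_smul, ← hhc z h2, ← hac z h3, smul_comm, sub_self]
    exact ⟨c', N, hac, hN⟩
  choose! c' N hac hN using h1
  have hyp := y.isPrime
  -- So `h` to the power `∑ N + 1` is a global denominator, with numerator `h ^ ∑ N • c`: this can be
  -- checked where one of the finitely many `a` does not vanish, after multiplication by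
  -- `a ^ (N a + 1)`.
  refine ⟨h ^ (∑ a ∈ H, N a + 1), ?_, fun h2 => hhy (hyp.mem_of_pow_mem _ h2)⟩
  have hdeg : ∀ M : ℕ, h ^ M ∈ 𝒮 (M * d) := fun M => SetLike.pow_mem_graded M hhd
  refine (mem_denominators (hdeg _)).2 ⟨h ^ (∑ a ∈ H, N a) • c, ?_, fun z => ?_⟩
  · have := smul_mem (𝒮 := 𝒮) (hdeg (∑ a ∈ H, N a)) hc
    rwa [show i + 2 * d + 2 * ((∑ a ∈ H, N a) * d) = i + 2 * ((∑ a ∈ H, N a + 1) * d) by ring]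
      at this
  · obtain ⟨a, ha, haz⟩ := hHy z
    obtain ⟨M, hM⟩ : ∃ M, ∑ a ∈ H, N a = N a + M :=
      Nat.exists_eq_add_of_le (Finset.single_le_sum (fun _ _ => Nat.zero_le _) ha)
    have hzp := z.isPrime
    have hz2 : a ^ (N a + 1) ∉ z.asHomogeneousIdeal := fun h2 => haz (hzp.mem_of_pow_mem _ h2)
    apply smul_stalk_cancel hz2
    have h4 : (h ^ M * (h * a) ^ N a) • (a • c - h • c' a) = 0 := by
      rw [mul_smul, hN a ha, smul_zero]
    rw [hM, smul_smul, show a ^ (N a + 1) * h ^ (N a + M + 1) = (h ^ M * (h * a) ^ N a * h) * a by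
      ring, mul_smul, hac a ha z haz, ← map_smul, ← map_smul, smul_smul,
      show a ^ (N a + 1) * h ^ (N a + M) = h ^ M * (h * a) ^ N a * a by ring]
    rw [smul_sub, sub_eq_zero, smul_smul, smul_smul] at h4
    rw [h4]

end Stalks

end HalfGraded

/-! ### Global sections over a projective bundle -/

/-- The module `L` is locally free of rank `n`: every prime has a neighbourhood, given by the
nonvanishing of some `r`, over which `L` becomes isomorphic to `Rⁿ`; the isomorphism and its inverse
are multiplied by denominators to be defined over `R`, so that they compose to `r`. -/
def Module.IsLocallyFreeOfRank (R L : Type*) [CommRing R] [AddCommGroup L] [Module R L] (n : ℕ) :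
    Prop :=
  ∀ p : PrimeSpectrum R, ∃ r ∉ p.asIdeal, ∃ (F : (Fin n → R) →ₗ[R] L) (G : L →ₗ[R] (Fin n → R)),
    F ∘ₗ G = r • LinearMap.id ∧ G ∘ₗ F = r • LinearMap.id

theorem Module.IsLocallyFreeOfRank.dual {R U : Type*} [CommRing R] [AddCommGroup U] [Module R U]
    {n : ℕ} (h : Module.IsLocallyFreeOfRank R U n) :
    Module.IsLocallyFreeOfRank R (Module.Dual R U) n := by
  intro p
  obtain ⟨r, hr, F, G, hFG, hGF⟩ := h p
  let e := (Pi.basisFun R (Fin n)).toDualEquiv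
  refine ⟨r, hr, G.dualMap ∘ₗ e.toLinearMap, e.symm.toLinearMap ∘ₗ F.dualMap, ?_, ?_⟩
  · refine LinearMap.ext fun l => LinearMap.ext fun u => ?_
    have h1 : F (G u) = r • u := LinearMap.congr_fun hFG u
    change e (e.symm (F.dualMap l)) (G u) = r • l u
    rw [LinearEquiv.apply_symm_apply, LinearMap.dualMap_apply, h1, map_smul]
  · refine LinearMap.ext fun x => ?_
    change e.symm (F.dualMap (G.dualMap (e x))) = r • x
    have h1 : F.dualMap (G.dualMap (e x)) = r • e x := by
      refine LinearMap.ext fun z => ?_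
      have h1 : G (F z) = r • z := LinearMap.congr_fun hGF z
      rw [LinearMap.dualMap_apply, LinearMap.dualMap_apply, h1, map_smul]
      rfl
    rw [h1, map_smul, LinearEquiv.symm_apply_apply]

theorem Ideal.eq_top_of_forall_primeSpectrum {R : Type*} [CommRing R] {J : Ideal R}
    (h : ∀ p : PrimeSpectrum R, ∃ r ∉ p.asIdeal, r ∈ J) : J = ⊤ := by
  by_contra hJ
  obtain ⟨m, hm, hle⟩ := J.exists_le_maximal hJ
  obtain ⟨r, hr, hrJ⟩ := h ⟨m, hm.isPrime⟩
  exact hr (hle hrJ)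

/-- The elements of a spanning set of `L` have no common zero on `Proj (Sym L)`. -/
theorem SymGrading.exists_ι_notMem {R L : Type*} [CommRing R] [AddCommGroup L] [Module R L]
    {T : Set L} (hT : Submodule.span R T = ⊤) (y : ProjectiveSpectrum (SymGrading.part R L)) :
    ∃ l ∈ T, SymmetricAlgebra.ι R L l ∉ y.asHomogeneousIdeal := by
  classical
  by_contra! h
  have h1 : ∀ l, SymmetricAlgebra.ι R L l ∈ y.asHomogeneousIdeal.toIdeal := by
    intro l
    have hl : l ∈ Submodule.span R T := by
      rw [hT]
      trivial
    induction hl using Submodule.span_induction with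
    | mem l hl => exact h l hl
    | zero =>
      rw [map_zero]
      exact Submodule.zero_mem _
    | add l l' _ _ hl hl' =>
      rw [map_add]
      exact Submodule.add_mem _ hl hl'
    | smul r l _ hl =>
      rw [map_smul, Algebra.smul_def]
      exact Ideal.mul_mem_left _ _ hl
  have h2 : ∀ d, 0 < d → ∀ x ∈ SymGrading.part R L d, x ∈ y.asHomogeneousIdeal.toIdeal := by
    intro d hd x hx
    obtain ⟨d, rfl⟩ := Nat.exists_eq_succ_of_ne_zero hd.ne'
    rw [SymGrading.part, Nat.succ_eq_add_one, pow_succ'] at hx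
    induction hx using Submodule.mul_induction_on' with
    | mem_mul_mem a ha b hb =>
      obtain ⟨l, rfl⟩ := ha
      exact Ideal.mul_mem_right _ _ (h1 l)
    | add a _ b _ ha hb => exact Submodule.add_mem _ ha hb
  refine y.not_irrelevant_le fun x hx => ?_
  change x ∈ y.asHomogeneousIdeal.toIdeal
  rw [← sum_support_decompose (SymGrading.part R L) x]
  refine Ideal.sum_mem _ fun d _ => ?_
  rcases Nat.eq_zero_or_pos d with rfl | hd
  · have h3 : (decompose (SymGrading.part R L) x 0 : SymmetricAlgebra R L) = 0 := hx
    rw [h3]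
    exact Ideal.zero_mem _
  · exact h2 d hd _ (SetLike.coe_mem _)

/-- High powers of the `r • l` are combinations of powers of the coordinates. -/
theorem SymGrading.pow_mem_span_pow {R L σ : Type*} [CommRing R] [AddCommGroup L] [Module R L]
    [Fintype σ] [DecidableEq σ] {F : (σ → R) →ₗ[R] L} {G : L →ₗ[R] (σ → R)} {r : R}
    (hFG : F ∘ₗ G = r • LinearMap.id) (l : L) (N : ℕ) :
    (algebraMap R (SymmetricAlgebra R L) r * SymmetricAlgebra.ι R L l) ^
      (Fintype.card σ * N + 1) ∈ Ideal.span (Set.range fun j : σ =>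
        SymmetricAlgebra.ι R L (F (Pi.single j 1)) ^ (N + 1)) := by
  have h3 : algebraMap R (SymmetricAlgebra R L) r * SymmetricAlgebra.ι R L l =
      ∑ j, algebraMap R (SymmetricAlgebra R L) (G l j) *
        SymmetricAlgebra.ι R L (F (Pi.single j 1)) := by
    have h4 : F (G l) = r • l := LinearMap.congr_fun hFG l
    rw [← Algebra.smul_def, ← map_smul, ← h4]
    conv_lhs => rw [pi_eq_sum_univ' (G l), map_sum, map_sum]
    refine Finset.sum_congr rfl fun j _ => ?_
    rw [map_smul, map_smul, Algebra.smul_def]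
  have h6 := Ideal.sum_pow_mem_span_pow Finset.univ (fun j =>
    algebraMap R (SymmetricAlgebra R L) (G l j) * SymmetricAlgebra.ι R L (F (Pi.single j 1))) N
  rw [h3]
  refine Ideal.span_le.2 ?_ h6
  rintro _ ⟨j, -, rfl⟩
  simp only [mul_pow]
  exact Ideal.mul_mem_left _ _ (Ideal.subset_span ⟨j, rfl⟩)

namespace HalfGraded

variable {R L C I : Type*} [CommRing R] [AddCommGroup L] [Module R L] [Ring C] [Algebra R C]
  [Algebra (SymmetricAlgebra R L) C] [IsScalarTower R (SymmetricAlgebra R L) C]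
  {𝒞 : ℕ → Submodule R C} [GradedAlgebra 𝒞] [HalfGraded (SymGrading.part R L) 𝒞] [Fintype I]
  (B : Module.Basis I (SymmetricAlgebra R L) C) {deg : I → ℕ} (hB : ∀ a, B a ∈ 𝒞 (deg a))

section Local

variable {σ : Type*} [Fintype σ] [DecidableEq σ] {F : (σ → R) →ₗ[R] L} {G : L →ₗ[R] (σ → R)}
  {r : R}

include hB in
/-- The coordinates are nonzerodivisors on `C` up to powers of the denominator. -/
theorem exists_pow_smul_eq_zero_of_coordinate (hFG : F ∘ₗ G = r • LinearMap.id)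
    (hGF : G ∘ₗ F = r • LinearMap.id) {w : ℕ} {c : C} (hc : c ∈ 𝒞 w) (j : σ) {N : ℕ}
    (h : SymmetricAlgebra.ι R L (F (Pi.single j 1)) ^ N • c = 0) : ∃ m, r ^ m • c = 0 := by
  have h1 : ∀ a, ∃ m, r ^ m • B.repr c a = 0 := by
    intro a
    by_cases h' : ∃ d, deg a + 2 * d = w
    · obtain ⟨d, h'⟩ := h'
      refine ⟨N + d, SymGrading.smul_eq_zero_of_pow_mul hFG hGF (repr_mem B hB hc h') j ?_⟩
      have := congrArg (fun c => B.repr c a) h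
      simpa using this
    · push Not at h'
      exact ⟨0, by rw [repr_eq_zero B hB (SymGrading.part R L) hc h', smul_zero]⟩
  choose m hm using h1
  refine ⟨∑ a, m a, B.ext_elem fun a => ?_⟩
  obtain ⟨M, hM⟩ : ∃ M, ∑ a, m a = m a + M := Nat.exists_eq_add_of_le
    (Finset.single_le_sum (f := m) (fun _ _ => Nat.zero_le _) (Finset.mem_univ a))
  rw [← algebraMap_smul (SymmetricAlgebra R L), map_smul, map_zero, Finsupp.smul_apply,
    algebraMap_smul, hM, add_comm, pow_add, mul_smul, hm, smul_zero]
  rfl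

include hB in
/-- Elements of weight `i + 2M` that are the products of `y_j ^ M` with a common section come, up
to a power of the denominator, from an element of weight `i`. -/
theorem exists_pow_smul_eq_pow_smul [Nonempty σ] (hn : 1 < Fintype.card σ ∨ ∀ a, deg a ≤ 1)
    (hFG : F ∘ₗ G = r • LinearMap.id) (hGF : G ∘ₗ F = r • LinearMap.id) {i M : ℕ} (c : σ → C)
    (hc : ∀ j, c j ∈ 𝒞 (i + 2 * M))
    (h : ∀ j k, SymmetricAlgebra.ι R L (F (Pi.single k 1)) ^ M • c j =
      SymmetricAlgebra.ι R L (F (Pi.single j 1)) ^ M • c k) :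
    ∃ m, ∃ c' ∈ 𝒞 i, ∀ j, r ^ m • c j = SymmetricAlgebra.ι R L (F (Pi.single j 1)) ^ M • c' := by
  have h1 : ∀ a, ∃ (m : ℕ) (f : SymmetricAlgebra R L), f • B a ∈ 𝒞 i ∧ ∀ j,
      r ^ m • B.repr (c j) a = SymmetricAlgebra.ι R L (F (Pi.single j 1)) ^ M * f := by
    intro a
    by_cases h' : ∃ e, deg a + 2 * e = i + 2 * M
    · obtain ⟨e, h'⟩ := h'
      obtain ⟨f, hf, hf0, hfj⟩ := SymGrading.exists_smul_eq_pow_mul hFG hGF (e := e) (M := M)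
        (hn.imp_right fun hn => by
          have := hn a
          omega) (fun j => B.repr (c j) a)
        (fun j => repr_mem B hB (hc j) h') fun j k => by
          have := congrArg (fun c => B.repr c a) (h j k)
          simpa using this
      refine ⟨M + e, f, ?_, hfj⟩
      rcases le_or_gt M e with hM | hM
      · have := smul_mem (𝒮 := SymGrading.part R L) (hf hM) (hB a)
        rwa [show deg a + 2 * (e - M) = i by omega] at this
      · rw [hf0 hM, zero_smul]
        exact Submodule.zero_mem _
    · push Not at h'
      refine ⟨0, 0, by rw [zero_smul]; exact Submodule.zero_mem _, fun j => ?_⟩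
      rw [repr_eq_zero B hB (SymGrading.part R L) (hc j) h', smul_zero, mul_zero]
  choose m f hf hfj using h1
  have hM : ∀ a, ∑ a, m a = (∑ a, m a - m a) + m a := fun a => (Nat.sub_add_cancel
    (Finset.single_le_sum (f := m) (fun _ _ => Nat.zero_le _) (Finset.mem_univ a))).symm
  refine ⟨∑ a, m a, ∑ a, r ^ (∑ a, m a - m a) • f a • B a,
    Submodule.sum_mem _ fun a _ => Submodule.smul_mem _ _ (hf a), fun j => ?_⟩
  conv_lhs => rw [← B.sum_repr (c j)]
  rw [Finset.smul_sum, Finset.smul_sum]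
  refine Finset.sum_congr rfl fun a _ => ?_
  conv_lhs => rw [hM a]
  rw [pow_add, mul_smul, ← smul_assoc (r ^ m a), hfj, mul_smul]
  rw [smul_comm]

end Local

variable [Module.Finite R L] {n : ℕ} (hL : Module.IsLocallyFreeOfRank R L n) (hn : 0 < n)

include hB hL hn in
/-- Homogeneous elements that vanish in all stalks vanish. -/
theorem eq_zero_of_toStalk {w : ℕ} {c : C} (hc : c ∈ 𝒞 w)
    (h : ∀ y : ProjectiveSpectrum (SymGrading.part R L), toStalk y c = 0) : c = 0 := by
  -- The annihilator of `c` in `R` is contained in no prime ideal.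
  have hJ : LinearMap.ker (LinearMap.toSpanSingleton R C c) = (⊤ : Ideal R) := by
    refine Ideal.eq_top_of_forall_primeSpectrum fun p => ?_
    obtain ⟨r, hr, F, G, hFG, hGF⟩ := hL p
    obtain ⟨N, hN⟩ := exists_pow_smul_eq_zero (𝒮 := SymGrading.part R L) hc one_pos
      (SymGrading.ι_mem_part (F (Pi.single ⟨0, hn⟩ 1))) fun y _ => h y
    obtain ⟨m, hm⟩ := exists_pow_smul_eq_zero_of_coordinate B hB hFG hGF hc _ hN
    have hp := p.isPrime
    exact ⟨r ^ m, fun h => hr (hp.mem_of_pow_mem _ h), hm⟩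
  have h1 : (1 : R) ∈ LinearMap.ker (LinearMap.toSpanSingleton R C c) := by
    rw [hJ]
    trivial
  simpa using h1

include hB hL hn in
theorem eq_of_toStalk {w : ℕ} {c c' : C} (hc : c ∈ 𝒞 w) (hc' : c' ∈ 𝒞 w)
    (h : ∀ y : ProjectiveSpectrum (SymGrading.part R L), toStalk y c = toStalk y c') : c = c' :=
  sub_eq_zero.1 (eq_zero_of_toStalk B hB hL hn (Submodule.sub_mem _ hc hc') fun y => by
    rw [LinearMap.map_sub, h, sub_self])

theorem exists_pow_ι_mem_denominators {i : ℕ} (s : Sec (SymGrading.part R L) 𝒞 i ⊤) (l : L) :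
    ∃ N, SymmetricAlgebra.ι R L l ^ N ∈ denominators 𝒞 i (fun y => s.1 ⟨y, Opens.mem_top y⟩) := by
  classical
  obtain ⟨T, hT⟩ := Module.Finite.fg_top (R := R) (M := L)
  refine exists_pow_mem_denominators (T := T.image (SymmetricAlgebra.ι R L)) (fun x hx => ?_)
    (fun y => ?_) s (SymGrading.ι_mem_part l)
  · obtain ⟨l, -, rfl⟩ := Finset.mem_image.1 hx
    exact SymGrading.ι_mem_part l
  · obtain ⟨l, hl, hy⟩ := SymGrading.exists_ι_notMem hT y
    exact ⟨_, Finset.mem_image_of_mem _ hl, hy⟩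

variable (hdeg : 1 < n ∨ ∀ a, deg a ≤ 1)

include hB hL hn hdeg in
/-- Up to a denominator `r ^ m` a global section agrees with an element of weight `i` after
multiplication by high powers of the local coordinates. The hypothesis `hdeg` excludes the sections
of the negative twists `𝒪(s)` over a projective bundle of relative dimension zero. -/
theorem exists_pow_smul_eq_toStalk {F : (Fin n → R) →ₗ[R] L} {G : L →ₗ[R] (Fin n → R)} {r : R}
    (hFG : F ∘ₗ G = r • LinearMap.id) (hGF : G ∘ₗ F = r • LinearMap.id) {i : ℕ}
    (s : Sec (SymGrading.part R L) 𝒞 i ⊤) : ∃ N m, ∃ c ∈ 𝒞 i, ∀ j y,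
      SymmetricAlgebra.ι R L (F (Pi.single j 1)) ^ (N + 1) •
        algebraMap R (SymmetricAlgebra R L) (r ^ m) • s.1 ⟨y, Opens.mem_top y⟩ =
          SymmetricAlgebra.ι R L (F (Pi.single j 1)) ^ (N + 1) • toStalk y c := by
  set t : ∀ y : ProjectiveSpectrum (SymGrading.part R L), Stalk (SymGrading.part R L) C y :=
    fun y => s.1 ⟨y, Opens.mem_top y⟩
  have : Nonempty (Fin n) := ⟨⟨0, hn⟩⟩
  have hN : ∀ j : Fin n, ∃ N, SymmetricAlgebra.ι R L (F (Pi.single j 1)) ^ N ∈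
      denominators 𝒞 i t := fun j => exists_pow_ι_mem_denominators s _
  choose N hN using hN
  have h1 : ∀ j, SymmetricAlgebra.ι R L (F (Pi.single j 1)) ^ (∑ j, N j + 1) ∈
      SymGrading.part R L (∑ j, N j + 1) := fun j => by
    simpa using SetLike.pow_mem_graded (∑ j, N j + 1)
      (SymGrading.ι_mem_part (R := R) (F (Pi.single j 1)))
  have hM' : ∀ j : Fin n, ∃ c ∈ 𝒞 (i + 2 * (∑ j, N j + 1)), ∀ y,
      SymmetricAlgebra.ι R L (F (Pi.single j 1)) ^ (∑ j, N j + 1) • t y = toStalk y c := by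
    intro j
    refine (mem_denominators (h1 j)).1 (Ideal.mem_of_dvd _ (pow_dvd_pow _ ?_) (hN j))
    exact (Finset.single_le_sum (f := N) (fun _ _ => Nat.zero_le _) (Finset.mem_univ j)).trans
      (Nat.le_succ _)
  choose c hc hct using hM'
  obtain ⟨m, c', hc', hcc⟩ := exists_pow_smul_eq_pow_smul B hB
    (hdeg.imp_left fun h => by rwa [Fintype.card_fin]) hFG hGF c hc fun j k => by
      refine eq_of_toStalk B hB hL hn (smul_mem (h1 k) (hc j)) (smul_mem (h1 j) (hc k))
        fun y => ?_
      rw [map_smul, map_smul, ← hct, ← hct, smul_comm]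
  refine ⟨∑ j, N j, m, c', hc', fun j y => ?_⟩
  rw [smul_comm, ← map_smul, ← hcc, ← algebraMap_smul (SymmetricAlgebra R L) (r ^ m) (c j),
    map_smul, ← hct]

include hB hL hn hdeg in
/-- Near a point of `Spec R` a global section comes from an element of weight `i`. -/
theorem exists_smul_eq_toStalk {i : ℕ} (s : Sec (SymGrading.part R L) 𝒞 i ⊤) (p : PrimeSpectrum R) :
    ∃ r ∉ p.asIdeal, ∃ c ∈ 𝒞 i, ∀ y, algebraMap R (SymmetricAlgebra R L) r •
      s.1 ⟨y, Opens.mem_top y⟩ = toStalk y c := by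
  obtain ⟨r, hr, F, G, hFG, hGF⟩ := hL p
  obtain ⟨N, m, c', hc', hcc⟩ := exists_pow_smul_eq_toStalk B hB hL hn hdeg hFG hGF s
  set t : ∀ y : ProjectiveSpectrum (SymGrading.part R L), Stalk (SymGrading.part R L) C y :=
    fun y => s.1 ⟨y, Opens.mem_top y⟩
  refine ⟨r ^ (n * N + 1 + m), fun h => hr (p.isPrime.mem_of_pow_mem _ h),
    r ^ (n * N + 1) • c', Submodule.smul_mem _ _ hc', fun y => ?_⟩
  -- Over the nonvanishing set of `r` the powers of the coordinates have no common zero, as a power of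
  -- `r • l` lies in the ideal that they generate, for every `l`.
  obtain ⟨l, -, hl⟩ := SymGrading.exists_ι_notMem (T := Set.univ) Submodule.span_univ y
  have hyp := y.isPrime
  have hl' : SymmetricAlgebra.ι R L l ^ (n * N + 1) ∉ y.asHomogeneousIdeal :=
    fun h => hl (hyp.mem_of_pow_mem _ h)
  apply smul_stalk_cancel hl'
  have h5 := SymGrading.pow_mem_span_pow hFG l N
  rw [Fintype.card_fin] at h5
  have h7 : ∀ f ∈ Ideal.span (Set.range fun j : Fin n =>
      SymmetricAlgebra.ι R L (F (Pi.single j 1)) ^ (N + 1)),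
      f • algebraMap R (SymmetricAlgebra R L) (r ^ m) • t y = f • toStalk y c' := by
    intro f hf
    induction hf using Submodule.span_induction with
    | mem f hf =>
      obtain ⟨j, rfl⟩ := hf
      exact hcc j y
    | zero => rw [zero_smul, zero_smul]
    | add f g _ _ hf hg => rw [add_smul, add_smul, hf, hg]
    | smul a f _ hf => rw [smul_assoc, smul_assoc, hf]
  have h8 := h7 _ h5
  rw [smul_smul, mul_pow, ← map_pow,
    mul_comm (algebraMap R _ _) (SymmetricAlgebra.ι R L l ^ _)] at h8
  rw [smul_smul, ← algebraMap_smul (SymmetricAlgebra R L) (r ^ (n * N + 1)) c', map_smul,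
    smul_smul, pow_add r _ m, map_mul, ← mul_assoc]
  exact h8

include hB hL hn hdeg in
/-- Every global section of the sheaf `B_i` comes from an element of weight `i`. -/
theorem exists_eq_toStalk {i : ℕ} (s : Sec (SymGrading.part R L) 𝒞 i ⊤) :
    ∃ c ∈ 𝒞 i, ∀ y, s.1 ⟨y, Opens.mem_top y⟩ = toStalk y c := by
  set t : ∀ y : ProjectiveSpectrum (SymGrading.part R L), Stalk (SymGrading.part R L) C y :=
    fun y => s.1 ⟨y, Opens.mem_top y⟩
  have h0 : ∀ r : R, algebraMap R (SymmetricAlgebra R L) r ∈ SymGrading.part R L 0 := fun r =>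
    SetLike.algebraMap_mem_graded _ r
  -- The denominators of the section that lie in `R` form an ideal contained in no prime ideal.
  have hJ : (denominators 𝒞 i t).comap (algebraMap R (SymmetricAlgebra R L)) = ⊤ :=
    Ideal.eq_top_of_forall_primeSpectrum fun p => by
      obtain ⟨r, hr, c, hc, h⟩ := exists_smul_eq_toStalk B hB hL hn hdeg s p
      exact ⟨r, hr, (mem_denominators (h0 r)).2 ⟨c, hc, h⟩⟩
  have h1 : (1 : R) ∈ (denominators 𝒞 i t).comap (algebraMap R (SymmetricAlgebra R L)) := by
    rw [hJ]
    trivial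
  obtain ⟨c, hc, h⟩ := (mem_denominators (h0 1)).1 h1
  refine ⟨c, hc, fun y => ?_⟩
  rw [← h, map_one, one_smul]

variable (L 𝒞) in
/-- The elements of weight `i` as morphisms from `B_0` to `B_i`. -/
noncomputable def ofElemHom (i : ℕ) : 𝒞 i →ₗ[R] SheafHom (SymGrading.part R L) 𝒞 i where
  toFun c := SheafHom.ofElem _ 𝒞 c.2
  map_add' c c' := SheafHom.ext_val fun W a => by
    refine Eq.trans ?_ (add_mul _ _ _)
    refine congrArg (· * a.1) (funext fun y => ?_)
    exact (toStalk y.1).map_add c.1 c'.1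
  map_smul' r c := SheafHom.ext_val fun W a => by
    refine Eq.trans ?_ (smul_mul_assoc r _ a.1)
    refine congrArg (· * a.1) (funext fun y => ?_)
    refine Eq.trans ?_ (Stalk.smul_eq _ _ _).symm
    refine Eq.trans ?_ ((toStalk y.1).map_smul (algebraMap R (SymmetricAlgebra R L) r) c.1)
    rw [algebraMap_smul]
    rfl

include hB hL hn hdeg in
/-- A morphism `B_0 → B_i` is determined by its value at `1`, a global section of `B_i`, which comes
from a unique element of weight `i`. -/
theorem ofElemHom_bijective (i : ℕ) : Function.Bijective (ofElemHom L 𝒞 i) := by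
  constructor
  · rw [injective_iff_map_eq_zero]
    intro c hc
    refine Subtype.ext (eq_zero_of_toStalk B hB hL hn c.2 fun y => ?_)
    have h1 : ((ofElemHom L 𝒞 i c).app ⊤ (Sec.one _ 𝒞 ⊤)).1 = 0 := by
      rw [hc]
      rfl
    have h2 := congrFun h1 ⟨y, Opens.mem_top y⟩
    exact (mul_one (toStalk y c.1)).symm.trans h2
  · intro φ
    obtain ⟨c, hc, h⟩ := exists_eq_toStalk B hB hL hn hdeg (φ.app ⊤ (Sec.one _ 𝒞 ⊤))
    refine ⟨⟨c, hc⟩, SheafHom.ext_val fun W a => ?_⟩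
    refine Eq.trans ?_ (SheafHom.app_eq φ W a).symm
    have h2 := congrArg Subtype.val (φ.map_res ⊤ W le_top (Sec.one _ 𝒞 ⊤))
    exact (congrArg (· * a.1) (h2.trans (funext fun y => h y.1))).symm

end HalfGraded

/-! ### The coordinate algebra is the Clifford algebra -/

namespace DirectSum

variable {R : Type*} {A B : ℕ → Type*} [CommSemiring R] [∀ i, AddCommMonoid (A i)]
  [∀ i, Module R (A i)] [DirectSum.GSemiring A] [DirectSum.GAlgebra R A]
  [∀ i, AddCommMonoid (B i)] [∀ i, Module R (B i)] [DirectSum.GSemiring B]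
  [DirectSum.GAlgebra R B] (f : ∀ i, A i →ₗ[R] B i)
  (hone : f 0 GradedMonoid.GOne.one = GradedMonoid.GOne.one)
  (hmul : ∀ {i j : ℕ} (a : A i) (b : A j), f (i + j) (GradedMonoid.GMul.mul a b) =
    GradedMonoid.GMul.mul (f i a) (f j b))

/-- A family of linear maps compatible with the multiplication of graded algebras, as a homomorphism
of algebras. -/
noncomputable def gradedAlgHom : (⨁ i, A i) →ₐ[R] ⨁ i, B i :=
  DirectSum.toAlgebra R A (fun i => DirectSum.lof R ℕ B i ∘ₗ f i)
    (congrArg (DirectSum.of B 0) hone)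
    fun a b => (congrArg (DirectSum.of B _) (hmul a b)).trans (DirectSum.of_mul_of _ _).symm

theorem gradedAlgHom_of (i : ℕ) (x : A i) :
    gradedAlgHom f hone hmul (DirectSum.of A i x) = DirectSum.of B i (f i x) :=
  DirectSum.toAddMonoid_of (fun i => (DirectSum.lof R ℕ B i ∘ₗ f i).toAddMonoidHom) i x

theorem gradedAlgHom_bijective (h : ∀ i, Function.Bijective (f i)) :
    Function.Bijective (gradedAlgHom f hone hmul) := by
  have h1 : ∀ x, gradedAlgHom f hone hmul x = DirectSum.lmap f x := fun x => by
    induction x using DirectSum.induction_on with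
    | zero => rw [map_zero, map_zero]
    | of i x =>
      exact (gradedAlgHom_of f hone hmul i x).trans (DirectSum.lmap_lof f i x).symm
    | add x y hx hy => rw [map_add, map_add, hx, hy]
  rw [show ⇑(gradedAlgHom f hone hmul) = DirectSum.lmap f from funext h1]
  exact ⟨(DirectSum.lmap_injective _).2 fun i => (h i).1,
    (DirectSum.lmap_surjective _).2 fun i => (h i).2⟩

/-- An isomorphism of graded algebras given by its components. -/
noncomputable def gradedAlgEquiv (h : ∀ i, Function.Bijective (f i)) :
    (⨁ i, A i) ≃ₐ[R] ⨁ i, B i :=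
  AlgEquiv.ofBijective (gradedAlgHom f hone hmul) (gradedAlgHom_bijective f hone hmul h)

theorem gradedAlgEquiv_decompose {C : Type*} [Semiring C] [Algebra R C] (𝒞 : ℕ → Submodule R C)
    [GradedAlgebra 𝒞] (f : ∀ i, 𝒞 i →ₗ[R] B i)
    (hone : f 0 (GradedMonoid.GOne.one (A := fun i => 𝒞 i)) = GradedMonoid.GOne.one)
    (hmul : ∀ {i j : ℕ} (a : 𝒞 i) (b : 𝒞 j),
      f (i + j) (GradedMonoid.GMul.mul (A := fun i => 𝒞 i) a b) =
        GradedMonoid.GMul.mul (f i a) (f j b)) (h : ∀ i, Function.Bijective (f i))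
    {i : ℕ} (c : 𝒞 i) :
    (decomposeAlgEquiv 𝒞).trans (gradedAlgEquiv f hone hmul h) c = DirectSum.lof R ℕ B i (f i c) :=
  (congrArg (gradedAlgHom f hone hmul) (decompose_coe 𝒞 c)).trans (gradedAlgHom_of f hone hmul i c)

end DirectSum

namespace HalfGraded

variable {R L C : Type*} [CommRing R] [AddCommGroup L] [Module R L] [Ring C] [Algebra R C]
  [Algebra (SymmetricAlgebra R L) C] [IsScalarTower R (SymmetricAlgebra R L) C]
  (𝒞 : ℕ → Submodule R C) [GradedAlgebra 𝒞] [HalfGraded (SymGrading.part R L) 𝒞]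

theorem ofElemHom_one : ofElemHom L 𝒞 0 (GradedMonoid.GOne.one (A := fun i => 𝒞 i)) =
    GradedMonoid.GOne.one (A := fun i => SheafHom (SymGrading.part R L) 𝒞 i) := by
  refine SheafHom.ext_val fun W a => ?_
  funext y
  have h : (Stalk.mk (SymGrading.part R L) (1 : C) 1 : Stalk (SymGrading.part R L) C y.1) = 1 :=
    OreLocalization.one_def.symm
  exact (congrArg (· * a.1 y) h).trans (one_mul _)

theorem ofElemHom_mul {i j : ℕ} (a : 𝒞 i) (b : 𝒞 j) :
    ofElemHom L 𝒞 (i + j) (GradedMonoid.GMul.mul (A := fun i => 𝒞 i) a b) =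
      GradedMonoid.GMul.mul (A := fun i => SheafHom (SymGrading.part R L) 𝒞 i)
        (ofElemHom L 𝒞 i a) (ofElemHom L 𝒞 j b) := by
  refine SheafHom.ext_val fun W x => ?_
  rw [SheafHom.mul_val]
  funext y
  have h : (Stalk.mk (SymGrading.part R L) (a.1 * b.1) 1 : Stalk (SymGrading.part R L) C y.1) =
      Stalk.mk (SymGrading.part R L) a.1 1 * Stalk.mk (SymGrading.part R L) b.1 1 := by
    refine Eq.trans ?_ LocalizedModule.mk_mul_mk.symm
    rw [one_mul]
    rfl
  refine (congrArg (· * x.1 y) h).trans ?_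
  refine (mul_assoc _ _ _).trans ?_
  exact congrArg (· * (Stalk.mk (SymGrading.part R L) b.1 1 * x.1 y))
    (mul_one (Stalk.mk (SymGrading.part R L) a.1 1)).symm

end HalfGraded

namespace CliffordSpace

open Quadrics

variable {k V R : Type*} [Field k] [CharZero k] [AddCommGroup V] [Module k V] [CommRing R]
  [Algebra k R] {U : Submodule R (QuadForms k V R)} [FiniteDimensional k V] {n : ℕ}

theorem ofElemHom_bijective (hn : 0 < n) (hV : Module.finrank k V = n)
    (hU : IsGrassmannianPoint n U) (i : ℕ) :
    Function.Bijective (HalfGraded.ofElemHom (Module.Dual R U) (weight U) i) := by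
  have := hU.projective
  have := hU.finite
  have hL : Module.IsLocallyFreeOfRank R (Module.Dual R U) n :=
    Module.IsLocallyFreeOfRank.dual fun p =>
      Module.exists_comp_eq_smul_of_rankAtStalk p (hU.rank_eq p)
  refine HalfGraded.ofElemHom_bijective (basis U (Module.finBasis k V)) (basis_mem U _)
    (n := n) hL hn ?_ i
  -- For `n = 1` the exterior powers of `V` vanish above degree one.
  · by_cases h : 1 < n
    · exact Or.inl h
    · refine Or.inr fun I => ?_
      have h1 := Finset.card_le_univ I
      rw [Fintype.card_fin] at h1
      omega

variable (U) in
/-- The identity between a component of the coordinate algebra and the module of morphisms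
`B_0 → B_i` by which it is defined. -/
noncomputable def sheafHomEquiv (i : ℕ) :
    HalfGraded.SheafHom (coordGrading U) (weight U) i ≃ₗ[R] Component U i where
  toFun x := x
  invFun x := x
  left_inv _ := rfl
  right_inv _ := rfl
  map_add' _ _ := rfl
  map_smul' _ _ := rfl

variable (U) in
/-- An element of weight `i` of the Clifford algebra, as a component of the coordinate algebra. -/
noncomputable def ofWeight (i : ℕ) : weight U i →ₗ[R] Component U i :=
  (sheafHomEquiv U i).toLinearMap ∘ₗ HalfGraded.ofElemHom (Module.Dual R U) (weight U) i

theorem ofWeight_one : ofWeight U 0 (GradedMonoid.GOne.one (A := fun i => weight U i)) =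
    GradedMonoid.GOne.one (A := Component U) :=
  HalfGraded.ofElemHom_one (L := Module.Dual R U) (weight U)

theorem ofWeight_mul {i j : ℕ} (a : weight U i) (b : weight U j) :
    ofWeight U (i + j) (GradedMonoid.GMul.mul (A := fun i => weight U i) a b) =
      GradedMonoid.GMul.mul (A := Component U) (ofWeight U i a) (ofWeight U j b) :=
  HalfGraded.ofElemHom_mul (L := Module.Dual R U) (weight U) a b

theorem ofWeight_bijective (hn : 0 < n) (hV : Module.finrank k V = n)
    (hU : IsGrassmannianPoint n U) (i : ℕ) : Function.Bijective (ofWeight U i) :=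
  (sheafHomEquiv U i).bijective.comp (ofElemHom_bijective hn hV hU i)

/-- The components of the coordinate algebra are the parts of the Clifford algebra. -/
noncomputable def componentEquiv (hn : 0 < n) (hV : Module.finrank k V = n)
    (hU : IsGrassmannianPoint n U) (i : ℕ) : weight U i ≃ₗ[R] Component U i :=
  LinearEquiv.ofBijective (ofWeight U i) (ofWeight_bijective hn hV hU i)

variable (U) in
/-- The identity between the coordinate algebra and the direct sum by which it is defined. -/
noncomputable def directSumEquiv : (⨁ i, Component U i) ≃ₐ[R] CoordAlgebra U := by
  unfold CoordAlgebra
  exact AlgEquiv.refl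

/-- The Clifford algebra is isomorphic to the coordinate algebra of the Clifford space, with the part
of weight `i` as the component of degree `i`. -/
noncomputable def coordAlgebraEquiv (hn : 0 < n) (hV : Module.finrank k V = n)
    (hU : IsGrassmannianPoint n U) : Cliff U ≃ₐ[R] CoordAlgebra U :=
  ((decomposeAlgEquiv (weight U)).trans (DirectSum.gradedAlgEquiv (ofWeight U) ofWeight_one
    ofWeight_mul (ofWeight_bijective hn hV hU))).trans (directSumEquiv U)

theorem coordAlgebraEquiv_apply (hn : 0 < n) (hV : Module.finrank k V = n)
    (hU : IsGrassmannianPoint n U) {i : ℕ} (c : weight U i) :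
    coordAlgebraEquiv hn hV hU c = incl U i (componentEquiv hn hV hU i c) :=
  congrArg (directSumEquiv U) (DirectSum.gradedAlgEquiv_decompose (weight U) (ofWeight U)
    ofWeight_one ofWeight_mul (ofWeight_bijective hn hV hU) c)

theorem coordAlgebraEquiv_gen (hn : 0 < n) (hV : Module.finrank k V = n)
    (hU : IsGrassmannianPoint n U) (v : V) :
    coordAlgebraEquiv hn hV hU (gen U v) = vector U v :=
  coordAlgebraEquiv_apply hn hV hU ⟨gen U v, gen_mem U v⟩

end CliffordSpace

/-! ### Base change -/

/-- For a finite projective module the dual of a base change is the base change of the dual. The map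
is given by a dual basis: `g` goes to the sum of the `g(x_i) ⊗ y_i`. -/
theorem IsBaseChange.exists_toDual_inverse {R M A N : Type*} [CommRing R] [AddCommGroup M]
    [Module R M] [CommRing A] [Algebra R A] [AddCommGroup N] [Module R N] [Module A N]
    [IsScalarTower R A N] [Module.Finite R M] [Module.Projective R M] {j : M →ₗ[R] N}
    (h : IsBaseChange A j) :
    ∃ e : Module.Dual A N →ₗ[A] A ⊗[R] Module.Dual R M, ∀ f, e (h.toDual f) = 1 ⊗ₜ f := by
  obtain ⟨m, p, s, -, -, hps⟩ := Module.Finite.exists_comp_eq_id_of_projective R M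
  let x : Fin m → M := fun i => p (Pi.single i 1)
  let y : Fin m → Module.Dual R M := fun i => LinearMap.proj i ∘ₗ s
  refine ⟨∑ i, (LinearMap.toSpanSingleton A _ ((1 : A) ⊗ₜ[R] y i)) ∘ₗ
    LinearMap.applyₗ (R := A) (M₂ := A) (j (x i)), fun f => ?_⟩
  have h1 : f = ∑ i, f (x i) • y i := LinearMap.ext fun z => by
    have h2 : z = ∑ i, s z i • x i := by
      conv_lhs => rw [← LinearMap.id_apply (R := R) z, ← hps, LinearMap.comp_apply,
        pi_eq_sum_univ' (s z)]
      rw [map_sum]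
      refine Finset.sum_congr rfl fun i _ => ?_
      rw [map_smul]
    conv_lhs => rw [h2, map_sum]
    rw [LinearMap.sum_apply]
    refine Finset.sum_congr rfl fun i _ => ?_
    rw [map_smul, LinearMap.smul_apply, smul_eq_mul, smul_eq_mul, mul_comm]
    rfl
  conv_rhs => rw [h1, tmul_sum]
  rw [LinearMap.sum_apply]
  refine Finset.sum_congr rfl fun i _ => ?_
  rw [LinearMap.comp_apply, LinearMap.applyₗ_apply_apply, h.toDual_comp_apply,
    LinearMap.toSpanSingleton_apply, tmul_smul, algebraMap_smul]

theorem LinearMap.baseChange_commute {R M C : Type*} (R' : Type*) [CommRing R] [AddCommGroup M]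
    [Module R M] [Ring C] [Algebra R C] [CommRing R'] [Algebra R R'] {f : M →ₗ[R] C}
    (h : ∀ m c, f m * c = c * f m) (x : R' ⊗[R] M) (a : R' ⊗[R] C) :
    f.baseChange R' x * a = a * f.baseChange R' x := by
  induction x with
  | zero => rw [map_zero, zero_mul, mul_zero]
  | add x y hx hy => rw [map_add, add_mul, mul_add, hx, hy]
  | tmul r l =>
    induction a with
    | zero => rw [zero_mul, mul_zero]
    | add x y hx hy => rw [add_mul, mul_add, hx, hy]
    | tmul r' c =>
      rw [LinearMap.baseChange_tmul, Algebra.TensorProduct.tmul_mul_tmul,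
        Algebra.TensorProduct.tmul_mul_tmul, mul_comm r, h]

/-- The map `v ↦ 1 ⊗ β v` deduced from a map `β` that is semilinear along `k → R`. -/
noncomputable def LinearMap.tmulOne {k V R C : Type*} (R' : Type*) [CommRing k] [AddCommGroup V]
    [Module k V] [CommRing R] [Algebra k R] [Ring C] [Algebra R C] [CommRing R'] [Algebra k R']
    [Algebra R R'] [IsScalarTower k R R'] (β : V →ₛₗ[algebraMap k R] C) :
    V →ₛₗ[algebraMap k R'] R' ⊗[R] C where
  toFun v := 1 ⊗ₜ β v
  map_add' v w := by rw [map_add, tmul_add]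
  map_smul' a v := by
    rw [map_smulₛₗ, tmul_smul, ← algebraMap_smul R' (algebraMap k R a),
      ← IsScalarTower.algebraMap_apply]

theorem LinearMap.tmulOne_mul_self {k V R C M : Type*} (R' : Type*) [CommRing k] [AddCommGroup V]
    [Module k V] [CommRing R] [Algebra k R] [Ring C] [Algebra R C] [CommRing R'] [Algebra k R']
    [Algebra R R'] [IsScalarTower k R R'] [AddCommGroup M] [Module R M] {f : M →ₗ[R] C} {m : M}
    {β : V →ₛₗ[algebraMap k R] C} {v : V} (h : β v * β v = f m) :
    β.tmulOne R' v * β.tmulOne R' v = f.baseChange R' (1 ⊗ₜ m) := by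
  rw [LinearMap.baseChange_tmul, ← h]
  exact (Algebra.TensorProduct.tmul_mul_tmul _ _ _ _).trans (by rw [one_mul])

/-- A ring homomorphism from a symmetric algebra that sends generators to degree `m` multiplies degrees
by `m`. -/
theorem SymGrading.map_mem {R L A R' : Type*} [CommRing R] [AddCommGroup L] [Module R L]
    [CommRing R'] [Ring A] [Algebra R' A] (𝒟 : ℕ → Submodule R' A) [SetLike.GradedMonoid 𝒟]
    (γ : SymmetricAlgebra R L →+* A) (hr : ∀ r, γ (algebraMap R _ r) ∈ 𝒟 0) {m : ℕ}
    (hι : ∀ l, γ (SymmetricAlgebra.ι R L l) ∈ 𝒟 m) {s : ℕ} {f : SymmetricAlgebra R L}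
    (hf : f ∈ part R L s) : γ f ∈ 𝒟 (m * s) := by
  change f ∈ LinearMap.range (SymmetricAlgebra.ι R L) ^ s at hf
  induction hf using Submodule.pow_induction_on_left' with
  | algebraMap r => exact hr r
  | add x y i hx hy ihx ihy =>
    rw [map_add]
    exact Submodule.add_mem _ ihx ihy
  | mem_mul m hm i x hx ih =>
    obtain ⟨l, rfl⟩ := hm
    rw [map_mul, Nat.succ_eq_add_one, mul_add, mul_one, add_comm]
    exact SetLike.GradedMul.mul_mem (hι l) ih

theorem SetLike.map_list_prod_mem {S A B V : Type*} [Monoid A] [Monoid B] [SetLike S B]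
    (𝒟 : ℕ → S) [SetLike.GradedMonoid 𝒟] (ψ : A →* B) (g : V → A) (h : ∀ v, ψ (g v) ∈ 𝒟 1)
    (l : List V) : ψ (l.map g).prod ∈ 𝒟 l.length := by
  induction l with
  | nil =>
    rw [List.map_nil, List.prod_nil, map_one]
    exact SetLike.GradedOne.one_mem
  | cons v l ih =>
    rw [List.map_cons, List.prod_cons, map_mul, List.length_cons, add_comm]
    exact SetLike.GradedMul.mul_mem (h v) ih

namespace CliffordSpace

open Quadrics

variable {k V R : Type*} [Field k] [CharZero k] [AddCommGroup V] [Module k V] [CommRing R]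
  [Algebra k R] {U : Submodule R (QuadForms k V R)} [FiniteDimensional k V]
  (R' : Type*) [CommRing R'] [Algebra k R'] [Algebra R R'] [IsScalarTower k R R']

/-- The evaluation at `v` is compatible with base change. -/
theorem toDual_tautological [Module.Projective R (QuadForms k V R ⧸ U)] (v : V) :
    (isBaseChange_pullbackMap R' (U := U)).toDual (tautological U v) =
      tautological (pullback (IsScalarTower.toAlgHom k R R') U) v := by
  refine (isBaseChange_pullbackMap R' (U := U)).algHom_ext _ _ fun u => ?_
  rw [IsBaseChange.toDual_comp_apply]
  rfl

variable {R'} in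
/-- The universal property of the base change of the Clifford algebra. -/
theorem exists_algHom_baseChange {A : Type*} [Ring A] [Algebra R' A]
    (α : Module.Dual R U →ₗ[R] Module.Dual R' (pullback (IsScalarTower.toAlgHom k R R') U))
    (hα : ∀ v, α (tautological U v) = tautological _ v)
    (α' : Module.Dual R' (pullback (IsScalarTower.toAlgHom k R R') U) →ₗ[R'] A)
    (hα' : ∀ l a, α' l * a = a * α' l) (β : V →ₛₗ[algebraMap k R'] A)
    (hβ : ∀ v, β v * β v = α' (tautological _ v)) :
    ∃ φ : R' ⊗[R] Cliff U →ₐ[R'] A, ∀ v, φ (1 ⊗ₜ gen U v) = β v := by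
  let : Algebra R A := Algebra.compHom A (algebraMap R R')
  have : IsScalarTower R R' A := IsScalarTower.of_algebraMap_eq fun r => rfl
  obtain ⟨ψ, -, hψ⟩ := exists_algHom U (A := A) (α'.restrictScalars R ∘ₗ α) (fun l a => hα' _ a)
    { toFun := β
      map_add' := β.map_add
      map_smul' := fun a v => by
        rw [β.map_smulₛₗ, IsScalarTower.algebraMap_apply k R R', algebraMap_smul] }
    (fun v => (hβ v).trans (congrArg α' (hα v).symm))
  refine ⟨Algebra.TensorProduct.lift (Algebra.ofId R' A) ψ fun r c => Algebra.commutes r (ψ c),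
    fun v => (Algebra.TensorProduct.lift_tmul _ _ _ _ _).trans ?_⟩
  rw [map_one, one_mul]
  exact hψ v

variable {R'} in
theorem algHom_ext_tmul_gen [Module.Projective R (QuadForms k V R ⧸ U)] {A : Type*} [Ring A]
    [Algebra R' A] {φ ψ : R' ⊗[R] Cliff U →ₐ[R'] A}
    (h : ∀ v, φ (1 ⊗ₜ gen U v) = ψ (1 ⊗ₜ gen U v)) : φ = ψ := by
  let : Algebra R A := Algebra.compHom A (algebraMap R R')
  have : IsScalarTower R R' A := IsScalarTower.of_algebraMap_eq fun r => rfl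
  refine Algebra.TensorProduct.ext (Subsingleton.elim _ _) (algHom_ext_gen (U := U) fun v => ?_)
  exact h v

theorem mem_of_weight (S : AddSubmonoid (Cliff U)) {i : ℕ} {c : Cliff U} (hc : c ∈ weight U i)
    (h : ∀ (s : ℕ) (f : CoordRing U) (l : List V), f ∈ coordGrading U s →
      l.length + 2 * s = i → algebraMap (CoordRing U) (Cliff U) f * (l.map (gen U)).prod ∈ S) :
    c ∈ S :=
  weight_induction U (p := (· ∈ S)) hc S.zero_mem (fun _ _ => S.add_mem) h

variable (U) in
/-- The linear forms on `U` as central elements of the Clifford algebra. -/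
noncomputable def ofDual : Module.Dual R U →ₗ[R] Cliff U :=
  (IsScalarTower.toAlgHom R (CoordRing U) (Cliff U)).toLinearMap ∘ₗ SymmetricAlgebra.ι R _

variable (U) in
theorem ofDual_commute (l : Module.Dual R U) (a : Cliff U) : ofDual U l * a = a * ofDual U l :=
  Algebra.commutes (A := Cliff U) (SymmetricAlgebra.ι R _ l) a

section

variable {R'}

theorem ringHom_ofDual_mem [Module.Projective R (QuadForms k V R ⧸ U)] {A : Type*} [Ring A]
    [Algebra R' A] (𝒟 : ℕ → Submodule R' A) [SetLike.GradedMonoid 𝒟] (ψ : Cliff U →+* A)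
    (hr : ∀ r : R, ψ (algebraMap R (Cliff U) r) = algebraMap R' A (algebraMap R R' r))
    (h : ∀ v, ψ (gen U v) ∈ 𝒟 1) (l : Module.Dual R U) : ψ (ofDual U l) ∈ 𝒟 2 := by
  have hl : l ∈ Submodule.span R (Set.range (tautological U)) := by
    rw [span_tautological]
    trivial
  induction hl using Submodule.span_induction with
  | mem l hl =>
    obtain ⟨v, rfl⟩ := hl
    have h1 := SetLike.GradedMul.mul_mem (h v) (h v)
    rw [← ψ.map_mul, gen_mul_gen] at h1
    exact h1
  | zero =>
    rw [map_zero, ψ.map_zero]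
    exact Submodule.zero_mem _
  | add x y _ _ hx hy =>
    rw [map_add, ψ.map_add]
    exact Submodule.add_mem _ hx hy
  | smul r x _ hx =>
    rw [map_smul, Algebra.smul_def, ψ.map_mul, hr, ← Algebra.smul_def]
    exact Submodule.smul_mem _ _ hx

/-- A ring homomorphism from the Clifford algebra that sends vectors to elements of degree one is
graded: the linear forms on `U` go to degree two, since they are combinations of squares of
vectors. -/
theorem ringHom_mem [Module.Projective R (QuadForms k V R ⧸ U)] {A : Type*} [Ring A]
    [Algebra R' A] (𝒟 : ℕ → Submodule R' A) [SetLike.GradedMonoid 𝒟] (ψ : Cliff U →+* A)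
    (hr : ∀ r : R, ψ (algebraMap R (Cliff U) r) = algebraMap R' A (algebraMap R R' r))
    (h : ∀ v, ψ (gen U v) ∈ 𝒟 1) {i : ℕ} {c : Cliff U} (hc : c ∈ weight U i) : ψ c ∈ 𝒟 i := by
  refine mem_of_weight ((𝒟 i).toAddSubmonoid.comap ψ.toAddMonoidHom) hc fun s f l hf hi => ?_
  have hS : ψ (algebraMap (CoordRing U) (Cliff U) f) ∈ 𝒟 (2 * s) :=
    SymGrading.map_mem 𝒟 (ψ.comp (algebraMap (CoordRing U) (Cliff U))) (fun r => by
      rw [RingHom.comp_apply, ← IsScalarTower.algebraMap_apply R (CoordRing U), hr,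
        Algebra.algebraMap_eq_smul_one]
      exact Submodule.smul_mem _ _ SetLike.GradedOne.one_mem) (ringHom_ofDual_mem 𝒟 ψ hr h) hf
  have h1 := SetLike.GradedMul.mul_mem hS
    (SetLike.map_list_prod_mem 𝒟 ψ.toMonoidHom (gen U) h l)
  rw [add_comm, hi] at h1
  exact (congrArg (· ∈ 𝒟 i) (ψ.map_mul _ _)).mpr h1

/-- A homomorphism from a base change of the Clifford algebra that sends vectors to elements of degree
one is graded. -/
theorem map_tmul_mem [Module.Projective R (QuadForms k V R ⧸ U)] {A : Type*} [Ring A]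
    [Algebra R' A] (𝒟 : ℕ → Submodule R' A) [SetLike.GradedMonoid 𝒟]
    (φ : R' ⊗[R] Cliff U →ₐ[R'] A) (h : ∀ v, φ (1 ⊗ₜ gen U v) ∈ 𝒟 1) {i : ℕ} {c : Cliff U}
    (hc : c ∈ weight U i) : φ (1 ⊗ₜ c) ∈ 𝒟 i := by
  refine ringHom_mem 𝒟 (φ.toRingHom.comp
    (Algebra.TensorProduct.includeRight (R := R) (A := R') (B := Cliff U)).toRingHom)
    (fun r => ?_) h hc
  change φ (1 ⊗ₜ _) = _
  rw [← Algebra.TensorProduct.algebraMap_apply', ← φ.commutes, IsScalarTower.algebraMap_apply R R']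

end

/-- The Clifford algebra commutes with base change. Both sides have the same universal property, and
the two homomorphisms are inverse to each other because they are on the generators `v ∈ V`. -/
theorem exists_baseChangeEquiv {n : ℕ} (hU : IsGrassmannianPoint n U) :
    ∃ φ : R' ⊗[R] Cliff U ≃ₐ[R'] Cliff (pullback (IsScalarTower.toAlgHom k R R') U),
      ∀ v, φ (1 ⊗ₜ gen U v) = gen _ v := by
  have := hU.projective_quotient
  have := hU.projective
  have := hU.finite
  have := (hU.pullback_toAlgHom R').projective_quotient
  obtain ⟨e, he⟩ := IsBaseChange.exists_toDual_inverse (M := U)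
    (N := pullback (IsScalarTower.toAlgHom k R R') U) (isBaseChange_pullbackMap R' (U := U))
  obtain ⟨φ, hφ⟩ := exists_algHom_baseChange (R' := R')
    (isBaseChange_pullbackMap R' (U := U)).toDual (toDual_tautological R')
    (ofDual _) (ofDual_commute _) (genMap _) (gen_mul_gen _)
  obtain ⟨ψ, -, hψ⟩ := exists_algHom (pullback (IsScalarTower.toAlgHom k R R') U)
    (A := R' ⊗[R] Cliff U) ((ofDual U).baseChange R' ∘ₗ e)
    (fun l a => LinearMap.baseChange_commute R' (ofDual_commute U) _ a)
    ((genMap U).tmulOne R')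
    (fun v => (LinearMap.tmulOne_mul_self R' (β := genMap U) (gen_mul_gen U v)).trans
      (congrArg ((ofDual U).baseChange R') ((congrArg e (toDual_tautological R' v).symm).trans
        (he _)).symm))
  refine ⟨AlgEquiv.ofAlgHom φ ψ (algHom_ext_gen _ fun v => ?_) (algHom_ext_tmul_gen fun v => ?_),
    hφ⟩
  · exact (congrArg φ (hψ v)).trans (hφ v)
  · exact (congrArg ψ (hφ v)).trans (hψ v)

end CliffordSpace

/-! ### Ranks -/

/-- A function with values in `ℕ` is given by its quotient by `2` and by the set where it is odd. -/
noncomputable def Nat.funDivModTwo (n : ℕ) : (Fin n →₀ ℕ) × Finset (Fin n) ≃ (Fin n → ℕ) where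
  toFun x j := 2 * x.1 j + if j ∈ x.2 then 1 else 0
  invFun a :=
    (Finsupp.equivFunOnFinite.symm fun j => a j / 2, Finset.univ.filter fun j => a j % 2 = 1)
  left_inv x := by
    refine Prod.ext (Finsupp.ext fun j => ?_) (Finset.ext fun j => ?_)
    · simp only [Finsupp.equivFunOnFinite_symm_apply_apply]
      split_ifs <;> omega
    · simp only [Finset.mem_filter, Finset.mem_univ, true_and]
      split_ifs with h <;> simp [h]
  right_inv a := by
    funext j
    simp only [Finsupp.equivFunOnFinite_symm_apply_apply, Finset.mem_filter, Finset.mem_univ,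
      true_and]
    split_ifs <;> omega

/-- The pairs of a monomial `m` and a set `I` with `|I| + 2 |m| = i` correspond to the monomials
`2m + 1_I` of degree `i`. -/
theorem Nat.card_degree_two_mul_add_card (n i : ℕ) :
    Nat.card {x : (Fin n →₀ ℕ) × Finset (Fin n) // x.2.card + 2 * x.1.degree = i} =
      (n + i - 1).choose i := by
  have e : {x : (Fin n →₀ ℕ) × Finset (Fin n) // x.2.card + 2 * x.1.degree = i} ≃
      {a : Fin n → ℕ // ∑ j, a j = i} := by
    refine (Nat.funDivModTwo n).subtypeEquiv fun x => ?_
    rw [show ∑ j, Nat.funDivModTwo n x j = x.2.card + 2 * x.1.degree by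
      simp only [Nat.funDivModTwo, Equiv.coe_fn_mk, Finset.sum_add_distrib, ← Finset.mul_sum,
        Finsupp.degree_eq_sum, Finset.sum_ite_mem, Finset.univ_inter, Finset.sum_const, smul_eq_mul,
        mul_one]
      rw [add_comm]]
  rw [Nat.card_congr (e.trans (Sym.equivNatSumOfFintype (Fin n) i).symm), Nat.card_eq_fintype_card,
    Sym.card_sym_eq_choose, Fintype.card_fin]

theorem Module.finrank_eq_of_rankAtStalk_eq {K M : Type*} [Field K] [AddCommGroup M] [Module K M]
    {n : ℕ} (h : ∀ p : PrimeSpectrum K, Module.rankAtStalk M p = n) : Module.finrank K M = n := by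
  have h1 := h default
  rwa [Module.rankAtStalk_eq_finrank_of_free] at h1

/-- The homogeneous elements of a basis are bases of the parts of a graded module. -/
theorem DirectSum.finrank_of_basis {R C J : Type*} [CommRing R] [Nontrivial R] [AddCommGroup C]
    [Module R C] (𝒞 : ℕ → Submodule R C) [DirectSum.Decomposition 𝒞] (B : Module.Basis J R C)
    (d : J → ℕ) (hB : ∀ j, B j ∈ 𝒞 (d j)) (i : ℕ) :
    Module.finrank R (𝒞 i) = Nat.card {j // d j = i} := by
  classical
  have hspan : 𝒞 i = Submodule.span R (Set.range fun j : {j // d j = i} => B j) := by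
    refine le_antisymm (fun c hc => ?_) (Submodule.span_le.2 ?_)
    · have h1 : c = (decompose 𝒞 (∑ j ∈ (B.repr c).support, B.repr c j • B j) i : C) := by
        have := B.linearCombination_repr c
        rw [Finsupp.linearCombination_apply, Finsupp.sum] at this
        rw [this, decompose_of_mem_same 𝒞 hc]
      rw [h1, decompose_sum, DFinsupp.finsetSum_apply, AddSubmonoidClass.coe_finsetSum]
      refine Submodule.sum_mem _ fun j _ => ?_
      by_cases hj : d j = i
      · rw [decompose_of_mem_same 𝒞 (hj ▸ Submodule.smul_mem _ _ (hB j))]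
        exact Submodule.smul_mem _ _ (Submodule.subset_span ⟨⟨j, hj⟩, rfl⟩)
      · rw [decompose_of_mem_ne 𝒞 (Submodule.smul_mem _ _ (hB j)) hj]
        exact Submodule.zero_mem _
    · rintro _ ⟨⟨j, rfl⟩, rfl⟩
      exact hB j
  have hli : LinearIndependent R fun j : {j // d j = i} => B j :=
    B.linearIndependent.comp _ Subtype.val_injective
  rw [hspan, Module.finrank_eq_nat_card_basis (Module.Basis.span hli)]

theorem SymGrading.basis_mem_part {R L κ : Type*} [CommRing R] [AddCommGroup L] [Module R L]
    (b : Module.Basis κ R L) (m : κ →₀ ℕ) : b.symmetricAlgebra m ∈ part R L m.degree := by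
  change (SymmetricAlgebra.equivMvPolynomial b).symm (MvPolynomial.monomial m 1) ∈ _
  induction m using Finsupp.induction_linear with
  | zero =>
    rw [MvPolynomial.monomial_zero', map_one, map_one]
    exact SetLike.GradedOne.one_mem
  | add m m' h h' =>
    rw [← mul_one (1 : R), ← MvPolynomial.monomial_mul, map_mul, map_add]
    exact SetLike.GradedMul.mul_mem h h'
  | single j e =>
    rw [← MvPolynomial.X_pow_eq_monomial, map_pow, SymmetricAlgebra.equivMvPolynomial_symm_X,
      Finsupp.degree_single]
    exact Submodule.pow_mem_pow _ (LinearMap.mem_range_self _ _) e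

section BaseChange

variable {R C R' D : Type*} [CommRing R] [CommRing R'] [Algebra R R'] [AddCommGroup C] [Module R C]
  [AddCommGroup D] [Module R' D] (𝒞 : ℕ → Submodule R C) [DirectSum.Decomposition 𝒞]
  (𝒟 : ℕ → Submodule R' D) [DirectSum.Decomposition 𝒟]

/-- A graded isomorphism with a base change is in each degree an isomorphism with the base
change. -/
theorem DirectSum.nonempty_baseChange_equiv (φ : R' ⊗[R] C ≃ₗ[R'] D)
    (h : ∀ (i : ℕ) (c : C), c ∈ 𝒞 i → φ (1 ⊗ₜ c) ∈ 𝒟 i) (i : ℕ) :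
    Nonempty (R' ⊗[R] 𝒞 i ≃ₗ[R'] 𝒟 i) := by
  let p : C →ₗ[R] 𝒞 i := DirectSum.component R ℕ (fun i => 𝒞 i) i ∘ₗ
    (decomposeLinearEquiv 𝒞).toLinearMap
  have hp : p ∘ₗ (𝒞 i).subtype = LinearMap.id := LinearMap.ext fun c => by
    change decompose 𝒞 (c : C) i = c
    rw [decompose_coe, DirectSum.of_eq_same]
  let f : R' ⊗[R] 𝒞 i →ₗ[R'] D := φ.toLinearMap ∘ₗ (𝒞 i).subtype.baseChange R'
  have hf : ∀ x, f x ∈ 𝒟 i := fun x => by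
    induction x with
    | zero => rw [map_zero]; exact Submodule.zero_mem _
    | add x y hx hy => rw [map_add]; exact Submodule.add_mem _ hx hy
    | tmul r c =>
      have h1 : r ⊗ₜ[R] c = r • (1 ⊗ₜ c) := by rw [smul_tmul', smul_eq_mul, mul_one]
      rw [h1, map_smul]
      exact Submodule.smul_mem _ _ (h i c c.2)
  refine ⟨LinearEquiv.ofBijective (f.codRestrict (𝒟 i) hf) ⟨?_, ?_⟩⟩
  · refine (LinearMap.injective_codRestrict_iff hf).2 (φ.injective.comp
      (Function.LeftInverse.injective (g := p.baseChange R') fun x => ?_))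
    rw [← LinearMap.comp_apply, ← LinearMap.baseChange_comp, hp, LinearMap.baseChange_id,
      LinearMap.id_apply]
  · have hd : ∀ y, (decompose 𝒟 (φ y) i : D) = f (p.baseChange R' y) := fun y => by
      induction y with
      | zero => simp
      | add x y hx hy =>
        rw [map_add, decompose_add, DirectSum.add_apply, Submodule.coe_add, hx, hy, map_add,
          map_add]
      | tmul r c =>
        have h1 : (decompose 𝒟 (φ (1 ⊗ₜ[R] c)) i : D) = f (p.baseChange R' (1 ⊗ₜ c)) := by
          induction c using DirectSum.Decomposition.inductionOn 𝒞 with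
          | zero => simp
          | add x y hx hy =>
            rw [tmul_add, map_add, decompose_add, DirectSum.add_apply, Submodule.coe_add, hx, hy,
              map_add, map_add]
          | homogeneous c =>
            rename_i j
            have hm := h j c c.2
            by_cases hj : j = i
            · subst hj
              rw [decompose_of_mem_same 𝒟 hm, LinearMap.baseChange_tmul,
                show p (c : C) = c from LinearMap.congr_fun hp c]
              rfl
            · rw [decompose_of_mem_ne 𝒟 hm hj, LinearMap.baseChange_tmul,
                show p (c : C) = 0 from Subtype.ext (decompose_of_mem_ne 𝒞 c.2 hj), tmul_zero,
                map_zero]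
        rw [show r ⊗ₜ[R] c = r • (1 ⊗ₜ c) by rw [smul_tmul', smul_eq_mul, mul_one], map_smul,
          decompose_smul, DirectSum.smul_apply, Submodule.coe_smul, map_smul, map_smul, h1]
    intro x
    refine ⟨p.baseChange R' (φ.symm x), Subtype.ext ?_⟩
    rw [LinearMap.codRestrict_apply, ← hd, LinearEquiv.apply_symm_apply,
      decompose_of_mem_same 𝒟 x.2]

end BaseChange

theorem DirectSum.nonempty_baseChange_algEquiv {R C R' D : Type*} [CommRing R] [CommRing R']
    [Algebra R R'] [Ring C] [Algebra R C] [Ring D] [Algebra R' D] (𝒞 : ℕ → Submodule R C)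
    [GradedAlgebra 𝒞] (𝒟 : ℕ → Submodule R' D) [GradedAlgebra 𝒟] (φ : R' ⊗[R] C ≃ₐ[R'] D)
    (h : ∀ (i : ℕ) (c : C), c ∈ 𝒞 i → φ (1 ⊗ₜ c) ∈ 𝒟 i) (i : ℕ) :
    Nonempty (R' ⊗[R] 𝒞 i ≃ₗ[R'] 𝒟 i) :=
  DirectSum.nonempty_baseChange_equiv 𝒞 𝒟 φ.toLinearEquiv h i

namespace CliffordSpace

open Quadrics

variable {k V : Type*} [Field k] [CharZero k] [AddCommGroup V] [Module k V]
  [FiniteDimensional k V] {n : ℕ}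

/-- The Hilbert function of the Clifford algebra of a linear system of quadrics over a field, counted
with the basis formed by the products of the monomials in `Sym(U^∨)` and the elements `b_I`. -/
theorem finrank_weight {K : Type*} [Field K] [Algebra k K] {U : Submodule K (QuadForms k V K)}
    (hV : Module.finrank k V = n) (hU : IsGrassmannianPoint n U) (i : ℕ) :
    Module.finrank K (weight U i) = (n + i - 1).choose i := by
  have := hU.finite
  have hU : Module.finrank K U = n := Module.finrank_eq_of_rankAtStalk_eq (M := U) hU.rank_eq
  let b := (Module.finBasisOfFinrankEq K (Module.Dual K U)
    ((Subspace.dual_finrank_eq (V := U)).trans hU)).symmetricAlgebra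
  let B := b.smulTower (basis U (Module.finBasisOfFinrankEq k V hV))
  refine (DirectSum.finrank_of_basis (weight U) B (fun x => x.2.card + 2 * x.1.degree)
    (fun x => ?_) i).trans (Nat.card_degree_two_mul_add_card n i)
  rw [Module.Basis.smulTower_apply]
  exact HalfGraded.smul_mem (SymGrading.basis_mem_part _ x.1) (basis_mem U _ x.2)

section

variable {R : Type*} [CommRing R] [Algebra k R] {U : Submodule R (QuadForms k V R)}
  (R' : Type*) [CommRing R'] [Algebra k R'] [Algebra R R'] [IsScalarTower k R R']

/-- The Clifford algebra commutes with base change, as a graded algebra. -/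
theorem exists_gradedBaseChangeEquiv (hU : IsGrassmannianPoint n U) :
    ∃ φ : R' ⊗[R] Cliff U ≃ₐ[R'] Cliff (pullback (IsScalarTower.toAlgHom k R R') U),
      (∀ (i : ℕ) (c : Cliff U), c ∈ weight U i →
        φ (1 ⊗ₜ c) ∈ weight (pullback (IsScalarTower.toAlgHom k R R') U) i) ∧
      ∀ v, φ (1 ⊗ₜ gen U v) = gen _ v := by
  have := hU.projective_quotient
  obtain ⟨φ, hφ⟩ := exists_baseChangeEquiv R' hU
  refine ⟨φ, fun i c hc => ?_, hφ⟩
  refine map_tmul_mem (weight (pullback (IsScalarTower.toAlgHom k R R') U))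
    φ.toAlgHom (fun v => ?_) hc
  have h2 := gen_mem (pullback (IsScalarTower.toAlgHom k R R') U) v
  rw [← hφ v] at h2
  exact h2

theorem nonempty_weight_baseChange (hU : IsGrassmannianPoint n U) (i : ℕ) :
    Nonempty (R' ⊗[R] weight U i ≃ₗ[R'] weight (pullback (IsScalarTower.toAlgHom k R R') U) i) := by
  obtain ⟨φ, hφ, -⟩ := exists_gradedBaseChangeEquiv R' hU
  exact DirectSum.nonempty_baseChange_algEquiv (weight U)
    (weight (pullback (IsScalarTower.toAlgHom k R R') U)) φ hφ i

end

/-- The rank of a part of the Clifford algebra at `p` is its dimension for the fibre of the family over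
the residue field. -/
theorem rankAtStalk_weight {R : Type*} [CommRing R] [Algebra k R]
    {U : Submodule R (QuadForms k V R)} (hV : Module.finrank k V = n)
    (hU : IsGrassmannianPoint n U) (i : ℕ) (p : PrimeSpectrum R) :
    Module.rankAtStalk (weight U i) p = (n + i - 1).choose i := by
  have := hU.projective
  have := hU.finite
  have := finite_weight (U := U) i
  have := projective_weight (U := U) i
  obtain ⟨e⟩ := nonempty_weight_baseChange p.asIdeal.ResidueField hU i
  rw [Module.rankAtStalk_eq]
  exact e.finrank_eq.trans (finrank_weight hV (hU.pullback_toAlgHom p.asIdeal.ResidueField) i)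

end CliffordSpace

/-! ### The family of coordinate algebras -/

namespace CliffordSpace

open Quadrics

variable {k V : Type*} [Field k] [CharZero k] [AddCommGroup V] [Module k V]
  [FiniteDimensional k V] {n : ℕ}

section

variable {R : Type*} [CommRing R] [Algebra k R] {U : Submodule R (QuadForms k V R)}

theorem flat_coordAlgebra (hn : 0 < n) (hV : Module.finrank k V = n)
    (hU : IsGrassmannianPoint n U) : Module.Flat R (CoordAlgebra U) := by
  have := hU.projective
  have := hU.finite
  have := projective_cliff (U := U)
  exact Module.Flat.of_linearEquiv (coordAlgebraEquiv hn hV hU).symm.toLinearEquiv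

theorem finite_component (hn : 0 < n) (hV : Module.finrank k V = n)
    (hU : IsGrassmannianPoint n U) (i : ℕ) : Module.Finite R (Component U i) := by
  have := hU.projective
  have := hU.finite
  have := finite_weight (U := U) i
  exact Module.Finite.equiv (componentEquiv hn hV hU i)

theorem projective_component (hn : 0 < n) (hV : Module.finrank k V = n)
    (hU : IsGrassmannianPoint n U) (i : ℕ) : Module.Projective R (Component U i) := by
  have := hU.projective
  have := hU.finite
  have := projective_weight (U := U) i
  exact Module.Projective.of_equiv (componentEquiv hn hV hU i)

theorem rankAtStalk_component (hn : 0 < n) (hV : Module.finrank k V = n)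
    (hU : IsGrassmannianPoint n U) (i : ℕ) (p : PrimeSpectrum R) :
    Module.rankAtStalk (Component U i) p = (n + i - 1).choose i := by
  rw [← Module.rankAtStalk_eq_of_equiv (componentEquiv hn hV hU i)]
  exact rankAtStalk_weight hV hU i p

/-- The coordinate algebras of a family commute with base change. -/
theorem exists_coordAlgebra_baseChange (hn : 0 < n) (hV : Module.finrank k V = n)
    (hU : IsGrassmannianPoint n U) (R' : Type*) [CommRing R'] [Algebra k R'] [Algebra R R']
    [IsScalarTower k R R'] :
    ∃ φ : R' ⊗[R] CoordAlgebra U ≃ₐ[R']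
        CoordAlgebra (pullback (IsScalarTower.toAlgHom k R R') U),
      (∀ (i : ℕ) (x : Component U i), ∃ y, φ (1 ⊗ₜ incl U i x) = incl _ i y) ∧
      ∀ v : V, φ (1 ⊗ₜ vector U v) = vector _ v := by
  obtain ⟨φ, hφ, hv⟩ := exists_gradedBaseChangeEquiv R' hU
  have hU' := hU.pullback_toAlgHom R'
  let e : R' ⊗[R] CoordAlgebra U ≃ₐ[R'] R' ⊗[R] Cliff U :=
    Algebra.TensorProduct.congr AlgEquiv.refl (coordAlgebraEquiv hn hV hU).symm
  have he : ∀ c, e (1 ⊗ₜ coordAlgebraEquiv hn hV hU c) = 1 ⊗ₜ c := fun c =>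
    congrArg (1 ⊗ₜ[R] ·) ((coordAlgebraEquiv hn hV hU).symm_apply_apply c)
  let ψ := (e.trans φ).trans (coordAlgebraEquiv hn hV hU')
  have hψ : ∀ c, ψ (1 ⊗ₜ coordAlgebraEquiv hn hV hU c) =
      coordAlgebraEquiv hn hV hU' (φ (1 ⊗ₜ c)) := fun c =>
    congrArg (fun z => coordAlgebraEquiv hn hV hU' (φ z)) (he c)
  refine ⟨ψ, fun i x => ?_, fun v => ?_⟩
  · obtain ⟨c, rfl⟩ := (componentEquiv hn hV hU i).surjective x
    refine ⟨componentEquiv hn hV hU' i ⟨_, hφ i c c.2⟩, ?_⟩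
    rw [← coordAlgebraEquiv_apply, ← coordAlgebraEquiv_apply]
    exact hψ c
  · refine (congrArg (fun z => ψ (1 ⊗ₜ z)) (coordAlgebraEquiv_gen hn hV hU v).symm).trans ?_
    refine (hψ _).trans ?_
    exact (congrArg (coordAlgebraEquiv hn hV hU') (hv v)).trans (coordAlgebraEquiv_gen hn hV hU' v)

end

theorem hilbertSeries_eq (hn : 0 < n) (hV : Module.finrank k V = n)
    {U : Submodule k (QuadForms k V k)} (hU : IsGrassmannianPoint n U) :
    hilbertSeries U = ((1 - PowerSeries.X) ^ n)⁻¹ := by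
  have h1 : hilbertSeries U * (1 - PowerSeries.X) ^ n = 1 := by
    obtain ⟨m, rfl⟩ : ∃ m, n = m + 1 := ⟨n - 1, by omega⟩
    have h2 : hilbertSeries U = PowerSeries.mk fun i => ((m + i).choose m : ℚ) := by
      refine PowerSeries.ext fun i => ?_
      rw [hilbertSeries, PowerSeries.coeff_mk, PowerSeries.coeff_mk,
        ← (componentEquiv hn hV hU i).finrank_eq, finrank_weight hV hU,
        show m + 1 + i - 1 = m + i by omega, Nat.choose_symm_add]
    rw [h2, ← PowerSeries.mk_one_pow_eq_mk_choose_add, ← mul_pow,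
      PowerSeries.mk_one_mul_one_sub_eq_one, one_pow]
  refine (PowerSeries.eq_inv_iff_mul_eq_one ?_).2 h1
  simp

end CliffordSpace

theorem lemma4p2 {k : Type u} [Field k] [CharZero k] {V : Type*} [AddCommGroup V] [Module k V]
    [FiniteDimensional k V] (n : ℕ) (hn : 0 < n) (hV : Module.finrank k V = n) :
    -- the Hilbert series
    (∀ U : Submodule k (QuadraticForm k V), Module.finrank k U = n →
      Quadrics.EmptyIntersection U →
        (∀ i : ℕ, Module.Finite k (CliffordSpace.Component U i)) ∧
        CliffordSpace.hilbertSeries U = ((1 - PowerSeries.X) ^ n)⁻¹) ∧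
    -- the base of the family: its `k`-points, its stability under base change, its openness in the
    -- Grassmannian, its connectedness
    (∀ U : Submodule k (QuadraticForm k V), Quadrics.IsCliffordPoint n U ↔
      Module.finrank k U = n ∧ Quadrics.EmptyIntersection U) ∧
    (∀ (R R' : Type*) [CommRing R] [Algebra k R] [CommRing R'] [Algebra k R'] (e : R →ₐ[k] R')
      (U : Submodule R (Quadrics.QuadForms k V R)), Quadrics.IsCliffordPoint n U →
        Quadrics.IsCliffordPoint n (Quadrics.pullback e U)) ∧
    (∀ (R : Type*) [CommRing R] [Algebra k R] (U : Submodule R (Quadrics.QuadForms k V R)),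
      Quadrics.IsGrassmannianPoint n U →
        IsOpen {p : PrimeSpectrum R | Quadrics.EmptyIntersectionAt U p}) ∧
    (∀ U₀ U₁ : Submodule k (QuadraticForm k V), Quadrics.IsCliffordPoint n U₀ →
      Quadrics.IsCliffordPoint n U₁ →
        ∃ (R : Type u) (_ : CommRing R) (_ : IsDomain R) (_ : Algebra k R)
          (U : Submodule R (Quadrics.QuadForms k V R)) (e₀ e₁ : R →ₐ[k] k),
          Quadrics.IsCliffordPoint n U ∧ Quadrics.pullback e₀ U = U₀ ∧
            Quadrics.pullback e₁ U = U₁) ∧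
    -- the flat family of graded algebras over this base, with its compatibility with base change
    (∀ (R : Type*) [CommRing R] [Algebra k R] (U : Submodule R (Quadrics.QuadForms k V R)),
      Quadrics.IsCliffordPoint n U →
        Module.Flat R (CliffordSpace.CoordAlgebra U) ∧
        (∀ i : ℕ, Module.Finite R (CliffordSpace.Component U i) ∧
          Module.Projective R (CliffordSpace.Component U i) ∧
          ∀ p : PrimeSpectrum R,
            Module.rankAtStalk (CliffordSpace.Component U i) p = (n + i - 1).choose i) ∧
        ∀ (R' : Type*) [CommRing R'] [Algebra k R'] [Algebra R R'] [IsScalarTower k R R'],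
          ∃ φ : R' ⊗[R] CliffordSpace.CoordAlgebra U ≃ₐ[R']
              CliffordSpace.CoordAlgebra (Quadrics.pullback (IsScalarTower.toAlgHom k R R') U),
            (∀ (i : ℕ) (x : CliffordSpace.Component U i), ∃ y,
              φ (1 ⊗ₜ CliffordSpace.incl U i x) = CliffordSpace.incl _ i y) ∧
            ∀ v : V, φ (1 ⊗ₜ CliffordSpace.vector U v) = CliffordSpace.vector _ v) := by
  classical
  refine ⟨fun U h h' => ?_, fun U => Quadrics.isCliffordPoint_iff U,
    fun R R' _ _ _ _ e U hU => hU.pullback e, fun R _ _ U hU => ?_, fun U₀ U₁ h₀ h₁ => ?_,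
    fun R _ _ U hU => ?_⟩
  · have hU := ((Quadrics.isCliffordPoint_iff U).2 ⟨h, h'⟩).toIsGrassmannianPoint
    exact ⟨CliffordSpace.finite_component hn hV hU, CliffordSpace.hilbertSeries_eq hn hV hU⟩
  · exact Quadrics.isOpen_emptyIntersectionAt U
  · obtain ⟨W, hW, hWc⟩ := Quadrics.exists_family (n := n) (fun c => if c = 0 then U₀ else U₁)
      fun c hc => by
        split_ifs
        exacts [h₀, h₁]
    refine ⟨SemilocalLine k, inferInstance, inferInstance, inferInstance, W,
      SemilocalLine.evalAt 0 (Or.inl rfl), SemilocalLine.evalAt 1 (Or.inr rfl), hW, ?_, ?_⟩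
    · rw [hWc, if_pos rfl]
    · rw [hWc, if_neg one_ne_zero]
  · have hU := hU.toIsGrassmannianPoint
    exact ⟨CliffordSpace.flat_coordAlgebra hn hV hU,
      fun i => ⟨CliffordSpace.finite_component hn hV hU i,
        CliffordSpace.projective_component hn hV hU i,
        CliffordSpace.rankAtStalk_component hn hV hU i⟩,
      fun R' _ _ _ _ => CliffordSpace.exists_coordAlgebra_baseChange hn hV hU R'⟩
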